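/- **Setting.** Fix $m\ge 0$. An instance consists of a finite universe $\mathcal U$ of $n$ points, a pseudometric $d:\mathcal U\times\mathcal U\to\mathbb R_{\ge 0}$, possibly overlapping classes $\mathcal U_1,\dots,\mathcal U_m\subseteq\mathcal U$, and integers $0\le k_i\le|\mathcal U_i|$. A set $S\subseteq\mathcal U$ is *feasible* if $|S\cap\mathcal U_i|\ge k_i$ for all $i$. Let $\mathrm{div}(S)=\min\{d(u,v):u,v\in S,\ u\ne v\}$ (with $\min\emptyset=+\infty$), and let $\ell^*=\max\{\mathrm{div}(S): S \text{ feasible}\}$. For $L\subseteq[m]$ let $X_L$ be the set of points that lie in the classes $\mathcal U_i$, $i\in L$, and in no others. Let $M=\binom{m}{\lfloor m/2\rfloor}$. **The algorithm Fair$^+$-Flow.** The input is an instance, a guess $\gamma\in\mathbb R$, and guesses $c_L\in\mathbb Z_{\ge 0}$ for all non-empty $L\subseteq[m]$. Put $d_1=\frac{M\gamma}{3M-1}$ and $d_2=\frac{\gamma}{3M-1}$. 1. For all non-empty $L\subseteq[m]$, in order of decreasing size, let $Z_L$ be a maximal subset of $X_L$ such that every point of $Z_L$ has distance at least $d_1$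 from every other point of $Z_L\cup\bigcup_{L'\supsetneq L}Z_{L'}$. 2. Let $C_1,\dots,C_t$ be the connected components of the graph on $Z=\bigcup_L Z_L$ in which distinct points at distance $<d_2$ are adjacent. 3. Compute a maximum integral $a$–$b$ flow in the network with nodes $a$, $u_L$ ($\emptyset\neq L\subseteq[m]$), $v_1,\dots,v_t$, $b$ and with edges $(a,u_L)$ of capacity $c_L$, $(v_j,b)$ of capacity $1$, and $(u_L,v_j)$ of capacity $1$ for certain pairs $(L,j)$. Two rules for these pairs are considered: (E) $Z_L\cap C_j\ne\emptyset$; (S) $Z_{L'}\cap C_j\neq\emptyset$ for some $L'\supseteq L$. 4. If the size of the flow is less than $\sum_L c_L$, abort. Otherwise return a set that consists of one point of $C_j\cap\bigcap_{i\in L}\mathcal U_i$ for every edge $(u_L,v_j)$ that carries flow. Call the guess $c$ *admissible* if $\sum_{L\ni i}c_L\ge k_i$ for all $i\in[m]$. **Theorem.** For each of the two rules the following holds. (a) For all $\gamma$ and $c$ the algorithm can be carried out. If $c$ is admissible then for every $\gamma\in\mathbb R$ (in particular for $\gamma>\ell^*$), and whatever choices are made in steps 1, 3 and 4, the algorithm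 aborts or returns a feasible set whose points are pairwise at least $\frac{\gamma}{3M-1}$ apart. (b) Let $\gamma\le\ell^*$. Then for every choice of the sets $Z_L$ there is an admissible guess $c$ for which the algorithm, whatever the remaining choices, returns a feasible set whose points are pairwise at least $\frac{\gamma}{3M-1}$ apart. Under rule (S), the algorithm returns such a set, whatever choices are made, for every guess of the form $c_L=|O\cap X_L|$ with $O$ an optimal solution. (c) For the fixed number $m$ of classes, there is an algorithm that, on every instance with $n$ points, runs in time polynomial in $n$ and outputs a feasible set $S$ with $\mathrm{div}(S)\ge\frac{1}{3M-1}\,\ell^*$; moreover $S$ is a set that Fair$^+$-Flow may return for some $\gamma$ and some admissible $c$. Here time is the number of steps of a uniform random access machine with natural and real registers that has read access to $n$, the $k_i$, the class memberships and the distances, whose operations are addition, subtraction, comparison and indirect addressing at unit cost, and whose only constants are natural numbers. -/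

import Mathlib

namespace FairDiv

/-! ### The problem -/

/-- An instance with `m` possibly overlapping classes over a universe of `n` points:
a pseudometric, the classes and the fairness constraints `k i ≤ |U i|`. -/
structure Instance (m n : ℕ) where
  d : Fin n → Fin n → ℝ
  d_nonneg : ∀ x y, 0 ≤ d x y
  d_self : ∀ x, d x x = 0
  d_symm : ∀ x y, d x y = d y x
  d_triangle : ∀ x y z, d x z ≤ d x y + d y z
  U : Fin m → Finset (Fin n)
  k : Fin m → ℕ
  k_le : ∀ i, k i ≤ (U i).card

/-- The number `M = C(m, ⌊m/2⌋)`. -/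
def bigM (m : ℕ) : ℕ := m.choose (m / 2)

/-- Colours: the non-empty sets of classes. -/
abbrev Colour (m : ℕ) := {L : Finset (Fin m) // L.Nonempty}

section
variable {m n : ℕ} (I : Instance m n)

/-- `S` contains at least `k i` points of every class. -/
def Feasible (S : Finset (Fin n)) : Prop := ∀ i, I.k i ≤ (S ∩ I.U i).card

/-- The minimum distance of two distinct points of `S`
(`⊤` if there are no two distinct points, as a minimum over the empty set). -/
noncomputable def diversity (S : Finset (Fin n)) : EReal :=
  ⨅ (x ∈ S) (y ∈ S) (_ : x ≠ y), (I.d x y : EReal)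

/-- The optimum fair diversity. -/
noncomputable def opt : EReal := ⨆ (S : Finset (Fin n)) (_ : Feasible I S), diversity I S

def IsOptimal (O : Finset (Fin n)) : Prop := Feasible I O ∧ diversity I O = opt I

/-- All points of `S` are at least `r` apart. -/
def Apart (r : ℝ) (S : Finset (Fin n)) : Prop := ∀ x ∈ S, ∀ y ∈ S, x ≠ y → r ≤ I.d x y

/-- `X_L`: the points that lie in the classes of `L` and in no others. -/
def X (L : Finset (Fin m)) : Finset (Fin n) :=
  Finset.univ.filter fun x => ∀ i, x ∈ I.U i ↔ i ∈ L

/-- The colour counts `|O ∩ X_L|` of a set `O`. -/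
def counts (O : Finset (Fin n)) (L : Colour m) : ℕ := (O ∩ X I L.1).card

/-- A guess of the counts that is consistent with the fairness constraints. -/
def Admissible (c : Colour m → ℕ) : Prop :=
  ∀ i, I.k i ≤ ∑ L ∈ Finset.univ.filter (fun L : Colour m => i ∈ L.1), c L

end

/-! ### Integral flows -/

structure Network (V : Type) where
  cap : V → V → ℕ
  source : V
  sink : V

namespace Network
variable {V : Type} [Fintype V] (N : Network V)

/-- Integral flows: capacity constraints, and conservation at the inner nodes. -/
def IsFlow (f : V → V → ℕ) : Prop :=
  (∀ u v, f u v ≤ N.cap u v) ∧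
    ∀ v, v ≠ N.source → v ≠ N.sink → ∑ u, f u v = ∑ w, f v w

/-- The net amount that leaves the source. -/
def value (f : V → V → ℕ) : ℤ := ∑ v, (f N.source v : ℤ) - ∑ v, (f v N.source : ℤ)

def IsMaxFlow (f : V → V → ℕ) : Prop :=
  N.IsFlow f ∧ ∀ g, N.IsFlow g → N.value g ≤ N.value f

end Network

/-! ### The algorithm Fair⁺-Flow -/

section
variable {m n : ℕ} (I : Instance m n) (γ : ℝ)

noncomputable def d1 (m : ℕ) (γ : ℝ) : ℝ := bigM m * γ / (3 * bigM m - 1)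

noncomputable def d2 (m : ℕ) (γ : ℝ) : ℝ := γ / (3 * bigM m - 1)

/-- A possible result of the selection phase: every `Z L` is a maximal subset of `X_L` whose
points are at least `d1` from every other point of `Z L` and of the sets `Z L'`, `L ⊂ L'`.
(The condition on `Z L` involves only the sets `Z L'` chosen in earlier rounds.) -/
def IsSelection (Z : Colour m → Finset (Fin n)) : Prop :=
  ∀ L : Colour m, Maximal
    (fun A : Finset (Fin n) => A ⊆ X I L.1 ∧
      ∀ x ∈ A, ∀ y, (y ∈ A ∨ ∃ L' : Colour m, L.1 ⊂ L'.1 ∧ y ∈ Z L') →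
        x ≠ y → d1 m γ ≤ I.d x y)
    (Z L)

/-- The selected points. -/
abbrev Selected (Z : Colour m → Finset (Fin n)) := {x : Fin n // ∃ L, x ∈ Z L}

/-- The graph `G_Z`: selected points are joined if they are less than `d2` apart. -/
def closeGraph (Z : Colour m → Finset (Fin n)) : SimpleGraph (Selected Z) where
  Adj x y := x ≠ y ∧ I.d x.1 y.1 < d2 m γ
  symm := ⟨fun x y h => ⟨h.1.symm, by rw [I.d_symm]; exact h.2⟩⟩
  loopless := ⟨fun _ h => h.1 rfl⟩

abbrev Comp (Z : Colour m → Finset (Fin n)) := (closeGraph I γ Z).ConnectedComponent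

noncomputable instance (Z : Colour m → Finset (Fin n)) : Fintype (Comp I γ Z) :=
  Fintype.ofFinite _

/-- When is a point of `Z_{L'}` in the component `C_j` a reason for an edge `(u_L, v_j)`?
`exact`: if `L' = L`; `atLeast`: if `L ⊆ L'`, that is, if it lies in all classes of `L`. -/
inductive EdgeRule
  | exact
  | atLeast

def EdgeRule.Allows : EdgeRule → Colour m → Colour m → Prop
  | .exact, L, L' => L' = L
  | .atLeast, L, L' => L.1 ⊆ L'.1

/-- The nodes of the flow network: `a`, the `u_L`, the `v_j`, and `b`. -/
abbrev Node (Z : Colour m → Finset (Fin n)) := Unit ⊕ Colour m ⊕ Comp I γ Z ⊕ Unit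

abbrev nodeA (Z : Colour m → Finset (Fin n)) : Node I γ Z := .inl ()
abbrev nodeU (Z : Colour m → Finset (Fin n)) (L : Colour m) : Node I γ Z := .inr (.inl L)
abbrev nodeV (Z : Colour m → Finset (Fin n)) (j : Comp I γ Z) : Node I γ Z :=
  .inr (.inr (.inl j))
abbrev nodeB (Z : Colour m → Finset (Fin n)) : Node I γ Z := .inr (.inr (.inr ()))

/-- The component `j` gives rise to an edge from `u_L`. -/
def HasEdge (R : EdgeRule) (Z : Colour m → Finset (Fin n)) (L : Colour m) (j : Comp I γ Z) :
    Prop :=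
  ∃ x : Selected Z, (closeGraph I γ Z).connectedComponentMk x = j ∧
    ∃ L' : Colour m, R.Allows L L' ∧ x.1 ∈ Z L'

open Classical in
noncomputable def flowNetwork (R : EdgeRule) (c : Colour m → ℕ)
    (Z : Colour m → Finset (Fin n)) : Network (Node I γ Z) where
  cap
    | .inl _, .inr (.inl L) => c L
    | .inr (.inl L), .inr (.inr (.inl j)) => if HasEdge I γ R Z L j then 1 else 0
    | .inr (.inr (.inl _)), .inr (.inr (.inr _)) => 1
    | _, _ => 0
  source := nodeA I γ Z
  sink := nodeB I γ Z

/-- `Outcome I γ R c Z r`: with selection `Z` and guesses `γ`, `c`, the flow phase may end with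
the result `r`, where `none` means that it aborts. A maximum flow is computed; if its size is less
than `∑ L, c L`, the algorithm aborts; otherwise it returns the set `S` that contains, for every
edge `(u_L, v_j)` with flow, one point of `C_j` that lies in all the classes of `L`. -/
def Outcome (R : EdgeRule) (c : Colour m → ℕ) (Z : Colour m → Finset (Fin n)) :
    Option (Finset (Fin n)) → Prop
  | none => ∃ f, (flowNetwork I γ R c Z).IsMaxFlow f ∧
      (flowNetwork I γ R c Z).value f < ∑ L, (c L : ℤ)
  | some S => ∃ f, (flowNetwork I γ R c Z).IsMaxFlow f ∧
      ∑ L, (c L : ℤ) ≤ (flowNetwork I γ R c Z).value f ∧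
      ∃ pick : Colour m → Comp I γ Z → Fin n,
        (∀ L j, 0 < f (nodeU I γ Z L) (nodeV I γ Z j) →
          (∃ x : Selected Z, x.1 = pick L j ∧ (closeGraph I γ Z).connectedComponentMk x = j) ∧
          ∀ i ∈ L.1, pick L j ∈ I.U i) ∧
        ∀ x, x ∈ S ↔ ∃ L j, 0 < f (nodeU I γ Z L) (nodeV I γ Z j) ∧ pick L j = x

/-- `r` is a possible result of Fair⁺-Flow on the guesses `γ`, `c`. -/
def FairPlusFlow (R : EdgeRule) (c : Colour m → ℕ) (r : Option (Finset (Fin n))) : Prop :=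
  ∃ Z, IsSelection I γ Z ∧ Outcome I γ R c Z r

end

/-! ### The machine model

A random access machine over the naturals and the reals, programmed in a while-language. It has
arrays of naturals and arrays of reals, and read access to the input. Its only
arithmetical operations are addition and subtraction (truncated on `ℕ`), its only constants
are naturals, and reals are inspected only by comparing them. Every operation costs one step.
-/

/-- Natural-valued expressions. -/
inductive NatExp
  | lit (c : ℕ)
  /-- the number `n` of points -/
  | size
  /-- the fairness constraint `k_i` -/
  | quota (i : NatExp)
  /-- `1` if the point `x` is in the class `U_i`, and `0` otherwise -/
  | member (x i : NatExp)
  /-- the entry with index `i` of the natural array `a` -/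
  | get (a : ℕ) (i : NatExp)
  | add (e f : NatExp)
  | sub (e f : NatExp)

/-- Real-valued expressions. -/
inductive RealExp
  | lit (c : ℕ)
  /-- the distance of two points -/
  | dist (x y : NatExp)
  /-- the entry with index `i` of the real array `a` -/
  | get (a : ℕ) (i : NatExp)
  | add (e f : RealExp)
  | sub (e f : RealExp)

inductive Test
  | natLe (e f : NatExp)
  | realLe (e f : RealExp)
  | not (t : Test)

inductive Program
  | skip
  /-- array `a` of naturals, entry `i`, receives the value of `e` -/
  | setNat (a : ℕ) (i e : NatExp)
  /-- array `a` of reals, entry `i`, receives the value of `e` -/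
  | setReal (a : ℕ) (i : NatExp) (e : RealExp)
  | seq (p q : Program)
  | ite (t : Test) (p q : Program)
  | loop (t : Test) (p : Program)

/-- The contents of the memory. -/
structure Memory where
  nat : ℕ → ℕ → ℕ
  real : ℕ → ℕ → ℝ

def Memory.setNat (s : Memory) (a i v : ℕ) : Memory :=
  ⟨Function.update s.nat a (Function.update (s.nat a) i v), s.real⟩

def Memory.setReal (s : Memory) (a i : ℕ) (v : ℝ) : Memory :=
  ⟨s.nat, Function.update s.real a (Function.update (s.real a) i v)⟩

def Memory.init : Memory := ⟨fun _ _ => 0, fun _ _ => 0⟩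

def NatExp.cost : NatExp → ℕ
  | .lit _ => 1
  | .size => 1
  | .quota i => i.cost + 1
  | .member x i => x.cost + i.cost + 1
  | .get _ i => i.cost + 1
  | .add e f => e.cost + f.cost + 1
  | .sub e f => e.cost + f.cost + 1

def RealExp.cost : RealExp → ℕ
  | .lit _ => 1
  | .dist x y => x.cost + y.cost + 1
  | .get _ i => i.cost + 1
  | .add e f => e.cost + f.cost + 1
  | .sub e f => e.cost + f.cost + 1

def Test.cost : Test → ℕ
  | .natLe e f => e.cost + f.cost + 1
  | .realLe e f => e.cost + f.cost + 1
  | .not t => t.cost + 1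

section
variable {m n : ℕ} (I : Instance m n)

def NatExp.eval (s : Memory) : NatExp → ℕ
  | .lit c => c
  | .size => n
  | .quota i => if h : i.eval s < m then I.k ⟨i.eval s, h⟩ else 0
  | .member x i =>
      if h : x.eval s < n ∧ i.eval s < m then
        if (⟨x.eval s, h.1⟩ : Fin n) ∈ I.U ⟨i.eval s, h.2⟩ then 1 else 0
      else 0
  | .get a i => s.nat a (i.eval s)
  | .add e f => e.eval s + f.eval s
  | .sub e f => e.eval s - f.eval s

noncomputable def RealExp.eval (s : Memory) : RealExp → ℝ
  | .lit c => c
  | .dist x y =>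
      if h : x.eval I s < n ∧ y.eval I s < n then
        I.d ⟨x.eval I s, h.1⟩ ⟨y.eval I s, h.2⟩
      else 0
  | .get a i => s.real a (i.eval I s)
  | .add e f => e.eval s + f.eval s
  | .sub e f => e.eval s - f.eval s

def Test.Holds (s : Memory) : Test → Prop
  | .natLe e f => e.eval I s ≤ f.eval I s
  | .realLe e f => e.eval I s ≤ f.eval I s
  | .not t => ¬ t.Holds s

/-- `Exec I p s t s'`: on the input `I`, started in `s`, the program `p` halts after exactly `t`
steps in `s'`. -/
inductive Exec : Program → Memory → ℕ → Memory → Prop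
  | skip (s) : Exec .skip s 1 s
  | setNat (s a i e) : Exec (.setNat a i e) s (i.cost + e.cost + 1)
      (s.setNat a (i.eval I s) (e.eval I s))
  | setReal (s a i e) : Exec (.setReal a i e) s (i.cost + e.cost + 1)
      (s.setReal a (i.eval I s) (e.eval I s))
  | seq {p q s t₁ s₁ t₂ s₂} : Exec p s t₁ s₁ → Exec q s₁ t₂ s₂ →
      Exec (.seq p q) s (t₁ + t₂) s₂
  | ite_true {b p q s t s'} : b.Holds I s → Exec p s t s' →
      Exec (.ite b p q) s (b.cost + t) s'
  | ite_false {b p q s t s'} : ¬ b.Holds I s → Exec q s t s' →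
      Exec (.ite b p q) s (b.cost + t) s'
  | loop_stop {b p s} : ¬ b.Holds I s → Exec (.loop b p) s b.cost s
  | loop_step {b p s t₁ s₁ t₂ s₂} : b.Holds I s → Exec p s t₁ s₁ →
      Exec (.loop b p) s₁ t₂ s₂ → Exec (.loop b p) s (b.cost + t₁ + t₂) s₂

end

/-- The set that a halted program outputs: its characteristic function is in array `0`. -/
def output (n : ℕ) (s : Memory) : Finset (Fin n) :=
  Finset.univ.filter fun x => s.nat 0 x.1 ≠ 0

/-- On input `I` the program outputs `S` after at most `T` steps. -/
def Computes {m n : ℕ} (I : Instance m n) (p : Program) (T : ℕ) (S : Finset (Fin n)) : Prop :=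
  ∃ t s, Exec I p Memory.init t s ∧ t ≤ T ∧ output n s = S

end FairDiv

namespace FairDiv

/-! ### Selections and the components of the graph of close points -/

section
variable {m n : ℕ}

/-! Here `d1 = M * d2` and `γ = (3M - 1) * d2`. Selected points with nested colours are at least
`d1` apart, whereas any two of `M + 1` consecutive points of a path in the graph of close points are
less than `M * d2 = d1` apart. The colours of such points would therefore form an antichain of `M +
1` sets of classes, against Sperner's theorem (`IsSelection.length_lt`). So a component has diameter
at most `(M - 1) * d2`.

By maximality, every coloured point is selected or less than `d1` from a selected point that lies in
at least the same classes (`IsSelection.exists_close`). If two points at distance at least `γ > 0`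
were moved into one component in this way, their distance would be less than `d1 + (M - 1) * d2 + d1
= γ`. Hence an optimal solution moves injectively to components without losing a class
(`IsSelection.exists_move`). This is an assignment that saturates the source, so no maximum flow can
lead to an abort (`returns_of_assignment`). Rule (S) allows the units to leave from the original
colours; under both rules they may leave from the colours of the moved points. Conversely, for every
`γ` a saturating flow for an admissible guess gives a feasible set with at most one point in each
component, and points of different components are at least `d2` apart (`outcome_sound`).

For the program no flow has to be computed: every feasible set of selected points with at most one
point per component is a possible output for some admissible guess (`IsTransversal.exists_outcome`).
A dynamic program over the components keeps one such set for every vector of class counts. The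
vectors are written in base `n + 1`, which gives `(n + 1) ^ m` states, and the state decides
feasibility (`feasibleN_of_sum_weightN_eq`). The optimum is a distance or infinite
(`opt_eq_top_or_eq_dist`), so all distances and one huge number are tried as `γ`, and a feasible set
with the largest successful guess is kept; a guess above the optimum does no harm, because soundness
holds for every `γ`. The time bound is read off the syntax, since every loop is bounded by a
constant, `n` or `(n + 1) ^ m` (`Code.exists_exec`). -/

theorem bigM_pos (m : ℕ) : 0 < bigM m := Nat.choose_pos (Nat.div_le_self _ _)

theorem one_le_bigM_cast (m : ℕ) : (1 : ℝ) ≤ bigM m := by exact_mod_cast bigM_pos m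

theorem denominator_pos (m : ℕ) : (0 : ℝ) < 3 * bigM m - 1 := by
  have := one_le_bigM_cast m
  linarith

theorem d1_eq (m : ℕ) (γ : ℝ) : d1 m γ = bigM m * d2 m γ := by
  unfold d1 d2
  ring

theorem gamma_eq (m : ℕ) (γ : ℝ) : γ = (3 * bigM m - 1) * d2 m γ := by
  unfold d2
  field_simp [(denominator_pos m).ne']

variable (I : Instance m n) (γ : ℝ)

/-- The set of classes that contain the point `x`. -/
def colourOf (x : Fin n) : Finset (Fin m) := Finset.univ.filter fun i => x ∈ I.U i

variable {I} in
theorem mem_colourOf {x : Fin n} {i : Fin m} : i ∈ colourOf I x ↔ x ∈ I.U i := by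
  simp [colourOf]

variable {I} in
theorem mem_X_iff {x : Fin n} {L : Finset (Fin m)} : x ∈ X I L ↔ colourOf I x = L := by
  simp [X, Finset.ext_iff, mem_colourOf]

/-- The condition on one colour refers only to strictly larger colours, so the rounds are a
well-founded recursion. In each round a maximal set exists by finiteness, as `∅` qualifies. -/
theorem exists_selection : ∃ Z, IsSelection I γ Z := by
  have key : ∀ (L : Colour m) (rec : ∀ L' : Colour m, L < L' → Finset (Fin n)),
      ∃ B : Finset (Fin n), Maximal (fun A : Finset (Fin n) => A ⊆ X I L.1 ∧
        ∀ x ∈ A, ∀ y, (y ∈ A ∨ ∃ (L' : Colour m) (h : L < L'), y ∈ rec L' h) →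
          x ≠ y → d1 m γ ≤ I.d x y) B := by
    intro L rec
    exact Set.Finite.exists_maximal (s := {A : Finset (Fin n) | A ⊆ X I L.1 ∧
        ∀ x ∈ A, ∀ y, (y ∈ A ∨ ∃ (L' : Colour m) (h : L < L'), y ∈ rec L' h) →
          x ≠ y → d1 m γ ≤ I.d x y}) (Set.toFinite _) ⟨∅, by simp⟩
  choose F hF using key
  have wf : WellFounded (fun a b : Colour m => b < a) := wellFounded_gt
  refine ⟨wf.fix (fun L rec => F L fun L' h => rec L' h), fun L => ?_⟩
  have h := hF L (fun L' _ => wf.fix (fun L rec => F L fun L' h => rec L' h) L')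
  rw [wf.fix_eq]
  convert h using 9
  funext L'
  exact propext ⟨fun h => ⟨h.1, h.2⟩, fun ⟨h1, h2⟩ => ⟨h1, h2⟩⟩

variable {I γ} {Z : Colour m → Finset (Fin n)}

theorem IsSelection.colourOf_eq (hZ : IsSelection I γ Z) {L : Colour m} {x : Fin n}
    (hx : x ∈ Z L) : colourOf I x = L.1 :=
  mem_X_iff.1 ((hZ L).1.1 hx)

theorem IsSelection.le_dist (hZ : IsSelection I γ Z) {L L' : Colour m} {x y : Fin n}
    (hx : x ∈ Z L) (hy : y ∈ Z L') (hL : L.1 ⊆ L'.1) (hxy : x ≠ y) : d1 m γ ≤ I.d x y := by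
  refine (hZ L).1.2 x hx y ?_ hxy
  rcases hL.eq_or_ssubset with h | h
  · exact Or.inl (Subtype.ext h ▸ hy)
  · exact Or.inr ⟨L', h, hy⟩

/-- Every coloured point is selected or close to a selected point of a larger colour. -/
theorem IsSelection.exists_close (hZ : IsSelection I γ Z) {L : Colour m} {x : Fin n}
    (hx : colourOf I x = L.1) :
    ∃ (L' : Colour m) (y : Fin n), L.1 ⊆ L'.1 ∧ y ∈ Z L' ∧ (x = y ∨ I.d x y < d1 m γ) := by
  by_contra! hcon
  have hxZ : x ∉ Z L := fun h => (hcon L x subset_rfl h).1 rfl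
  have hfar : ∀ y, (y ∈ Z L ∨ ∃ L' : Colour m, L.1 ⊂ L'.1 ∧ y ∈ Z L') → d1 m γ ≤ I.d x y := by
    rintro y (h | ⟨L', h, hy⟩)
    · exact (hcon L y subset_rfl h).2
    · exact (hcon L' y h.subset hy).2
  -- If no such point existed, `x` could be added to `Z L`, against maximality.
  have hins := (hZ L).2 (y := insert x (Z L)) ⟨?_, ?_⟩ (Finset.subset_insert _ _)
  · exact hxZ (hins (Finset.mem_insert_self _ _))
  · exact Finset.insert_subset (mem_X_iff.2 hx) (hZ L).1.1
  · intro a ha b hb hab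
    rw [Finset.mem_insert] at ha
    rcases ha with rfl | ha
    · refine hfar b (hb.imp_left fun h => ?_)
      exact (Finset.mem_insert.1 h).resolve_left (Ne.symm hab)
    · rcases hb with hb | hb
      · rcases Finset.mem_insert.1 hb with rfl | hb
        · rw [I.d_symm]
          exact hfar a (Or.inl ha)
        · exact (hZ L).1.2 a ha b (Or.inl hb) hab
      · exact (hZ L).1.2 a ha b (Or.inr hb) hab

/-- A separated and covering set of coloured points is a possible result of the selection. -/
theorem isSelection_of_separated_of_cover {A : Finset (Fin n)}
    (hsep : ∀ x ∈ A, ∀ y ∈ A, x ≠ y → colourOf I x ⊆ colourOf I y → d1 m γ ≤ I.d x y)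
    (hcover : ∀ x, (colourOf I x).Nonempty → x ∉ A →
      ∃ y ∈ A, colourOf I x ⊆ colourOf I y ∧ I.d x y < d1 m γ) :
    IsSelection I γ fun L => A.filter fun x => colourOf I x = L.1 := by
  intro L
  refine ⟨⟨fun x hx => mem_X_iff.2 (Finset.mem_filter.1 hx).2, ?_⟩, ?_⟩
  · intro x hx y hy hxy
    rw [Finset.mem_filter] at hx
    rcases hy with hy | ⟨L', hL', hy⟩
    · rw [Finset.mem_filter] at hy
      exact hsep x hx.1 y hy.1 hxy (by rw [hx.2, hy.2])
    · rw [Finset.mem_filter] at hy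
      exact hsep x hx.1 y hy.1 hxy (by rw [hx.2, hy.2]; exact hL'.subset)
  -- A point of a larger candidate `B` outside `A` is too close to a covering point of `A`, which
  -- lies in `B` or in the set of a strictly larger colour; `B` admits neither.
  · rintro B ⟨hBX, hB⟩ hle x hx
    have hxL := mem_X_iff.1 (hBX hx)
    rw [Finset.mem_filter]
    refine ⟨?_, hxL⟩
    by_contra hxA
    obtain ⟨y, hyA, hsub, hlt⟩ := hcover x (hxL ▸ L.2) hxA
    refine absurd (hB x hx y ?_ fun h => hxA (h ▸ hyA)) (not_le.2 hlt)
    rw [hxL] at hsub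
    rcases hsub.eq_or_ssubset with h | h
    · exact Or.inl (hle (Finset.mem_filter.2 ⟨hyA, h.symm⟩))
    · exact Or.inr ⟨⟨colourOf I y, L.2.mono hsub⟩, h, Finset.mem_filter.2 ⟨hyA, rfl⟩⟩

/-- Triangle inequality along the walk; every edge contributes less than `d2`, and `i < j` makes the
bound strict. -/
theorem dist_getVert_lt {u v : Selected Z} (p : (closeGraph I γ Z).Walk u v) {i j : ℕ}
    (hij : i < j) (hj : j ≤ p.length) :
    I.d (p.getVert i).1 (p.getVert j).1 < ((j : ℝ) - i) * d2 m γ := by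
  induction j, hij using Nat.le_induction with
  | base =>
    have := (p.adj_getVert_succ (i := i) (by lia)).2
    push_cast
    linarith
  | succ k hk ih =>
    have h1 := (p.adj_getVert_succ (i := k) (by lia)).2
    have h2 := ih (by lia)
    have h3 := I.d_triangle (p.getVert i).1 (p.getVert k).1 (p.getVert (k + 1)).1
    push_cast
    linarith

/-- A path in the graph of close points has at most `M` points, by Sperner's theorem. -/
theorem IsSelection.length_lt (hZ : IsSelection I γ Z) {u v : Selected Z}
    (p : (closeGraph I γ Z).Walk u v) (hp : p.IsPath) : p.length < bigM m := by
  by_contra! hlen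
  choose col hcol using fun x : Selected Z => x.2
  -- The first `M + 1` points of the path are pairwise less than `d1` apart, so separation excludes
  -- nested colours.
  have key : ∀ i j : Fin (bigM m + 1), i ≠ j →
      ¬ (col (p.getVert i)).1 ⊆ (col (p.getVert j)).1 := by
    intro i j hij hsub
    have hi : (i : ℕ) ≤ bigM m := by lia
    have hj : (j : ℕ) ≤ bigM m := by lia
    have hne : p.getVert i ≠ p.getVert j := fun h => hij (Fin.ext
      (hp.getVert_injOn (show (i : ℕ) ≤ p.length by lia) (show (j : ℕ) ≤ p.length by lia) h))
    have hfar := hZ.le_dist (hcol _) (hcol _) hsub fun h => hne (Subtype.ext h)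
    have aux : ∀ a b : ℕ, a < b → b ≤ bigM m →
        I.d (p.getVert a).1 (p.getVert b).1 < d1 m γ := by
      intro a b hab hb
      have h1 := dist_getVert_lt p hab (hb.trans hlen)
      have h2 : (b : ℝ) - a ≤ bigM m := by
        have : (b : ℝ) ≤ bigM m := by exact_mod_cast hb
        have : (0 : ℝ) ≤ a := Nat.cast_nonneg a
        linarith
      have h4 : (0 : ℝ) < b - a := by
        have : (a : ℝ) < b := by exact_mod_cast hab
        linarith
      -- Nothing is assumed about the sign of `γ`: a distance below a positive multiple of `d2`
      -- forces `d2` to be positive.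
      have h3 : 0 < d2 m γ := by
        have := lt_of_le_of_lt (I.d_nonneg _ _) h1
        exact pos_of_mul_pos_right this h4.le
      rw [d1_eq]
      nlinarith
    rcases lt_or_gt_of_ne (fun h => hij (Fin.ext h) : (i : ℕ) ≠ j) with h | h
    · exact absurd (aux i j h hj) (not_lt.2 hfar)
    · rw [I.d_symm] at hfar
      exact absurd (aux j i h hi) (not_lt.2 hfar)
  have hinj : Function.Injective fun i : Fin (bigM m + 1) => (col (p.getVert i)).1 := by
    intro i j h
    by_contra hij
    exact key i j hij (Finset.Subset.antisymm_iff.1 h).1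
  have hanti : IsAntichain (· ⊆ ·) (SetLike.coe
      (Finset.univ.image fun i : Fin (bigM m + 1) => (col (p.getVert i)).1)) := by
    intro a ha b hb hab
    obtain ⟨i, -, rfl⟩ := Finset.mem_image.1 (Finset.mem_coe.1 ha)
    obtain ⟨j, -, rfl⟩ := Finset.mem_image.1 (Finset.mem_coe.1 hb)
    exact key i j fun h => hab (by rw [h])
  have := hanti.sperner
  rw [Finset.card_image_of_injective _ hinj, Finset.card_univ, Fintype.card_fin,
    Fintype.card_fin] at this
  exact absurd this (by unfold bigM; lia)

/-- Points of one component are equal or less than `M * d2` apart. -/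
theorem IsSelection.dist_of_reachable (hZ : IsSelection I γ Z) {u v : Selected Z}
    (h : (closeGraph I γ Z).Reachable u v) :
    u = v ∨ (0 < d2 m γ ∧ I.d u.1 v.1 ≤ (bigM m - 1) * d2 m γ) := by
  obtain ⟨p, hp⟩ := h.exists_isPath
  have hlen := hZ.length_lt p hp
  rcases Nat.eq_zero_or_pos p.length with h0 | h0
  · exact Or.inl (SimpleGraph.Walk.eq_of_length_eq_zero h0)
  · right
    have h1 := dist_getVert_lt p h0 le_rfl
    rw [p.getVert_zero, p.getVert_length] at h1
    have h2 : (p.length : ℝ) + 1 ≤ bigM m := by exact_mod_cast hlen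
    have h3 : (1 : ℝ) ≤ p.length := by exact_mod_cast h0
    have h4 : 0 < d2 m γ := by
      have := lt_of_le_of_lt (I.d_nonneg _ _) h1
      exact pos_of_mul_pos_right this (by push_cast; linarith)
    refine ⟨h4, h1.le.trans ?_⟩
    push_cast
    nlinarith

/-- Points that are `γ` apart are close to different components. -/
theorem IsSelection.eq_of_reachable (hZ : IsSelection I γ Z) {x x' : Fin n} {y y' : Selected Z}
    (hx : x = y.1 ∨ I.d x y.1 < d1 m γ) (hx' : x' = y'.1 ∨ I.d x' y'.1 < d1 m γ)
    (hfar : x ≠ x' → γ ≤ I.d x x') (h : (closeGraph I γ Z).Reachable y y') : x = x' := by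
  by_contra hne
  have hfar := hfar hne
  have hγ := gamma_eq m γ
  have hM := one_le_bigM_cast m
  rw [d1_eq] at hx hx'
  -- If `d2 ≤ 0` no distance is below `d1` or `d2`: both points are selected and the graph has no
  -- edges, so reachability is equality.
  rcases le_or_gt (d2 m γ) 0 with h0 | h0
  · have aux : ∀ a b, ¬ I.d a b < bigM m * d2 m γ := fun a b hab => by
      have := I.d_nonneg a b
      nlinarith
    have e : y = y' := (hZ.dist_of_reachable h).resolve_right fun h => absurd h.1 (not_lt.2 h0)
    exact hne ((hx.resolve_right (aux _ _)).trans
      (e ▸ (hx'.resolve_right (aux _ _)).symm))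
  · have aux : ∀ a b, (a = b ∨ I.d a b < bigM m * d2 m γ) → I.d a b < bigM m * d2 m γ := by
      rintro a b (rfl | h)
      · rw [I.d_self]
        positivity
      · exact h
    have h1 := aux _ _ hx
    have h2 := aux _ _ hx'
    have h3 : I.d y.1 y'.1 ≤ (bigM m - 1) * d2 m γ := by
      rcases hZ.dist_of_reachable h with rfl | h
      · rw [I.d_self]
        exact mul_nonneg (by linarith) h0.le
      · exact h.2
    -- The route from `x` to `y`, `y'` and `x'` is shorter than `d1 + (M - 1) * d2 + d1 = (3M - 1) *
    -- d2 = γ`.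
    have h4 := I.d_triangle x y.1 x'
    have h5 := I.d_triangle y.1 y'.1 x'
    rw [I.d_symm y'.1 x'] at h5
    nlinarith

end

/-! ### Flows -/

/-- Integral flows are bounded by the capacities, so there are finitely many, and zero is one of
them. -/
theorem Network.exists_isMaxFlow {V : Type} [Fintype V] (N : Network V) :
    ∃ f, N.IsMaxFlow f := by
  classical
  have hfin : {f | N.IsFlow f}.Finite :=
    (Set.finite_Icc (0 : V → V → ℕ) N.cap).subset fun f hf =>
      ⟨fun _ _ => Nat.zero_le _, fun u v => hf.1 u v⟩
  obtain ⟨f, hf, hmax⟩ := Set.exists_max_image _ N.value hfin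
    ⟨fun _ _ => 0, fun _ _ => Nat.zero_le _, fun _ _ _ => by simp⟩
  exact ⟨f, hf, hmax⟩

section
variable {m n : ℕ} {I : Instance m n} {γ : ℝ} {R : EdgeRule} {c : Colour m → ℕ}
  {Z : Colour m → Finset (Fin n)}

theorem value_eq {f : Node I γ Z → Node I γ Z → ℕ} (hf : (flowNetwork I γ R c Z).IsFlow f) :
    (flowNetwork I γ R c Z).value f = ∑ L, (f (nodeA I γ Z) (nodeU I γ Z L) : ℤ) := by
  have hz : ∀ u v, (flowNetwork I γ R c Z).cap u v = 0 → f u v = 0 := fun u v h =>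
    Nat.le_zero.1 (h ▸ hf.1 u v)
  have h1 : ∀ v, f v (nodeA I γ Z) = 0 := fun v => hz _ _ (by
    rcases v with _ | _ | _ | _ <;> rfl)
  have h2 : ∀ j, f (nodeA I γ Z) (nodeV I γ Z j) = 0 := fun j => hz _ _ rfl
  have h3 : f (nodeA I γ Z) (nodeB I γ Z) = 0 := hz _ _ rfl
  simp only [Network.value]
  rw [show (flowNetwork I γ R c Z).source = nodeA I γ Z from rfl]
  simp [Fintype.sum_sum_type, h1, h2, h3]

theorem flow_le {f : Node I γ Z → Node I γ Z → ℕ} (hf : (flowNetwork I γ R c Z).IsFlow f)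
    (L : Colour m) : f (nodeA I γ Z) (nodeU I γ Z L) ≤ c L := hf.1 _ _

theorem value_le {f : Node I γ Z → Node I γ Z → ℕ} (hf : (flowNetwork I γ R c Z).IsFlow f) :
    (flowNetwork I γ R c Z).value f ≤ ∑ L, (c L : ℤ) := by
  rw [value_eq hf]
  exact Finset.sum_le_sum fun L _ => by exact_mod_cast flow_le hf L

theorem flow_conservation_colour {f : Node I γ Z → Node I γ Z → ℕ}
    (hf : (flowNetwork I γ R c Z).IsFlow f) (L : Colour m) :
    ∑ j, f (nodeU I γ Z L) (nodeV I γ Z j) = f (nodeA I γ Z) (nodeU I γ Z L) := by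
  have hz : ∀ u v, (flowNetwork I γ R c Z).cap u v = 0 → f u v = 0 := fun u v h =>
    Nat.le_zero.1 (h ▸ hf.1 u v)
  have h := hf.2 (nodeU I γ Z L) (by simp [flowNetwork]) (by simp [flowNetwork])
  have h1 : ∀ L', f (nodeU I γ Z L') (nodeU I γ Z L) = 0 := fun _ => hz _ _ rfl
  have h2 : ∀ j, f (nodeV I γ Z j) (nodeU I γ Z L) = 0 := fun _ => hz _ _ rfl
  have h3 : f (nodeB I γ Z) (nodeU I γ Z L) = 0 := hz _ _ rfl
  have h4 : f (nodeU I γ Z L) (nodeA I γ Z) = 0 := hz _ _ rfl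
  have h5 : ∀ L', f (nodeU I γ Z L) (nodeU I γ Z L') = 0 := fun _ => hz _ _ rfl
  have h6 : f (nodeU I γ Z L) (nodeB I γ Z) = 0 := hz _ _ rfl
  simp [Fintype.sum_sum_type, h1, h2, h3, h4, h5, h6] at h
  exact h.symm

/-- By conservation the inflow of `v_j` equals its outflow, which can only use the edge to `b` of
capacity `1`. -/
theorem flow_conservation_comp {f : Node I γ Z → Node I γ Z → ℕ}
    (hf : (flowNetwork I γ R c Z).IsFlow f) (j : Comp I γ Z) :
    ∑ L, f (nodeU I γ Z L) (nodeV I γ Z j) ≤ 1 := by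
  have hz : ∀ u v, (flowNetwork I γ R c Z).cap u v = 0 → f u v = 0 := fun u v h =>
    Nat.le_zero.1 (h ▸ hf.1 u v)
  have h := hf.2 (nodeV I γ Z j) (by simp [flowNetwork]) (by simp [flowNetwork])
  have h1 : f (nodeA I γ Z) (nodeV I γ Z j) = 0 := hz _ _ rfl
  have h2 : ∀ j', f (nodeV I γ Z j') (nodeV I γ Z j) = 0 := fun _ => hz _ _ rfl
  have h3 : f (nodeB I γ Z) (nodeV I γ Z j) = 0 := hz _ _ rfl
  have h4 : f (nodeV I γ Z j) (nodeA I γ Z) = 0 := hz _ _ rfl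
  have h5 : ∀ L, f (nodeV I γ Z j) (nodeU I γ Z L) = 0 := fun _ => hz _ _ rfl
  have h6 : ∀ j', f (nodeV I γ Z j) (nodeV I γ Z j') = 0 := fun _ => hz _ _ rfl
  simp [Fintype.sum_sum_type, h1, h2, h3, h4, h5, h6] at h
  rw [h]
  exact hf.1 (nodeV I γ Z j) (nodeB I γ Z)

theorem hasEdge_of_flow_pos {f : Node I γ Z → Node I γ Z → ℕ}
    (hf : (flowNetwork I γ R c Z).IsFlow f) {L : Colour m} {j : Comp I γ Z}
    (h : 0 < f (nodeU I γ Z L) (nodeV I γ Z j)) : HasEdge I γ R Z L j := by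
  by_contra hcon
  have := hf.1 (nodeU I γ Z L) (nodeV I γ Z j)
  simp [flowNetwork, hcon] at this
  lia

theorem flow_le_one {f : Node I γ Z → Node I γ Z → ℕ}
    (hf : (flowNetwork I γ R c Z).IsFlow f) (L : Colour m) (j : Comp I γ Z) :
    f (nodeU I γ Z L) (nodeV I γ Z j) ≤ 1 :=
  (Finset.single_le_sum (f := fun L => f (nodeU I γ Z L) (nodeV I γ Z j))
    (fun _ _ => Nat.zero_le _) (Finset.mem_univ L)).trans (flow_conservation_comp hf j)

/-- A component receives flow from one colour only. -/
theorem colour_unique {f : Node I γ Z → Node I γ Z → ℕ}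
    (hf : (flowNetwork I γ R c Z).IsFlow f) {L L' : Colour m} {j : Comp I γ Z}
    (h : 0 < f (nodeU I γ Z L) (nodeV I γ Z j))
    (h' : 0 < f (nodeU I γ Z L') (nodeV I γ Z j)) : L = L' := by
  by_contra hne
  have h1 := flow_conservation_comp hf j
  have h2 := Finset.sum_le_univ_sum_of_nonneg
    (f := fun L => f (nodeU I γ Z L) (nodeV I γ Z j)) (s := {L, L'}) fun _ => Nat.zero_le _
  rw [Finset.sum_pair hne] at h2
  lia

/-- The flow network has an edge only where the component has a point with the right classes. -/
theorem exists_point_of_hasEdge (hZ : IsSelection I γ Z) {L : Colour m} {j : Comp I γ Z}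
    (h : HasEdge I γ R Z L j) :
    ∃ x : Fin n, (∃ y : Selected Z, y.1 = x ∧ (closeGraph I γ Z).connectedComponentMk y = j) ∧
      ∀ i ∈ L.1, x ∈ I.U i := by
  obtain ⟨x, hj, L', hL', hx⟩ := h
  refine ⟨x.1, ⟨x, rfl, hj⟩, fun i hi => ?_⟩
  rw [← mem_colourOf, hZ.colourOf_eq hx]
  cases R with
  | exact => exact (show L' = L from hL') ▸ hi
  | atLeast => exact hL' hi

theorem exists_outcome (hZ : IsSelection I γ Z) : ∃ r, Outcome I γ R c Z r := by
  classical
  obtain ⟨f, hf⟩ := (flowNetwork I γ R c Z).exists_isMaxFlow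
  rcases lt_or_ge ((flowNetwork I γ R c Z).value f) (∑ L, (c L : ℤ)) with h | h
  · exact ⟨none, f, hf, h⟩
  · have key : ∀ L j, ∃ x : Option (Fin n), ∀ _ : 0 < f (nodeU I γ Z L) (nodeV I γ Z j),
        ∃ y ∈ x, (∃ z : Selected Z, z.1 = y ∧
          (closeGraph I γ Z).connectedComponentMk z = j) ∧ ∀ i ∈ L.1, y ∈ I.U i := by
      intro L j
      by_cases h : 0 < f (nodeU I γ Z L) (nodeV I γ Z j)
      · obtain ⟨x, hx⟩ := exists_point_of_hasEdge hZ (hasEdge_of_flow_pos hf.1 h)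
        exact ⟨some x, fun _ => ⟨x, rfl, hx⟩⟩
      · exact ⟨none, fun h' => absurd h' h⟩
    choose g hg using key
    -- `pick` has to be total, so pairs without flow need a default point. Without points there are
    -- no components and nothing has to be picked.
    rcases isEmpty_or_nonempty (Fin n) with hn | ⟨⟨x₀⟩⟩
    · have hc : IsEmpty (Comp I γ Z) := ⟨fun j => by
        obtain ⟨x, -⟩ := j.exists_rep
        exact hn.elim x.1⟩
      exact ⟨some ∅, f, hf, h, fun _ j => hc.elim j, fun _ j => hc.elim j,
        fun x => hn.elim x⟩
    · refine ⟨some (Finset.univ.filter fun x => ∃ L j, 0 < f (nodeU I γ Z L) (nodeV I γ Z j) ∧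
        (g L j).getD x₀ = x), f, hf, h, fun L j => (g L j).getD x₀, fun L j hpos => ?_,
        fun x => by simp⟩
      obtain ⟨y, hy, h⟩ := hg L j hpos
      rw [Option.mem_def] at hy
      simpa [hy] using h

/-- A returned set is feasible and its points are far apart. -/
theorem outcome_sound {S : Finset (Fin n)} (hc : Admissible I c)
    (h : Outcome I γ R c Z (some S)) : Feasible I S ∧ Apart I (d2 m γ) S := by
  classical
  obtain ⟨f, ⟨hf, -⟩, hval, pick, hpick, hS⟩ := h
  constructor
  · intro i
    refine (hc i).trans ?_
    -- The summands are at most `c L` and their sum is at least `∑ L, c L`, so every edge at the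
    -- source is saturated.
    have hfull : ∀ L, f (nodeA I γ Z) (nodeU I γ Z L) = c L := by
      rw [value_eq hf] at hval
      have := (Finset.sum_eq_sum_iff_of_le (s := Finset.univ)
        (f := fun L => (f (nodeA I γ Z) (nodeU I γ Z L) : ℤ)) (g := fun L => (c L : ℤ))
        fun L _ => by exact_mod_cast flow_le hf L).1
        (le_antisymm (Finset.sum_le_sum fun L _ => by exact_mod_cast flow_le hf L) hval)
      intro L
      exact_mod_cast this L (Finset.mem_univ L)
    -- Each edge into a component carries `0` or `1`, so the saturated `c L` counts the components
    -- served by `u_L`.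
    have hcount : ∀ L, c L = (Finset.univ.filter fun j =>
        0 < f (nodeU I γ Z L) (nodeV I γ Z j)).card := by
      intro L
      rw [← hfull L, ← flow_conservation_colour hf L, Finset.card_filter]
      refine Finset.sum_congr rfl fun j _ => ?_
      have := flow_le_one hf L j
      split_ifs <;> lia
    simp_rw [hcount]
    rw [← Finset.card_sigma]
    -- The pairs `(L, j)` with flow and `i ∈ L` inject into `S ∩ U i`: a point determines its
    -- component, and the component determines the colour that serves it.
    refine Finset.card_le_card_of_injOn (fun p => pick p.1 p.2) ?_ ?_
    · rintro ⟨L, j⟩ hp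
      simp only [Finset.coe_sigma, Set.mem_sigma_iff, Finset.mem_coe, Finset.mem_filter,
        Finset.mem_univ, true_and] at hp
      rw [Finset.mem_coe, Finset.mem_inter]
      exact ⟨(hS _).2 ⟨L, j, hp.2, rfl⟩, (hpick L j hp.2).2 i hp.1⟩
    · rintro ⟨L, j⟩ hp ⟨L', j'⟩ hp' heq
      simp only [Finset.coe_sigma, Set.mem_sigma_iff, Finset.mem_coe, Finset.mem_filter,
        Finset.mem_univ, true_and] at hp hp' heq
      obtain ⟨x, hx, hxj⟩ := (hpick L j hp.2).1
      obtain ⟨x', hx', hxj'⟩ := (hpick L' j' hp'.2).1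
      have hxx : x = x' := Subtype.ext (by rw [hx, hx', heq])
      have hj : j = j' := by rw [← hxj, ← hxj', hxx]
      subst hj
      have hL := colour_unique hf hp.2 hp'.2
      subst hL
      rfl
  · intro x hx y hy hxy
    obtain ⟨L, j, hpos, rfl⟩ := (hS x).1 hx
    obtain ⟨L', j', hpos', rfl⟩ := (hS y).1 hy
    obtain ⟨u, hu, huj⟩ := (hpick L j hpos).1
    obtain ⟨v, hv, hvj⟩ := (hpick L' j' hpos').1
    -- Closer points would be adjacent and hence in one component, but only one point is picked from
    -- each component.
    by_contra! hlt
    rw [← hu, ← hv] at hlt hxy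
    have hadj : (closeGraph I γ Z).Adj u v := ⟨fun h => hxy (by rw [h]), hlt⟩
    have hj : j = j' := by
      rw [← huj, ← hvj]
      exact SimpleGraph.ConnectedComponent.eq.2 hadj.reachable
    subst hj
    have hL := colour_unique hf hpos hpos'
    subst hL
    exact hxy (by rw [hu, hv])

open Classical in
/-- The flow that sends one unit through `u_(g i)` and `v_(h i)` for every index `i`. -/
noncomputable def assignFlow {ι : Type} [Fintype ι] (g : ι → Colour m) (h : ι → Comp I γ Z) :
    Node I γ Z → Node I γ Z → ℕ
  | .inl _, .inr (.inl L) => (Finset.univ.filter fun i => g i = L).card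
  | .inr (.inl L), .inr (.inr (.inl j)) => (Finset.univ.filter fun i => g i = L ∧ h i = j).card
  | .inr (.inr (.inl j)), .inr (.inr (.inr _)) => (Finset.univ.filter fun i => h i = j).card
  | _, _ => 0

open Classical in
/-- The number of indices of each colour. -/
noncomputable def colourCount {ι : Type} [Fintype ι] (g : ι → Colour m) (L : Colour m) : ℕ :=
  (Finset.univ.filter fun i => g i = L).card

/-- Conservation at an inner node counts the same indices by component or by colour, and injectivity
of `h` respects the unit capacities into `b`. The flow saturates the source, so it attains the upper
bound `value_le`. -/
theorem assignFlow_isMaxFlow {ι : Type} [Fintype ι] {g : ι → Colour m} {h : ι → Comp I γ Z}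
    (hinj : Function.Injective h) (hedge : ∀ i, HasEdge I γ R Z (g i) (h i)) :
    (flowNetwork I γ R (colourCount g) Z).IsMaxFlow (assignFlow g h) ∧
      (flowNetwork I γ R (colourCount g) Z).value (assignFlow g h) =
        ∑ L, (colourCount g L : ℤ) := by
  classical
  have hle : ∀ j : Comp I γ Z, (Finset.univ.filter fun i => h i = j).card ≤ 1 := by
    intro j
    rw [Finset.card_le_one]
    intro a ha b hb
    exact hinj ((Finset.mem_filter.1 ha).2.trans (Finset.mem_filter.1 hb).2.symm)
  have hflow : (flowNetwork I γ R (colourCount g) Z).IsFlow (assignFlow g h) := by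
    constructor
    · rintro (_ | L | j | _) (_ | L' | j' | _) <;>
        simp only [assignFlow, flowNetwork, le_refl, colourCount]
      · split_ifs with hE
        · refine (Finset.card_le_card ?_).trans (hle j')
          intro i hi
          simp only [Finset.mem_filter, Finset.mem_univ, true_and] at hi ⊢
          exact hi.2
        · rw [Nat.le_zero, Finset.card_eq_zero, Finset.filter_eq_empty_iff]
          rintro i - ⟨rfl, rfl⟩
          exact hE (hedge i)
      · exact hle j
    · rintro (_ | L | j | _) h1 h2
      · exact absurd rfl h1
      · simp only [Fintype.sum_sum_type, assignFlow, Finset.sum_const_zero, Finset.univ_unique,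
          Finset.sum_singleton, add_zero, zero_add]
        rw [Finset.card_eq_sum_card_fiberwise
          (f := h) (s := Finset.univ.filter fun i => g i = L) (t := Finset.univ)
          (fun _ _ => Finset.mem_coe.2 (Finset.mem_univ _))]
        simp only [Finset.filter_filter]
      · simp only [Fintype.sum_sum_type, assignFlow, Finset.sum_const_zero, Finset.univ_unique,
          Finset.sum_singleton, add_zero, zero_add]
        rw [Finset.card_eq_sum_card_fiberwise
          (f := g) (s := Finset.univ.filter fun i => h i = j) (t := Finset.univ)
          (fun _ _ => Finset.mem_coe.2 (Finset.mem_univ _))]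
        simp only [Finset.filter_filter, and_comm]
      · exact absurd rfl h2
  have hval : (flowNetwork I γ R (colourCount g) Z).value (assignFlow g h) =
      ∑ L, (colourCount g L : ℤ) := by
    rw [value_eq hflow]
    rfl
  exact ⟨⟨hflow, fun f hf => hval ▸ value_le hf⟩, hval⟩

/-- The assignment shows that the maximum equals `∑ L, c L`. Hence any maximum flow, not only this
one, avoids the abort. -/
theorem returns_of_assignment {ι : Type} [Fintype ι] {g : ι → Colour m} {h : ι → Comp I γ Z}
    (hinj : Function.Injective h) (hedge : ∀ i, HasEdge I γ R Z (g i) (h i))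
    (hadm : Admissible I (colourCount g)) {r : Option (Finset (Fin n))}
    (hr : Outcome I γ R (colourCount g) Z r) :
    ∃ S, r = some S ∧ Feasible I S ∧ Apart I (d2 m γ) S := by
  rcases r with _ | S
  · obtain ⟨f, hf, hlt⟩ := hr
    obtain ⟨h1, h2⟩ := assignFlow_isMaxFlow (R := R) hinj hedge
    exact absurd (hf.2 _ h1.1) (by rw [h2]; exact not_le.2 hlt)
  · exact ⟨S, rfl, outcome_sound hadm hr⟩

theorem sum_colourCount {ι : Type} [Fintype ι] (g : ι → Colour m) (i : Fin m) :
    ∑ L ∈ Finset.univ.filter (fun L : Colour m => i ∈ L.1), colourCount g L =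
      (Finset.univ.filter fun x => i ∈ (g x).1).card := by
  classical
  rw [Finset.card_eq_sum_card_fiberwise (f := g) (s := Finset.univ.filter fun x => i ∈ (g x).1)
    (t := Finset.univ.filter (fun L : Colour m => i ∈ L.1)) (fun x hx => by simpa using hx)]
  refine Finset.sum_congr rfl fun L hL => ?_
  rw [colourCount, Finset.filter_filter]
  congr 1
  ext x
  simp only [Finset.mem_filter, Finset.mem_univ, true_and] at hL ⊢
  exact ⟨fun h => ⟨h ▸ hL, h⟩, fun h => h.2⟩

/-- The coloured points of `O`. -/
abbrev Coloured (I : Instance m n) (O : Finset (Fin n)) :=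
  {x : Fin n // x ∈ O ∧ (colourOf I x).Nonempty}

/-- Moving a point to a colour that contains its own loses no class; points outside all classes
count for none. -/
theorem card_inter_class_le {O : Finset (Fin n)} {g : Coloured I O → Colour m}
    (hg : ∀ x, colourOf I x.1 ⊆ (g x).1) (i : Fin m) :
    (O ∩ I.U i).card ≤ (Finset.univ.filter fun x => i ∈ (g x).1).card := by
  classical
  refine Finset.card_le_card_of_surjOn (fun x => x.1) ?_
  intro x hx
  rw [Finset.mem_coe, Finset.mem_inter, ← mem_colourOf] at hx
  refine ⟨⟨x, hx.1, i, hx.2⟩, ?_, rfl⟩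
  simpa using hg ⟨x, hx.1, i, hx.2⟩ hx.2

theorem admissible_colourCount {O : Finset (Fin n)} (hO : Feasible I O)
    {g : Coloured I O → Colour m} (hg : ∀ x, colourOf I x.1 ⊆ (g x).1) :
    Admissible I (colourCount g) := by
  intro i
  rw [sum_colourCount]
  exact (hO i).trans (card_inter_class_le hg i)

/-- Only non-empty colours are counted, so the points of `O` in no class can be dropped. This brings
the guess into the form to which `returns_of_assignment` applies. -/
theorem counts_eq (O : Finset (Fin n)) :
    counts I O = colourCount fun x : Coloured I O => ⟨colourOf I x.1, x.2.2⟩ := by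
  classical
  funext L
  rw [counts, colourCount]
  symm
  refine Finset.card_bij (fun x _ => x.1) ?_ (fun x _ y _ h => Subtype.ext h) ?_
  · intro x hx
    rw [Finset.mem_inter, mem_X_iff]
    exact ⟨x.2.1, congrArg Subtype.val (Finset.mem_filter.1 hx).2⟩
  · intro x hx
    rw [Finset.mem_inter, mem_X_iff] at hx
    exact ⟨⟨x, hx.1, hx.2 ▸ L.2⟩, by simpa [Subtype.ext_iff] using hx.2, rfl⟩

/-- Points that are `γ` apart can be moved to selected points of different components. -/
theorem IsSelection.exists_move (hZ : IsSelection I γ Z) {O : Finset (Fin n)}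
    (hO : Apart I γ O) :
    ∃ (g : Coloured I O → Colour m) (y : Coloured I O → Selected Z),
      (∀ x, colourOf I x.1 ⊆ (g x).1) ∧ (∀ x, (y x).1 ∈ Z (g x)) ∧
      Function.Injective fun x => (closeGraph I γ Z).connectedComponentMk (y x) := by
  choose g y hsub hy hclose using fun x : Coloured I O =>
    hZ.exists_close (L := ⟨colourOf I x.1, x.2.2⟩) (x := x.1) rfl
  refine ⟨g, fun x => ⟨y x, g x, hy x⟩, hsub, hy, fun x x' h => Subtype.ext ?_⟩
  exact hZ.eq_of_reachable (y := ⟨y x, g x, hy x⟩) (y' := ⟨y x', g x', hy x'⟩) (hclose x)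
    (hclose x') (hO x.1 x.2.1 x'.1 x'.2.1) (SimpleGraph.ConnectedComponent.eq.1 h)

/-! ### Optimal solutions and transversals of the components. -/

theorem le_diversity_iff {r : ℝ} {S : Finset (Fin n)} :
    (r : EReal) ≤ diversity I S ↔ Apart I r S := by
  simp only [diversity, le_iInf_iff, EReal.coe_le_coe_iff, Apart]

/-- The whole universe is feasible because `k i ≤ |U i|`, and there are finitely many sets. -/
theorem exists_isOptimal (I : Instance m n) : ∃ O, IsOptimal I O := by
  have huniv : Feasible I Finset.univ := fun i => by
    rw [Finset.univ_inter]
    exact I.k_le i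
  obtain ⟨O, hO, hmax⟩ := Set.exists_max_image {S | Feasible I S} (diversity I)
    (Set.toFinite _) ⟨_, huniv⟩
  exact ⟨O, hO, le_antisymm (le_iSup₂ (f := fun S _ => diversity I S) O hO)
    (iSup₂_le fun S hS => hmax S hS)⟩

/-- `T` consists of selected points, at most one of every component. -/
structure IsTransversal (I : Instance m n) (γ : ℝ) (Z : Colour m → Finset (Fin n))
    (T : Finset (Fin n)) : Prop where
  selected : ∀ x ∈ T, ∃ L, x ∈ Z L
  eq_of_reachable : ∀ (x y : Selected Z), x.1 ∈ T → y.1 ∈ T →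
    (closeGraph I γ Z).Reachable x y → x = y

/-- The transversal is the set of the moved points of an optimal solution. This is what makes the
search of the program complete for guesses up to the optimum. -/
theorem IsSelection.exists_transversal (hZ : IsSelection I γ Z) (hγ : (γ : EReal) ≤ opt I) :
    ∃ T, IsTransversal I γ Z T ∧ Feasible I T := by
  classical
  obtain ⟨O, hO, hdiv⟩ := exists_isOptimal I
  obtain ⟨g, y, hsub, hy, hinj⟩ := hZ.exists_move (le_diversity_iff.1 (hdiv ▸ hγ))
  refine ⟨Finset.univ.image fun x => (y x).1, ⟨?_, ?_⟩, fun i => ?_⟩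
  · intro x hx
    obtain ⟨u, -, rfl⟩ := Finset.mem_image.1 hx
    exact (y u).2
  · intro a b ha hb hab
    obtain ⟨u, -, hu⟩ := Finset.mem_image.1 ha
    obtain ⟨v, -, hv⟩ := Finset.mem_image.1 hb
    obtain rfl : y u = a := Subtype.ext hu
    obtain rfl : y v = b := Subtype.ext hv
    rw [hinj (SimpleGraph.ConnectedComponent.eq.2 hab)]
  · refine (hO i).trans ((card_inter_class_le hsub i).trans ?_)
    refine Finset.card_le_card_of_injOn (fun x => (y x).1) ?_ ?_
    · intro x hx
      simp only [Finset.coe_filter, Finset.mem_univ, true_and, Set.mem_ofPred_eq] at hx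
      rw [Finset.mem_coe, Finset.mem_inter, ← mem_colourOf, hZ.colourOf_eq (hy x)]
      exact ⟨Finset.mem_image_of_mem _ (Finset.mem_univ _), hx⟩
    · intro x _ x' _ h
      exact hinj (by simp only [Subtype.ext (h : (y x).1 = (y x').1)])

/-- A feasible transversal is a possible result. -/
theorem IsTransversal.exists_outcome (hZ : IsSelection I γ Z) {T : Finset (Fin n)}
    (hT : IsTransversal I γ Z T) (hfeas : Feasible I T) (R : EdgeRule) :
    ∃ c, Admissible I c ∧ Outcome I γ R c Z (some T) := by
  classical
  choose L hL using hT.selected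
  have hsel : ∀ x : Coloured I T, ∃ L, x.1 ∈ Z L := fun x => hT.selected x.1 x.2.1
  let y : Coloured I T → Selected Z := fun x => ⟨x.1, hsel x⟩
  let g : Coloured I T → Colour m := fun x => L x.1 x.2.1
  let h : Coloured I T → Comp I γ Z := fun x => (closeGraph I γ Z).connectedComponentMk (y x)
  have hinj : Function.Injective h := fun a b hab => Subtype.ext <|
    congrArg (fun z : Selected Z => z.1) <|
      hT.eq_of_reachable (y a) (y b) a.2.1 b.2.1 (SimpleGraph.ConnectedComponent.eq.1 hab)
  have hg : ∀ x, colourOf I x.1 = (g x).1 := fun x => hZ.colourOf_eq (hL x.1 x.2.1)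
  have hedge : ∀ x, HasEdge I γ R Z (g x) (h x) := fun x =>
    ⟨y x, rfl, g x, by cases R <;> simp [EdgeRule.Allows], hL x.1 x.2.1⟩
  obtain ⟨h1, h2⟩ := assignFlow_isMaxFlow (R := R) hinj hedge
  have hpos : ∀ L j, 0 < assignFlow g h (nodeU I γ Z L) (nodeV I γ Z j) ↔
      ∃ x, g x = L ∧ h x = j := by
    intro L j
    simp only [assignFlow, Finset.card_pos, Finset.filter_nonempty_iff, Finset.mem_univ,
      true_and]
  -- On components met by `T` the pick is the point of `T`; on the others any representative serves,
  -- since they carry no flow.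
  obtain ⟨pick, hpick⟩ : ∃ pick : Comp I γ Z → Fin n, ∀ x, pick (h x) = x.1 := by
    choose rep _ using fun j : Comp I γ Z => j.exists_rep
    exact ⟨Function.extend h Subtype.val fun j => (rep j).1, fun x => hinj.extend_apply _ _ x⟩
  refine ⟨colourCount g, admissible_colourCount hfeas fun x => (hg x).subset,
    assignFlow g h, h1, h2.ge, fun _ j => pick j, fun L j hLj => ?_, fun x => ⟨fun hx => ?_, ?_⟩⟩
  · obtain ⟨x, rfl, rfl⟩ := (hpos L j).1 hLj
    beta_reduce
    rw [hpick]
    exact ⟨⟨y x, rfl, rfl⟩, fun i hi => mem_colourOf.1 (hg x ▸ hi)⟩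
  -- Selected points have a non-empty colour, so indexing the flow by the coloured points of `T`
  -- misses none.
  · have hcol : (colourOf I x).Nonempty := by
      rw [hZ.colourOf_eq (hL x hx)]
      exact (L x hx).2
    let x' : Coloured I T := ⟨x, hx, hcol⟩
    exact ⟨g x', h x', (hpos _ _).2 ⟨x', rfl, rfl⟩, hpick x'⟩
  · rintro ⟨L, j, hLj, rfl⟩
    obtain ⟨x, rfl, rfl⟩ := (hpos L j).1 hLj
    beta_reduce
    rw [hpick]
    exact x.2.1

/-- The unit for a point `x` of `O` leaves from the colour of `x` itself and enters the component of
the moved point. The colour of the latter may be larger, which is why rule (S) is needed. -/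
theorem returns_of_isOptimal {O : Finset (Fin n)} (hO : IsOptimal I O)
    (hγ : (γ : EReal) ≤ opt I) {r : Option (Finset (Fin n))}
    (hr : FairPlusFlow I γ .atLeast (counts I O) r) :
    ∃ S, r = some S ∧ Feasible I S ∧ Apart I (d2 m γ) S := by
  obtain ⟨Z, hZ, hr⟩ := hr
  obtain ⟨g, y, hsub, hy, hinj⟩ := hZ.exists_move (le_diversity_iff.1 (hO.2 ▸ hγ))
  rw [counts_eq] at hr
  refine returns_of_assignment hinj (fun x => ?_) ?_ hr
  · exact ⟨y x, rfl, g x, hsub x, hy x⟩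
  · exact admissible_colourCount hO.1 fun _ => subset_rfl

/-- The guess counts the colours after the move and so depends on `Z`. The edges used are then
exact, hence present under both rules. -/
theorem exists_admissible_returns (R : EdgeRule) (hγ : (γ : EReal) ≤ opt I)
    (hZ : IsSelection I γ Z) :
    ∃ c : Colour m → ℕ, Admissible I c ∧ ∀ r, Outcome I γ R c Z r →
      ∃ S, r = some S ∧ Feasible I S ∧ Apart I (d2 m γ) S := by
  obtain ⟨O, hO, hdiv⟩ := exists_isOptimal I
  obtain ⟨g, y, hsub, hy, hinj⟩ := hZ.exists_move (le_diversity_iff.1 (hdiv ▸ hγ))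
  have hadm := admissible_colourCount hO hsub
  refine ⟨_, hadm, fun r hr => returns_of_assignment hinj (fun x => ?_) hadm hr⟩
  exact ⟨y x, rfl, g x, by cases R <;> simp [EdgeRule.Allows], hy x⟩

end

/-! ### Programs with bounded loops -/

@[simp]
theorem Memory.setNat_nat_self (s : Memory) (a i v : ℕ) :
    (s.setNat a i v).nat a = Function.update (s.nat a) i v := by
  simp [Memory.setNat]

@[simp]
theorem Memory.setNat_nat_of_ne (s : Memory) {a b : ℕ} (i v : ℕ) (h : b ≠ a) :
    (s.setNat a i v).nat b = s.nat b := by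
  simp [Memory.setNat, h]

@[simp]
theorem Memory.setNat_real (s : Memory) (a i v : ℕ) : (s.setNat a i v).real = s.real := rfl

@[simp]
theorem Memory.setReal_nat (s : Memory) (a i : ℕ) (v : ℝ) : (s.setReal a i v).nat = s.nat := rfl

@[simp]
theorem Memory.setReal_real_self (s : Memory) (a i : ℕ) (v : ℝ) :
    (s.setReal a i v).real a = Function.update (s.real a) i v := by
  simp [Memory.setReal]

@[simp]
theorem Memory.setReal_real_of_ne (s : Memory) {a b : ℕ} (i : ℕ) (v : ℝ) (h : b ≠ a) :
    (s.setReal a i v).real b = s.real b := by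
  simp [Memory.setReal, h]

/-- The bounds of loops: a constant, the number of points, or the contents of a register. -/
inductive Bound
  | lit (c : ℕ)
  | size
  /-- the entry `0` of the array `1` -/
  | pow

def Bound.exp : Bound → NatExp
  | .lit c => .lit c
  | .size => .size
  | .pow => .get 1 (.lit 0)

/-- The value of a bound if the register for the bounds contains `(n + 1) ^ m`. -/
noncomputable def Bound.poly (m : ℕ) : Bound → Polynomial ℕ
  | .lit c => Polynomial.C c
  | .size => Polynomial.X
  | .pow => (Polynomial.X + 1) ^ m

/-- Programs all of whose loops are bounded. The counter of `for_ a b p` is entry `0` of array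
`a`. -/
inductive Code
  | skip
  | setNat (a : ℕ) (i e : NatExp)
  | setReal (a : ℕ) (i : NatExp) (e : RealExp)
  | seq (p q : Code)
  | ite (t : Test) (p q : Code)
  | for_ (a : ℕ) (b : Bound) (p : Code)

namespace Code

/-- Translation to the machine language. -/
def compile : Code → Program
  | skip => .skip
  | setNat a i e => .setNat a i e
  | setReal a i e => .setReal a i e
  | seq p q => .seq p.compile q.compile
  | ite t p q => .ite t p.compile q.compile
  | for_ a b p => .seq (.setNat a (.lit 0) (.lit 0))
      (.loop (.not (.natLe b.exp (.get a (.lit 0))))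
        (.seq p.compile (.setNat a (.lit 0) (.add (.get a (.lit 0)) (.lit 1)))))

/-- The arrays of naturals that a program may change. -/
def writes : Code → List ℕ
  | skip => []
  | setNat a _ _ => [a]
  | setReal _ _ _ => []
  | seq p q => p.writes ++ q.writes
  | ite _ p q => p.writes ++ q.writes
  | for_ a _ p => a :: p.writes

/-- The arrays of reals that a program may change. -/
def writesReal : Code → List ℕ
  | skip => []
  | setNat _ _ _ => []
  | setReal a _ _ => [a]
  | seq p q => p.writesReal ++ q.writesReal
  | ite _ p q => p.writesReal ++ q.writesReal
  | for_ _ _ p => p.writesReal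

/-- Loops do not change their own counters. -/
def CountersSafe : Code → Prop
  | skip => True
  | setNat _ _ _ => True
  | setReal _ _ _ => True
  | seq p q => p.CountersSafe ∧ q.CountersSafe
  | ite _ p q => p.CountersSafe ∧ q.CountersSafe
  | for_ a _ p => a ∉ p.writes ∧ p.CountersSafe

open Polynomial in
/-- A bound on the running time if the register for the bounds contains `(n + 1) ^ m`. -/
noncomputable def timeBound (m : ℕ) : Code → Polynomial ℕ
  | skip => 1
  | setNat _ i e => C (i.cost + e.cost + 1)
  | setReal _ i e => C (i.cost + e.cost + 1)
  | seq p q => p.timeBound m + q.timeBound m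
  | ite t p q => C t.cost + (p.timeBound m + q.timeBound m)
  | for_ _ b p => C 9 + b.poly m * (p.timeBound m + C 12)

end Code

/-- `iterate F k s` applies `F 0`, …, `F (k - 1)` to `s`. -/
def iterate {α : Type*} (F : ℕ → α → α) : ℕ → α → α
  | 0, s => s
  | k + 1, s => F k (iterate F k s)

section
variable {m n : ℕ} (I : Instance m n)

open Classical in
/-- The effect of a program on the memory. -/
noncomputable def Code.run : Code → Memory → Memory
  | .skip, s => s
  | .setNat a i e, s => s.setNat a (i.eval I s) (e.eval I s)
  | .setReal a i e, s => s.setReal a (i.eval I s) (e.eval I s)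
  | .seq p q, s => q.run (p.run s)
  | .ite t p q, s => if t.Holds I s then p.run s else q.run s
  | .for_ a b p, s =>
      (iterate (fun i s' => p.run (s'.setNat a 0 i)) (b.exp.eval I s) s).setNat a 0
        (b.exp.eval I s)

variable {I}

@[simp]
theorem Code.run_skip (s : Memory) : Code.skip.run I s = s := rfl

@[simp]
theorem Code.run_setNat (a : ℕ) (i e : NatExp) (s : Memory) :
    (Code.setNat a i e).run I s = s.setNat a (i.eval I s) (e.eval I s) := rfl

@[simp]
theorem Code.run_setReal (a : ℕ) (i : NatExp) (e : RealExp) (s : Memory) :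
    (Code.setReal a i e).run I s = s.setReal a (i.eval I s) (e.eval I s) := rfl

@[simp]
theorem Code.run_seq (p q : Code) (s : Memory) :
    (Code.seq p q).run I s = q.run I (p.run I s) := rfl

/-- The rule for loops with an invariant. -/
theorem Code.run_for_of_invariant {a : ℕ} {b : Bound} {p : Code} {s : Memory} {N : ℕ}
    (Inv : ℕ → Memory → Prop) (hN : b.exp.eval I s = N) (h0 : Inv 0 s)
    (hstep : ∀ i < N, ∀ s', Inv i s' → Inv (i + 1) (p.run I (s'.setNat a 0 i)))
    (hend : ∀ s', Inv N s' → Inv N (s'.setNat a 0 N)) :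
    Inv N ((Code.for_ a b p).run I s) := by
  have key : ∀ k ≤ N, Inv k (iterate (fun i s' => p.run I (s'.setNat a 0 i)) k s) := by
    intro k
    induction k with
    | zero => exact fun _ => h0
    | succ k ih => exact fun hk => hstep k (by lia) _ (ih (by lia))
  rw [Code.run, hN]
  exact hend _ (key N le_rfl)

/-- Frame rule. For concrete programs the list `writes` can be evaluated even with a variable `m`,
so its hypothesis is mostly discharged by computation. -/
theorem Code.run_nat_of_not_mem {p : Code} {a : ℕ} (h : a ∉ p.writes) (s : Memory) :
    (p.run I s).nat a = s.nat a := by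
  induction p generalizing s with
  | skip => rfl
  | setNat b i e =>
    exact Memory.setNat_nat_of_ne _ _ _ (by simpa [Code.writes] using h)
  | setReal => rfl
  | seq p q ihp ihq =>
    simp only [Code.writes, List.mem_append, not_or] at h
    rw [Code.run, ihq h.2, ihp h.1]
  | ite t p q ihp ihq =>
    simp only [Code.writes, List.mem_append, not_or] at h
    rw [Code.run]
    split_ifs
    · exact ihp h.1 s
    · exact ihq h.2 s
  | for_ b c p ih =>
    simp only [Code.writes, List.mem_cons, not_or] at h
    refine Code.run_for_of_invariant (fun _ s' => s'.nat a = s.nat a) rfl rfl ?_ ?_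
    · intro i _ s' hs'
      rw [ih h.2, Memory.setNat_nat_of_ne _ _ _ h.1, hs']
    · intro s' hs'
      rw [Memory.setNat_nat_of_ne _ _ _ h.1, hs']

theorem Code.run_real_of_not_mem {p : Code} {a : ℕ} (h : a ∉ p.writesReal) (s : Memory) :
    (p.run I s).real a = s.real a := by
  induction p generalizing s with
  | skip => rfl
  | setNat b i e => rfl
  | setReal b i e =>
    exact Memory.setReal_real_of_ne _ _ _ (by simpa [Code.writesReal] using h)
  | seq p q ihp ihq =>
    simp only [Code.writesReal, List.mem_append, not_or] at h
    rw [Code.run, ihq h.2, ihp h.1]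
  | ite t p q ihp ihq =>
    simp only [Code.writesReal, List.mem_append, not_or] at h
    rw [Code.run]
    split_ifs
    · exact ihp h.1 s
    · exact ihq h.2 s
  | for_ b c p ih =>
    refine Code.run_for_of_invariant (fun _ s' => s'.real a = s.real a) rfl rfl ?_ ?_
    · intro i _ s' hs'
      rw [ih h, Memory.setNat_real, hs']
    · intro s' hs'
      rw [Memory.setNat_real, hs']

/-- The rule for loops with an invariant, with the information that other arrays are fixed. -/
theorem Code.run_for {a : ℕ} {b : Bound} {p : Code} {s : Memory} {N : ℕ}
    (Inv : ℕ → Memory → Prop) (hN : b.exp.eval I s = N) (h0 : Inv 0 s)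
    (hstep : ∀ i < N, ∀ s', (∀ c ∉ (Code.for_ a b p).writes, s'.nat c = s.nat c) →
      (∀ c ∉ p.writesReal, s'.real c = s.real c) →
      Inv i s' → Inv (i + 1) (p.run I (s'.setNat a 0 i)))
    (hend : ∀ s', Inv N s' → Inv N (s'.setNat a 0 N)) :
    Inv N ((Code.for_ a b p).run I s) := by
  refine (Code.run_for_of_invariant (fun i s' => Inv i s' ∧
    (∀ c ∉ (Code.for_ a b p).writes, s'.nat c = s.nat c) ∧
    (∀ c ∉ p.writesReal, s'.real c = s.real c)) hN ⟨h0, fun _ _ => rfl, fun _ _ => rfl⟩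
    ?_ ?_).1
  · rintro i hi s' ⟨h1, h2, h3⟩
    refine ⟨hstep i hi s' h2 h3 h1, fun c hc => ?_, fun c hc => ?_⟩
    · rw [← h2 c hc]
      simp only [Code.writes, List.mem_cons, not_or] at hc
      rw [Code.run_nat_of_not_mem hc.2, Memory.setNat_nat_of_ne _ _ _ hc.1]
    · rw [Code.run_real_of_not_mem hc, Memory.setNat_real, h3 c hc]
  · rintro s' ⟨h1, h2, h3⟩
    refine ⟨hend s' h1, fun c hc => ?_, fun c hc => h3 c hc⟩
    rw [← h2 c hc]
    simp only [Code.writes, List.mem_cons, not_or] at hc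
    rw [Memory.setNat_nat_of_ne _ _ _ hc.1]

/-- The loop test evaluates the bound again in every round; a body that leaves array `1` alone
cannot change it. -/
theorem Bound.eval_congr (b : Bound) {s s' : Memory} (h : s.nat 1 0 = s'.nat 1 0) :
    b.exp.eval I s = b.exp.eval I s' := by
  cases b <;> simp [Bound.exp, NatExp.eval, h]

/-- Programs with bounded loops run in polynomial time. -/
theorem Code.exists_exec {p : Code} (hp : p.CountersSafe) (h1 : 1 ∉ p.writes) {s : Memory}
    (hs : s.nat 1 0 ≤ (n + 1) ^ m) :
    ∃ t ≤ (p.timeBound m).eval n, Exec I p.compile s t (p.run I s) := by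
  induction p generalizing s with
  | skip => exact ⟨1, by simp [Code.timeBound], Exec.skip s⟩
  | setNat a i e => exact ⟨_, by simp [Code.timeBound], Exec.setNat s a i e⟩
  | setReal a i e => exact ⟨_, by simp [Code.timeBound], Exec.setReal s a i e⟩
  | seq p q ihp ihq =>
    simp only [Code.writes, List.mem_append, not_or] at h1
    obtain ⟨t, ht, h⟩ := ihp hp.1 h1.1 hs
    obtain ⟨t', ht', h'⟩ := ihq hp.2 h1.2 (s := p.run I s)
      (by rwa [Code.run_nat_of_not_mem h1.1])
    refine ⟨t + t', ?_, Exec.seq h h'⟩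
    simp only [Code.timeBound, Polynomial.eval_add]
    lia
  | ite b p q ihp ihq =>
    simp only [Code.writes, List.mem_append, not_or] at h1
    simp only [Code.timeBound, Polynomial.eval_add, Polynomial.eval_C, Code.run]
    split_ifs with hb
    · obtain ⟨t, ht, h⟩ := ihp hp.1 h1.1 hs
      exact ⟨b.cost + t, by lia, Exec.ite_true hb h⟩
    · obtain ⟨t, ht, h⟩ := ihq hp.2 h1.2 hs
      exact ⟨b.cost + t, by lia, Exec.ite_false hb h⟩
  | for_ a b p ih =>
    simp only [Code.writes, List.mem_cons, not_or] at h1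
    obtain ⟨N, hN⟩ : ∃ N, b.exp.eval I s = N := ⟨_, rfl⟩
    have hNle : N ≤ (b.poly m).eval n := by
      rw [← hN]
      cases b <;> simp [Bound.exp, Bound.poly, NatExp.eval, hs]
    have hcost : b.exp.cost ≤ 2 := by
      cases b <;> simp [Bound.exp, NatExp.cost]
    set F : ℕ → Memory → Memory := fun i s' => p.run I (s'.setNat a 0 i) with hF
    have hfix : ∀ k, (iterate F k s).nat 1 = s.nat 1 := by
      intro k
      induction k with
      | zero => rfl
      | succ k ihk =>
        rw [iterate, hF]
        beta_reduce
        rw [Code.run_nat_of_not_mem h1.2, Memory.setNat_nat_of_ne _ _ _ h1.1, ← hF, ihk]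
    -- A test costs at most `6`, and so does the increment of the counter; this gives `12` for each
    -- round besides the body, and `6` for the last test. Initialising the counter costs another
    -- `3`.
    have hloop : ∀ k i, i + k = N → ∃ t ≤ 6 + k * ((p.timeBound m).eval n + 12),
        Exec I (.loop (.not (.natLe b.exp (.get a (.lit 0))))
          (.seq p.compile (.setNat a (.lit 0) (.add (.get a (.lit 0)) (.lit 1)))))
          ((iterate F i s).setNat a 0 i) t ((iterate F N s).setNat a 0 N) := by
      intro k
      induction k with
      | zero =>
        rintro i rfl
        refine ⟨_, ?_, Exec.loop_stop ?_⟩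
        · simp only [Test.cost, NatExp.cost]
          lia
        · simp only [Test.Holds, not_not]
          rw [Bound.eval_congr b (s' := s) (by
            rw [Memory.setNat_nat_of_ne _ _ _ h1.1, hfix]), hN]
          simp [NatExp.eval, Memory.setNat_nat_self]
      | succ k ihk =>
        intro i hi
        obtain ⟨t₁, ht₁, he₁⟩ := ih hp.2 h1.2 (s := (iterate F i s).setNat a 0 i)
          (by rwa [Memory.setNat_nat_of_ne _ _ _ h1.1, hfix])
        obtain ⟨t₂, ht₂, he₂⟩ := ihk (i + 1) (by lia)
        have hset := Exec.setNat (I := I) (iterate F (i + 1) s) a (.lit 0)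
          (.add (.get a (.lit 0)) (.lit 1))
        have hval : (iterate F (i + 1) s).nat a 0 = i := by
          rw [iterate, hF]
          beta_reduce
          rw [Code.run_nat_of_not_mem hp.1, Memory.setNat_nat_self]
          simp
        simp only [NatExp.eval, hval] at hset
        refine ⟨_, ?_, Exec.loop_step ?_ (Exec.seq he₁ hset) he₂⟩
        · simp only [Test.cost, NatExp.cost]
          rw [add_one_mul]
          lia
        · simp only [Test.Holds]
          rw [Bound.eval_congr b (s' := s) (by
            rw [Memory.setNat_nat_of_ne _ _ _ h1.1, hfix]), hN]
          simp [NatExp.eval, Memory.setNat_nat_self]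
          lia
    obtain ⟨t, ht, he⟩ := hloop N 0 (zero_add N)
    refine ⟨3 + t, ?_, ?_⟩
    · simp only [Code.timeBound, Polynomial.eval_add, Polynomial.eval_mul, Polynomial.eval_C]
      have := Nat.mul_le_mul_right ((p.timeBound m).eval n + 12) hNle
      lia
    · rw [Code.run, hN]
      exact Exec.seq (Exec.setNat s a (.lit 0) (.lit 0)) he

end

/-! ### Building blocks of programs -/

infixr:60 " ;; " => Code.seq

/-- The scalar in entry `0` of the array `a`. -/
abbrev var (a : ℕ) : NatExp := .get a (.lit 0)

/-- Multiplication by a constant. -/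
def RealExp.smul (c : ℕ) (e : RealExp) : RealExp :=
  match c with
  | 0 => .lit 0
  | c + 1 => .add (RealExp.smul c e) e

/-- A sum with a constant number of terms. -/
def NatExp.sum (c : ℕ) (f : ℕ → NatExp) : NatExp :=
  match c with
  | 0 => .lit 0
  | c + 1 => .add (NatExp.sum c f) (f c)

/-- Execute `p` if all tests succeed. -/
def Code.guard (ts : List Test) (p : Code) : Code :=
  match ts with
  | [] => p
  | t :: ts => .ite t (Code.guard ts p) .skip

section
variable {m n : ℕ} (I : Instance m n)

/-- Membership of points in classes, with numbers as arguments. -/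
def memN (x i : ℕ) : ℕ :=
  if h : x < n ∧ i < m then
    if (⟨x, h.1⟩ : Fin n) ∈ I.U ⟨i, h.2⟩ then 1 else 0
  else 0

/-- The distance, with numbers as arguments. -/
noncomputable def distN (x y : ℕ) : ℝ :=
  if h : x < n ∧ y < n then I.d ⟨x, h.1⟩ ⟨y, h.2⟩ else 0

/-- The fairness constraints, with numbers as arguments. -/
def quotaN (i : ℕ) : ℕ := if h : i < m then I.k ⟨i, h⟩ else 0

theorem distN_nonneg (x y : ℕ) : 0 ≤ distN I x y := by
  unfold distN
  split_ifs
  · exact I.d_nonneg _ _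
  · exact le_rfl

variable {I} {s : Memory}

@[simp] theorem NatExp.eval_lit (c : ℕ) : (NatExp.lit c).eval I s = c := rfl

@[simp] theorem NatExp.eval_size : NatExp.size.eval I s = n := rfl

@[simp] theorem NatExp.eval_quota (i : NatExp) :
    (NatExp.quota i).eval I s = quotaN I (i.eval I s) := rfl

@[simp] theorem NatExp.eval_member (x i : NatExp) :
    (NatExp.member x i).eval I s = memN I (x.eval I s) (i.eval I s) := rfl

@[simp] theorem NatExp.eval_get (a : ℕ) (i : NatExp) :
    (NatExp.get a i).eval I s = s.nat a (i.eval I s) := rfl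

@[simp] theorem NatExp.eval_add (e f : NatExp) :
    (NatExp.add e f).eval I s = e.eval I s + f.eval I s := rfl

@[simp] theorem NatExp.eval_sub (e f : NatExp) :
    (NatExp.sub e f).eval I s = e.eval I s - f.eval I s := rfl

@[simp] theorem NatExp.eval_sum (c : ℕ) (f : ℕ → NatExp) :
    (NatExp.sum c f).eval I s = ∑ i ∈ Finset.range c, (f i).eval I s := by
  induction c with
  | zero => rfl
  | succ c ih => rw [NatExp.sum, NatExp.eval_add, ih, Finset.sum_range_succ]

@[simp] theorem RealExp.eval_lit (c : ℕ) : (RealExp.lit c).eval I s = c := rfl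

@[simp] theorem RealExp.eval_dist (x y : NatExp) :
    (RealExp.dist x y).eval I s = distN I (x.eval I s) (y.eval I s) := rfl

@[simp] theorem RealExp.eval_get (a : ℕ) (i : NatExp) :
    (RealExp.get a i).eval I s = s.real a (i.eval I s) := rfl

@[simp] theorem RealExp.eval_add (e f : RealExp) :
    (RealExp.add e f).eval I s = e.eval I s + f.eval I s := rfl

@[simp] theorem RealExp.eval_smul (c : ℕ) (e : RealExp) :
    (RealExp.smul c e).eval I s = c * e.eval I s := by
  induction c with
  | zero => simp [RealExp.smul]
  | succ c ih =>
    rw [RealExp.smul, RealExp.eval_add, ih]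
    push_cast
    ring

@[simp] theorem Test.holds_natLe (e f : NatExp) :
    (Test.natLe e f).Holds I s ↔ e.eval I s ≤ f.eval I s := Iff.rfl

@[simp] theorem Test.holds_realLe (e f : RealExp) :
    (Test.realLe e f).Holds I s ↔ e.eval I s ≤ f.eval I s := Iff.rfl

@[simp] theorem Test.holds_not (t : Test) : (Test.not t).Holds I s ↔ ¬ t.Holds I s := Iff.rfl

@[simp] theorem Bound.eval_exp_lit (c : ℕ) : (Bound.lit c).exp.eval I s = c := rfl

@[simp] theorem Bound.eval_exp_size : Bound.size.exp.eval I s = n := rfl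

@[simp] theorem Bound.eval_exp_pow : Bound.pow.exp.eval I s = s.nat 1 0 := rfl

open Classical in
theorem Code.run_ite (t : Test) (p q : Code) (s : Memory) :
    (Code.ite t p q).run I s = if t.Holds I s then p.run I s else q.run I s := rfl

open Classical in
theorem Code.run_guard (ts : List Test) (p : Code) (s : Memory) :
    (Code.guard ts p).run I s = if ∀ t ∈ ts, t.Holds I s then p.run I s else s := by
  induction ts with
  | nil => simp [Code.guard]
  | cons t ts ih =>
    rw [Code.guard, Code.run_ite, ih, Code.run_skip]
    by_cases h : t.Holds I s <;> simp [h]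

end

/-! ### Preparations -/

/-- Array `2` receives the powers of `n + 1`. -/
def powersCode (m : ℕ) : Code :=
  .setNat 2 (.lit 0) (.lit 1) ;;
  .for_ 20 (.lit m) (.setNat 2 (.add (var 20) (.lit 1)) (.get 2 (var 20)) ;;
    .for_ 21 .size (.setNat 2 (.add (var 20) (.lit 1))
      (.add (.get 2 (.add (var 20) (.lit 1))) (.get 2 (var 20)))))

/-- Array `3` receives the weights of the points. -/
def weightsCode (m : ℕ) : Code :=
  .for_ 20 .size (.setNat 3 (var 20) (.lit 0) ;;
    .for_ 21 (.lit m) (.guard [.natLe (.lit 1) (.member (var 20) (var 21))]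
      (.setNat 3 (var 20) (.add (.get 3 (var 20)) (.get 2 (var 21))))))

/-- Array `4` receives the powers of `2`. -/
def twoPowersCode : Code :=
  .setNat 4 (.lit 0) (.lit 1) ;;
  .for_ 20 .size (.setNat 4 (.add (var 20) (.lit 1)) (.add (.get 4 (var 20)) (.get 4 (var 20))))

/-- The number `3 M - 1`. -/
def denom (m : ℕ) : ℕ := 3 * bigM m - 1

/-- The real register `0` receives a number larger than all multiples `(3 M - 1) d(x, y)`. -/
def hugeCode (m : ℕ) : Code :=
  .setReal 0 (.lit 0) (.lit 1) ;;
  .for_ 20 .size (.for_ 21 .size (.setReal 0 (.lit 0)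
    (.add (.get 0 (.lit 0)) (.smul (denom m) (.dist (var 20) (var 21))))))

section
variable {m n : ℕ} (I : Instance m n)

theorem denom_cast (m : ℕ) : (denom m : ℝ) = 3 * bigM m - 1 := by
  have := bigM_pos m
  rw [denom, Nat.cast_sub (by lia)]
  push_cast
  ring

theorem run_powersCode (s : Memory) :
    ∀ i ≤ m, ((powersCode m).run I s).nat 2 i = (n + 1) ^ i := by
  rw [powersCode, Code.run_seq]
  refine Code.run_for (fun i s' => ∀ j ≤ i, s'.nat 2 j = (n + 1) ^ j) rfl ?_ ?_ ?_
  · rintro j hj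
    obtain rfl : j = 0 := by lia
    simp
  · intro i hi s' _ _ hs' j hj
    rw [Code.run_seq]
    set s₁ := (Code.setNat 2 ((var 20).add (.lit 1)) (.get 2 (var 20))).run I
      (s'.setNat 20 0 i) with hs₁
    have h1 : s₁.nat 2 = Function.update (s'.nat 2) (i + 1) ((n + 1) ^ i) := by
      simp [hs₁, hs' i le_rfl]
    have h20 : s₁.nat 20 0 = i := by simp [hs₁]
    -- Multiplication by `n + 1` is one copy followed by `n` additions, hence the factor `k + 1`
    -- after `k` rounds.
    have key := Code.run_for (I := I) (a := 21) (b := .size)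
      (p := .setNat 2 (.add (var 20) (.lit 1))
        (.add (.get 2 (.add (var 20) (.lit 1))) (.get 2 (var 20)))) (s := s₁)
      (fun k s'' => s''.nat 2 = Function.update (s'.nat 2) (i + 1) ((k + 1) * (n + 1) ^ i)) rfl
      (by rw [h1]; simp) (by
        intro k _ s'' hfix _ h
        have h20' : s''.nat 20 0 = i := by rw [hfix 20 (of_decide_eq_true rfl), h20]
        simp [h, h20', hs' i le_rfl]
        congr 1
        ring) (by
        intro s'' h
        simpa using h)
    rw [key]
    rcases Nat.lt_or_ge j (i + 1) with hlt | hge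
    · rw [Function.update_of_ne (by lia)]
      exact hs' j (by lia)
    · obtain rfl : j = i + 1 := by lia
      simp [pow_succ, mul_comm]
  · intro s' h
    simpa using h

theorem run_weightsCode {s : Memory} (h : ∀ i ≤ m, s.nat 2 i = (n + 1) ^ i) :
    ∀ x < n, ((weightsCode m).run I s).nat 3 x =
      ∑ i ∈ Finset.range m, memN I x i * (n + 1) ^ i := by
  rw [weightsCode]
  refine Code.run_for (fun k s' => ∀ x < k, s'.nat 3 x =
      ∑ i ∈ Finset.range m, memN I x i * (n + 1) ^ i) rfl (by simp) ?_ ?_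
  · intro x hx s' hfix _ hs' x' hx'
    have h2 : s'.nat 2 = s.nat 2 := hfix 2 (of_decide_eq_true rfl)
    rw [Code.run_seq]
    have key := Code.run_for (I := I) (a := 21) (b := .lit m)
      (p := .guard [.natLe (.lit 1) (.member (var 20) (var 21))]
        (.setNat 3 (var 20) (.add (.get 3 (var 20)) (.get 2 (var 21)))))
      (s := (Code.setNat 3 (var 20) (.lit 0)).run I (s'.setNat 20 0 x))
      (fun k s'' => s''.nat 3 = Function.update (s'.nat 3) x
        (∑ i ∈ Finset.range k, memN I x i * (n + 1) ^ i)) rfl (by simp) (by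
        intro k hk s'' hfix' _ hs''
        have h20 : s''.nat 20 0 = x := by
          rw [hfix' 20 (of_decide_eq_true rfl)]
          simp
        have h2' : s''.nat 2 k = (n + 1) ^ k := by
          rw [hfix' 2 (of_decide_eq_true rfl)]
          simp [h2, h k hk.le]
        rw [Code.run_guard]
        have hmem : memN I x k = 0 ∨ memN I x k = 1 := by
          unfold memN
          split_ifs <;> simp
        rw [Finset.sum_range_succ]
        rcases hmem with hmem | hmem <;> simp [h20, hmem, hs'', h2']) (by
        intro s'' h
        simpa using h)
    rw [key]
    rcases Nat.lt_or_ge x' x with hlt | hge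
    · rw [Function.update_of_ne (by lia)]
      exact hs' x' hlt
    · obtain rfl : x' = x := by lia
      simp
  · intro s' h
    simpa using h

theorem run_twoPowersCode (s : Memory) :
    ∀ x ≤ n, (twoPowersCode.run I s).nat 4 x = 2 ^ x := by
  rw [twoPowersCode, Code.run_seq]
  refine Code.run_for (fun i s' => ∀ j ≤ i, s'.nat 4 j = 2 ^ j) rfl ?_ ?_ ?_
  · rintro j hj
    obtain rfl : j = 0 := by lia
    simp
  · intro i hi s' _ _ hs' j hj
    rcases Nat.lt_or_ge j (i + 1) with hlt | hge
    · simpa [Function.update_of_ne (show j ≠ i + 1 by lia)] using hs' j (by lia)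
    · obtain rfl : j = i + 1 := by lia
      simp [hs' i le_rfl, pow_succ, mul_two]
  · intro s' h
    simpa using h

/-- The register holds `1` plus a sum of non-negative terms that contains each product; the initial
`1` makes the inequalities strict. -/
theorem run_hugeCode (s : Memory) :
    0 < ((hugeCode m).run I s).real 0 0 ∧
      ∀ x < n, ∀ y < n, denom m * distN I x y < ((hugeCode m).run I s).real 0 0 := by
  have hnn : ∀ x y, (0 : ℝ) ≤ denom m * distN I x y := fun x y =>
    mul_nonneg (Nat.cast_nonneg _) (distN_nonneg I x y)
  rw [hugeCode, Code.run_seq]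
  refine Code.run_for (fun k s' => 0 < s'.real 0 0 ∧
    ∀ x < k, ∀ y < n, denom m * distN I x y < s'.real 0 0) rfl ?_ ?_ ?_
  · simp
  · intro x hx s' _ _ hs'
    have key := Code.run_for (I := I) (a := 21) (b := .size)
      (p := .setReal 0 (.lit 0)
        (.add (.get 0 (.lit 0)) (.smul (denom m) (.dist (var 20) (var 21)))))
      (s := s'.setNat 20 0 x)
      (fun k s'' => s'.real 0 0 ≤ s''.real 0 0 ∧
        ∀ y < k, denom m * distN I x y < s''.real 0 0) rfl (by simp) (by
        intro y hy s'' hfix _ hs''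
        have h20 : s''.nat 20 0 = x := by
          rw [hfix 20 (of_decide_eq_true rfl)]
          simp
        have h1 := hnn x y
        simp only [Code.run_setReal, Memory.setReal_real_self, NatExp.eval_lit,
          RealExp.eval_add, RealExp.eval_get, RealExp.eval_smul, RealExp.eval_dist,
          NatExp.eval_get, Function.update_self, Memory.setNat_real]
        simp only [ne_eq, Nat.reduceEqDiff, not_false_eq_true,
          Memory.setNat_nat_of_ne, h20, Memory.setNat_nat_self, Function.update_self]
        refine ⟨by linarith [hs''.1], fun y' hy' => ?_⟩
        rcases Nat.lt_or_ge y' y with hlt | hge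
        · linarith [hs''.2 y' hlt]
        · obtain rfl : y' = y := by lia
          linarith [hs''.1, hs'.1]) (by
        intro s'' h
        simpa using h)
    refine ⟨hs'.1.trans_le key.1, fun x' hx' y hy => ?_⟩
    rcases Nat.lt_or_ge x' x with hlt | hge
    · exact (hs'.2 x' hlt y hy).trans_le key.1
    · obtain rfl : x' = x := by lia
      exact key.2 y hy
  · intro s' h
    simpa using h

end

/-! ### The selection phase -/

/-- The number of classes of the point `x`. -/
def cardExp (m : ℕ) (x : NatExp) : NatExp := .sum m fun i => .member x (.lit i)

/-- The number of classes of the point `x` that do not contain `y`. -/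
def diffExp (m : ℕ) (x y : NatExp) : NatExp :=
  .sum m fun i => .sub (.member x (.lit i)) (.member y (.lit i))

/-- Register `8` is set to `1` if the point in register `21` is too close to a selected point. -/
def conflictCode (m : ℕ) : Code :=
  .for_ 22 .size (.guard [.natLe (.lit 1) (.get 5 (var 22)),
      .natLe (diffExp m (var 21) (var 22)) (.lit 0),
      .not (.realLe (.smul (bigM m) (.get 0 (.lit 0)))
        (.smul (denom m) (.dist (var 21) (var 22))))]
    (.setNat 8 (.lit 0) (.lit 1)))

/-- Array `5` receives the characteristic function of a selection, for the guess in the real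
register `0`. -/
def selectCode (m : ℕ) : Code :=
  .for_ 20 .size (.setNat 5 (var 20) (.lit 0)) ;;
  .for_ 20 (.lit m) (.for_ 21 .size
    (.guard [.natLe (.add (cardExp m (var 21)) (var 20)) (.lit m),
        .natLe (.lit m) (.add (cardExp m (var 21)) (var 20))]
      (.setNat 8 (.lit 0) (.lit 0) ;; conflictCode m ;;
        .setNat 5 (var 21) (.sub (.lit 1) (var 8)))))

section
variable {m n : ℕ} (I : Instance m n)

/-- The number of classes of a point. -/
def cardN (x : ℕ) : ℕ := ∑ i ∈ Finset.range m, memN I x i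

/-- All classes of `x` are classes of `y`. -/
def ColourLe (x y : ℕ) : Prop := ∀ i < m, memN I x i ≤ memN I y i

theorem memN_le_one (x i : ℕ) : memN I x i ≤ 1 := by
  unfold memN
  split_ifs <;> simp

theorem cardN_le (x : ℕ) : cardN I x ≤ m :=
  (Finset.sum_le_card_nsmul _ _ 1 fun i _ => memN_le_one I x i).trans (by simp)

theorem distN_comm (x y : ℕ) : distN I x y = distN I y x := by
  unfold distN
  by_cases h : x < n ∧ y < n
  · rw [dif_pos h, dif_pos h.symm, I.d_symm]
  · rw [dif_neg h, dif_neg fun h' => h h'.symm]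

variable {I} in
-- An inclusion of finite sets is an equality if the larger set has no more elements.
theorem ColourLe.symm_of_card_le {x y : ℕ} (h : ColourLe I x y)
    (hc : cardN I y ≤ cardN I x) : ColourLe I y x := by
  have hle : ∀ i ∈ Finset.range m, memN I x i ≤ memN I y i := fun i hi =>
    h i (Finset.mem_range.1 hi)
  have := (Finset.sum_eq_sum_iff_of_le hle).1 (le_antisymm (Finset.sum_le_sum hle) hc)
  exact fun i hi => (this i (Finset.mem_range.2 hi)).ge

@[simp]
theorem eval_cardExp (s : Memory) (x : NatExp) :
    (cardExp m x).eval I s = cardN I (x.eval I s) := by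
  simp [cardExp, cardN]

theorem eval_diffExp_le_zero (s : Memory) (x y : NatExp) :
    (diffExp m x y).eval I s ≤ 0 ↔ ColourLe I (x.eval I s) (y.eval I s) := by
  simp only [diffExp, NatExp.eval_sum, NatExp.eval_sub, NatExp.eval_member, NatExp.eval_lit,
    Nat.le_zero, Finset.sum_eq_zero_iff, Finset.mem_range, Nat.sub_eq_zero_iff_le, ColourLe]

/-- The points `x` and `y` are at distance less than `d1`. -/
def TooClose (γ : ℝ) (x y : ℕ) : Prop := denom m * distN I x y < bigM m * γ

/-- `z` is a selection from the points that satisfy `D`. -/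
structure SelectionSpec (γ : ℝ) (D : ℕ → Prop) (z : ℕ → ℕ) : Prop where
  done : ∀ x < n, z x ≠ 0 → D x
  separated : ∀ x < n, ∀ y < n, z x ≠ 0 → z y ≠ 0 → x ≠ y → ColourLe I x y →
    ¬ TooClose I γ x y
  cover : ∀ x < n, D x → z x = 0 → ∃ y < n, z y ≠ 0 ∧ ColourLe I x y ∧ TooClose I γ x y

variable {I}

theorem SelectionSpec.congr {γ : ℝ} {D D' : ℕ → Prop} {z : ℕ → ℕ} (h : SelectionSpec I γ D z)
    (hD : ∀ x < n, D x ↔ D' x) : SelectionSpec I γ D' z :=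
  ⟨fun x hx hz => (hD x hx).1 (h.done x hx hz), h.separated,
    fun x hx hDx => h.cover x hx ((hD x hx).2 hDx)⟩

/-- One greedy decision. Treated points have at least as many classes as `x`, so one whose colour is
contained in that of `x` has the same colour; testing the selected points of larger or equal colour
therefore detects all conflicts. Selected points are never removed, so covering persists. -/
theorem SelectionSpec.step {γ : ℝ} {D : ℕ → Prop} {z : ℕ → ℕ} (h : SelectionSpec I γ D z)
    {x : ℕ} (hx : x < n) (hxD : ¬ D x) (hcard : ∀ y < n, D y → cardN I x ≤ cardN I y) {v : ℕ}
    (hv : v = 0 ↔ ∃ y < n, z y ≠ 0 ∧ ColourLe I x y ∧ TooClose I γ x y) :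
    SelectionSpec I γ (fun y => D y ∨ y = x) (Function.update z x v) := by
  have hzx : z x = 0 := by
    by_contra hz
    exact hxD (h.done x hx hz)
  constructor
  · intro y hy hz
    rcases eq_or_ne y x with rfl | hne
    · exact Or.inr rfl
    · rw [Function.update_of_ne hne] at hz
      exact Or.inl (h.done y hy hz)
  · intro a ha b hb hza hzb hab hle hclose
    rcases eq_or_ne a x with rfl | hax
    · rw [Function.update_self] at hza
      rw [Function.update_of_ne (Ne.symm hab)] at hzb
      exact hza (hv.2 ⟨b, hb, hzb, hle, hclose⟩)
    · rw [Function.update_of_ne hax] at hza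
      rcases eq_or_ne b x with rfl | hbx
      · rw [Function.update_self] at hzb
        refine hzb (hv.2 ⟨a, ha, hza, ?_, ?_⟩)
        · exact hle.symm_of_card_le (hcard a ha (h.done a ha hza))
        · rwa [TooClose, distN_comm]
      · rw [Function.update_of_ne hbx] at hzb
        exact h.separated a ha b hb hza hzb hab hle hclose
  · intro a ha hDa hza
    have lift : (∃ y < n, z y ≠ 0 ∧ ColourLe I a y ∧ TooClose I γ a y) →
        ∃ y < n, Function.update z x v y ≠ 0 ∧ ColourLe I a y ∧ TooClose I γ a y := by
      rintro ⟨y, hy, hzy, h1, h2⟩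
      refine ⟨y, hy, ?_, h1, h2⟩
      rwa [Function.update_of_ne]
      rintro rfl
      exact hzy hzx
    apply lift
    rcases eq_or_ne a x with rfl | hax
    · rw [Function.update_self] at hza
      exact hv.1 hza
    · rw [Function.update_of_ne hax] at hza
      exact h.cover a ha (hDa.resolve_right hax) hza

theorem run_conflictCode {s : Memory} (h8 : s.nat 8 0 = 0) :
    ((conflictCode m).run I s).nat 8 0 =
      open Classical in if ∃ y < n, s.nat 5 y ≠ 0 ∧ ColourLe I (s.nat 21 0) y ∧
        TooClose I (s.real 0 0) (s.nat 21 0) y then 1 else 0 := by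
  classical
  rw [conflictCode]
  refine Code.run_for (fun k s' => s'.nat 8 0 = if ∃ y < k, s.nat 5 y ≠ 0 ∧
    ColourLe I (s.nat 21 0) y ∧ TooClose I (s.real 0 0) (s.nat 21 0) y then 1 else 0) rfl ?_ ?_ ?_
  · simpa using h8
  · intro y hy s' hfix hreal hs'
    have h5 : s'.nat 5 = s.nat 5 := hfix 5 (of_decide_eq_true rfl)
    have h21 : s'.nat 21 = s.nat 21 := hfix 21 (of_decide_eq_true rfl)
    have hr : s'.real 0 = s.real 0 := hreal 0 (of_decide_eq_true rfl)
    rw [Code.run_guard]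
    have hiff : (∀ t ∈ [Test.natLe (.lit 1) (.get 5 (var 22)),
          .natLe (diffExp m (var 21) (var 22)) (.lit 0),
          .not (.realLe (.smul (bigM m) (.get 0 (.lit 0)))
            (.smul (denom m) (.dist (var 21) (var 22))))], t.Holds I (s'.setNat 22 0 y)) ↔
        s.nat 5 y ≠ 0 ∧ ColourLe I (s.nat 21 0) y ∧
          TooClose I (s.real 0 0) (s.nat 21 0) y := by
      simp only [List.forall_mem_cons, Test.holds_natLe, NatExp.eval_lit, eval_diffExp_le_zero]
      simp [h5, h21, hr, TooClose, Nat.one_le_iff_ne_zero]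
    by_cases hc : s.nat 5 y ≠ 0 ∧ ColourLe I (s.nat 21 0) y ∧
      TooClose I (s.real 0 0) (s.nat 21 0) y
    · rw [if_pos (hiff.2 hc), if_pos ⟨y, by lia, hc⟩]
      simp
    · rw [if_neg (fun h => hc (hiff.1 h))]
      simp only [ne_eq, Nat.reduceEqDiff, not_false_eq_true, Memory.setNat_nat_of_ne]
      rw [hs']
      congr 1
      refine propext ⟨fun ⟨y', h1, h2⟩ => ⟨y', by lia, h2⟩, fun ⟨y', h1, h2⟩ => ?_⟩
      rcases Nat.lt_or_ge y' y with hlt | hge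
      · exact ⟨y', hlt, h2⟩
      · obtain rfl : y' = y := by lia
        exact absurd h2 hc
  · intro s' h
    simpa using h

theorem run_selectCode (s : Memory) :
    SelectionSpec I (s.real 0 0) (fun x => 0 < cardN I x) (((selectCode m).run I s).nat 5) := by
  rw [selectCode, Code.run_seq]
  set s₁ := (Code.for_ 20 .size (.setNat 5 (var 20) (.lit 0))).run I s with hs₁
  have h5 : ∀ x < n, s₁.nat 5 x = 0 := by
    rw [hs₁]
    refine Code.run_for (fun k s' => ∀ x < k, s'.nat 5 x = 0) rfl (by simp) ?_ ?_
    · intro k hk s' _ _ hs' x hx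
      simp only [Code.run_setNat, NatExp.eval_get, NatExp.eval_lit, Memory.setNat_nat_self,
        Function.update_self]
      rcases eq_or_ne x k with rfl | hne
      · simp
      · simpa [hne] using hs' x (by lia)
    · intro s' h
      simpa using h
  have hr : s₁.real 0 = s.real 0 := Code.run_real_of_not_mem (of_decide_eq_true rfl) s
  rw [← hr]
  -- Round `l` treats the points in exactly `m - l` classes, so the points treated before it have
  -- more than `m - l`. After `m` rounds all coloured points are treated.
  have key := Code.run_for (I := I) (a := 20) (b := .lit m) (p := .for_ 21 .size
    (.guard [.natLe (.add (cardExp m (var 21)) (var 20)) (.lit m),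
        .natLe (.lit m) (.add (cardExp m (var 21)) (var 20))]
      (.setNat 8 (.lit 0) (.lit 0) ;; conflictCode m ;;
        .setNat 5 (var 21) (.sub (.lit 1) (var 8))))) (s := s₁)
    (fun l s' => SelectionSpec I (s₁.real 0 0) (fun x => m < cardN I x + l) (s'.nat 5)) rfl
    ?_ ?_ ?_
  · exact key.congr fun x _ => by simp
  · refine ⟨fun x hx hz => absurd (h5 x hx) hz, fun x hx y _ hz => absurd (h5 x hx) hz, ?_⟩
    intro x _ hD
    have := cardN_le I x
    simp only [add_zero] at hD
    lia
  · intro l hl s' hfix hreal hs'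
    have hr' : s'.real 0 = s₁.real 0 := hreal 0 (of_decide_eq_true rfl)
    have key := Code.run_for (I := I) (a := 21) (b := .size)
      (p := .guard [.natLe (.add (cardExp m (var 21)) (var 20)) (.lit m),
        .natLe (.lit m) (.add (cardExp m (var 21)) (var 20))]
      (.setNat 8 (.lit 0) (.lit 0) ;; conflictCode m ;;
        .setNat 5 (var 21) (.sub (.lit 1) (var 8)))) (s := s'.setNat 20 0 l)
      (fun p s'' => SelectionSpec I (s₁.real 0 0)
        (fun x => m < cardN I x + l ∨ (m = cardN I x + l ∧ x < p)) (s''.nat 5)) rfl ?_ ?_ ?_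
    · refine key.congr fun x hx => ?_
      simp only [Bound.eval_exp_size]
      lia
    · simpa using hs'
    · intro p hp s'' hfix' hreal' hs''
      simp only [Bound.eval_exp_size] at hp
      have h20 : s''.nat 20 0 = l := by
        rw [hfix' 20 (of_decide_eq_true rfl)]
        simp
      have hr'' : s''.real 0 = s₁.real 0 := by
        rw [hreal' 0 (of_decide_eq_true rfl)]
        simp [hr']
      rw [Code.run_guard]
      by_cases hc : m = cardN I p + l
      · rw [if_pos (by simp [h20]; lia)]
        set s₂ := (s''.setNat 21 0 p).setNat 8 0 0 with hs₂
        have hconf := run_conflictCode (I := I) (s := s₂) (by simp [hs₂])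
        have h5c : ((conflictCode m).run I s₂).nat 5 = s''.nat 5 := by
          rw [Code.run_nat_of_not_mem (of_decide_eq_true rfl)]
          simp [hs₂]
        have h21c : ((conflictCode m).run I s₂).nat 21 0 = p := by
          rw [Code.run_nat_of_not_mem (of_decide_eq_true rfl)]
          simp [hs₂]
        have hrun : ((Code.setNat 8 (.lit 0) (.lit 0) ;; conflictCode m ;;
            .setNat 5 (var 21) (.sub (.lit 1) (var 8))).run I (s''.setNat 21 0 p)).nat 5 =
            Function.update (s''.nat 5) p (1 - ((conflictCode m).run I s₂).nat 8 0) := by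
          simp [← hs₂, h5c, h21c]
        rw [hrun]
        refine (hs''.step hp (by lia) ?_ ?_).congr ?_
        · intro y _ hy
          lia
        · rw [hconf]
          split_ifs with h
          · simpa [hs₂, hr''] using h
          · simpa [hs₂, hr''] using h
        · intro x _
          constructor
          · rintro (h | rfl) <;> lia
          · intro h
            rcases eq_or_ne x p with rfl | hne
            · exact Or.inr rfl
            · left
              lia
      · rw [if_neg (by simp [h20]; lia)]
        simp only [ne_eq, Nat.reduceEqDiff, not_false_eq_true, Memory.setNat_nat_of_ne]
        refine hs''.congr fun x _ => ?_
        rcases eq_or_ne x p with rfl | hne <;> lia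
    · intro s'' h
      simpa using h
  · intro s' h
    simpa using h

end

/-! ### The components -/

/-- In array `6` the entries with the value in register `9` are replaced by register `10`. -/
def relabelCode : Code :=
  .for_ 22 .size (.guard [.natLe (.get 6 (var 22)) (var 9), .natLe (var 9) (.get 6 (var 22))]
    (.setNat 6 (var 22) (var 10)))

/-- Array `6` receives a labelling of the points whose level sets on the selected points are the
components. -/
def componentsCode (m : ℕ) : Code :=
  .for_ 20 .size (.setNat 6 (var 20) (var 20)) ;;
  .for_ 20 .size (.for_ 21 .size
    (.guard [.natLe (.lit 1) (.get 5 (var 20)), .natLe (.lit 1) (.get 5 (var 21)),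
        .not (.realLe (.get 0 (.lit 0)) (.smul (denom m) (.dist (var 20) (var 21))))]
      (.setNat 9 (.lit 0) (.get 6 (var 20)) ;; .setNat 10 (.lit 0) (.get 6 (var 21)) ;;
        relabelCode)))

section
variable {m n : ℕ} (I : Instance m n)

/-- The selected points `x` and `y` are adjacent or equal. -/
def CloseN (γ : ℝ) (z : ℕ → ℕ) (x y : ℕ) : Prop :=
  x < n ∧ y < n ∧ z x ≠ 0 ∧ z y ≠ 0 ∧ denom m * distN I x y < γ

/-- `c` is a labelling by components, where only the edges that satisfy `Q` have been taken into
account. -/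
structure LabelSpec (γ : ℝ) (z : ℕ → ℕ) (Q : ℕ → ℕ → Prop) (c : ℕ → ℕ) : Prop where
  lt : ∀ u < n, c u < n
  sound : ∀ u < n, ∀ v < n, c u = c v → Relation.EqvGen (CloseN I γ z) u v
  complete : ∀ u v, Q u v → CloseN I γ z u v → c u = c v

variable {I}

theorem LabelSpec.congr {γ : ℝ} {z : ℕ → ℕ} {Q Q' : ℕ → ℕ → Prop} {c : ℕ → ℕ}
    (h : LabelSpec I γ z Q c) (hQ : ∀ u < n, ∀ v < n, CloseN I γ z u v → Q' u v → Q u v) :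
    LabelSpec I γ z Q' c :=
  ⟨h.lt, h.sound, fun u v hq hr => h.complete u v (hQ u hr.1 v hr.2.1 hr hq) hr⟩

/-- Renaming the label of `x` to that of `y` merges two label classes that are joined by an edge.
Equal labels stay equal, so edges processed earlier remain respected. -/
theorem LabelSpec.step {γ : ℝ} {z : ℕ → ℕ} {Q : ℕ → ℕ → Prop} {c : ℕ → ℕ}
    (h : LabelSpec I γ z Q c) {x y : ℕ} (hxy : CloseN I γ z x y) :
    LabelSpec I γ z (fun u v => Q u v ∨ (u = x ∧ v = y))
      (fun u => if u < n ∧ c u = c x then c y else c u) := by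
  have hr : Relation.EqvGen (CloseN I γ z) x y := .rel _ _ hxy
  constructor
  · intro u hu
    split_ifs
    · exact h.lt y hxy.2.1
    · exact h.lt u hu
  · intro u hu v hv huv
    simp only [hu, hv, true_and] at huv
    split_ifs at huv with h1 h2 h2
    · exact h.sound u hu v hv (h1.trans h2.symm)
    · exact ((h.sound u hu x hxy.1 h1).trans _ _ _ hr).trans _ _ _ (h.sound y hxy.2.1 v hv huv)
    · exact (h.sound u hu y hxy.2.1 huv).trans _ _ _
        ((hr.symm _ _).trans _ _ _ (h.sound x hxy.1 v hv h2.symm))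
    · exact h.sound u hu v hv huv
  · rintro u v (hq | ⟨rfl, rfl⟩) hr
    · simp only [hr.1, hr.2.1, true_and, h.complete u v hq hr]
    · simp only [hr.1, hr.2.1, true_and, if_true]
      split_ifs <;> rfl

/-- The old and the new label are kept in registers `9` and `10`, because array `6` changes during
the loop. -/
theorem run_relabelCode (s : Memory) :
    (relabelCode.run I s).nat 6 = fun u =>
      if u < n ∧ s.nat 6 u = s.nat 9 0 then s.nat 10 0 else s.nat 6 u := by
  rw [relabelCode]
  refine Code.run_for (fun k s' => s'.nat 6 = fun u =>
    if u < k ∧ s.nat 6 u = s.nat 9 0 then s.nat 10 0 else s.nat 6 u) rfl (by simp) ?_ ?_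
  · intro k hk s' hfix _ hs'
    have h9 : s'.nat 9 = s.nat 9 := hfix 9 (of_decide_eq_true rfl)
    have h10 : s'.nat 10 = s.nat 10 := hfix 10 (of_decide_eq_true rfl)
    have hk6 : s'.nat 6 k = s.nat 6 k := by simp [hs']
    rw [Code.run_guard]
    by_cases hc : s.nat 6 k = s.nat 9 0
    · rw [if_pos (by simp [hk6, h9, hc])]
      funext u
      rcases eq_or_ne u k with rfl | hne
      · simp [h10, hc]
      · have : (u < k + 1) = (u < k) := propext (by lia)
        simp [hne, hs', this]
    · rw [if_neg (by simp [hk6, h9]; lia)]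
      funext u
      rcases eq_or_ne u k with rfl | hne
      · simp [hc, hs']
      · have : (u < k + 1) = (u < k) := propext (by lia)
        simp [hs', this]
  · intro s' h
    simpa using h

theorem run_componentsCode (s : Memory) :
    LabelSpec I (s.real 0 0) (s.nat 5) (fun _ _ => True)
      (((componentsCode m).run I s).nat 6) := by
  rw [componentsCode, Code.run_seq]
  set s₁ := (Code.for_ 20 .size (.setNat 6 (var 20) (var 20))).run I s with hs₁
  have h6 : ∀ x < n, s₁.nat 6 x = x := by
    rw [hs₁]
    refine Code.run_for (fun k s' => ∀ x < k, s'.nat 6 x = x) rfl (by simp) ?_ ?_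
    · intro k hk s' _ _ hs' x hx
      rcases eq_or_ne x k with rfl | hne
      · simp
      · simpa [hne] using hs' x (by lia)
    · intro s' h
      simpa using h
  have hr : s₁.real 0 = s.real 0 := Code.run_real_of_not_mem (of_decide_eq_true rfl) s
  have h5 : s₁.nat 5 = s.nat 5 := Code.run_nat_of_not_mem (of_decide_eq_true rfl) s
  rw [← hr, ← h5]
  -- All ordered pairs are visited lexicographically. The inner invariant covers the pairs before
  -- `(x, y)`; a pair that fails the test is no edge and demands nothing.
  have key := Code.run_for (I := I) (a := 20) (b := .size) (p := .for_ 21 .size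
    (.guard [.natLe (.lit 1) (.get 5 (var 20)), .natLe (.lit 1) (.get 5 (var 21)),
        .not (.realLe (.get 0 (.lit 0)) (.smul (denom m) (.dist (var 20) (var 21))))]
      (.setNat 9 (.lit 0) (.get 6 (var 20)) ;; .setNat 10 (.lit 0) (.get 6 (var 21)) ;;
        relabelCode))) (s := s₁)
    (fun k s' => LabelSpec I (s₁.real 0 0) (s₁.nat 5) (fun u _ => u < k) (s'.nat 6)) rfl
    ?_ ?_ ?_
  · exact key.congr fun u hu v hv _ _ => hu
  · refine ⟨fun u hu => by rwa [h6 u hu], fun u hu v hv huv => ?_, fun u v h => by lia⟩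
    rw [h6 u hu, h6 v hv] at huv
    rw [huv]
    exact .refl _
  · intro x hx s' hfix hreal hs'
    simp only [Bound.eval_exp_size] at hx
    have h5' : s'.nat 5 = s₁.nat 5 := hfix 5 (of_decide_eq_true rfl)
    have hr' : s'.real 0 = s₁.real 0 := hreal 0 (of_decide_eq_true rfl)
    have key := Code.run_for (I := I) (a := 21) (b := .size)
      (p := .guard [.natLe (.lit 1) (.get 5 (var 20)), .natLe (.lit 1) (.get 5 (var 21)),
        .not (.realLe (.get 0 (.lit 0)) (.smul (denom m) (.dist (var 20) (var 21))))]
      (.setNat 9 (.lit 0) (.get 6 (var 20)) ;; .setNat 10 (.lit 0) (.get 6 (var 21)) ;;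
        relabelCode)) (s := s'.setNat 20 0 x)
      (fun y s'' => LabelSpec I (s₁.real 0 0) (s₁.nat 5) (fun u v => u < x ∨ (u = x ∧ v < y))
        (s''.nat 6)) rfl ?_ ?_ ?_
    · refine key.congr fun u hu v hv _ h => ?_
      simp only [Bound.eval_exp_size]
      lia
    · simpa using hs'
    · intro y hy s'' hfix' hreal' hs''
      simp only [Bound.eval_exp_size] at hy
      have h20 : s''.nat 20 0 = x := by
        rw [hfix' 20 (of_decide_eq_true rfl)]
        simp
      have h5'' : s''.nat 5 = s₁.nat 5 := by
        rw [hfix' 5 (of_decide_eq_true rfl)]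
        simp [h5']
      have hr'' : s''.real 0 = s₁.real 0 := by
        rw [hreal' 0 (of_decide_eq_true rfl)]
        simp [hr']
      rw [Code.run_guard]
      by_cases hc : CloseN I (s₁.real 0 0) (s₁.nat 5) x y
      · rw [if_pos (by simpa [h20, h5'', hr'', Nat.one_le_iff_ne_zero] using hc.2.2)]
        rw [Code.run_seq, Code.run_seq, run_relabelCode]
        refine LabelSpec.congr (Q := fun u v => (u < x ∨ (u = x ∧ v < y)) ∨ (u = x ∧ v = y)) ?_
          fun u hu v hv _ h => by lia
        simpa [h20] using hs''.step hc
      · rw [if_neg (fun h => hc ⟨hx, hy,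
          by simpa [h20, h5'', hr'', Nat.one_le_iff_ne_zero] using h⟩)]
        simp only [ne_eq, Nat.reduceEqDiff, not_false_eq_true, Memory.setNat_nat_of_ne]
        refine hs''.congr fun u _ v _ hr h => ?_
        rcases eq_or_ne v y with rfl | hne
        · rcases h with h | ⟨rfl, h⟩
          · exact Or.inl h
          · exact absurd hr hc
        · lia
    · intro s'' h
      simpa using h
  · intro s' h
    simpa using h

end

/-! ### The search for a transversal -/

/-- One step of the dynamic program: array `7` is updated at the state in register `16`, for the
component in register `20`. -/
def stateCode : Code :=
  .for_ 22 .size (.guard [.natLe (.lit 1) (.get 5 (var 22)),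
      .natLe (.get 6 (var 22)) (var 20), .natLe (var 20) (.get 6 (var 22)),
      .natLe (.get 3 (var 22)) (var 16),
      .natLe (.lit 1) (.get 7 (.sub (var 16) (.get 3 (var 22))))]
    (.setNat 7 (var 16) (.add (.get 7 (.sub (var 16) (.get 3 (var 22)))) (.get 4 (var 22)))))

/-- Array `7` receives, for every number `s`, the code of a transversal of weight `s`, or `0` if
there is none. -/
def searchCode : Code :=
  .for_ 20 .pow (.setNat 7 (var 20) (.lit 0)) ;;
  .setNat 7 (.lit 0) (.lit 1) ;;
  .for_ 20 .size (.for_ 21 .pow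
    (.setNat 16 (.lit 0) (.sub (var 1) (.add (var 21) (.lit 1))) ;; stateCode))

/-- Sets of points are coded by numbers. -/
def codeOf (T : Finset ℕ) : ℕ := 1 + ∑ x ∈ T, 2 ^ x

/-- `T` consists of selected points with different labels that are less than `j`. -/
structure PartialTransversal (n : ℕ) (z c : ℕ → ℕ) (j : ℕ) (T : Finset ℕ) : Prop where
  lt : ∀ x ∈ T, x < n
  selected : ∀ x ∈ T, z x ≠ 0
  label_lt : ∀ x ∈ T, c x < j
  inj : ∀ x ∈ T, ∀ y ∈ T, c x = c y → x = y

/-- `v` codes a transversal of weight `s`; it may be `0` only if there is none that satisfies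
`Q`. -/
def StateSpec (n : ℕ) (z c w : ℕ → ℕ) (j : ℕ) (Q : Finset ℕ → Prop) (s v : ℕ) : Prop :=
  (v ≠ 0 → ∃ T, PartialTransversal n z c j T ∧ ∑ x ∈ T, w x = s ∧ v = codeOf T) ∧
    ∀ T, PartialTransversal n z c j T → Q T → ∑ x ∈ T, w x = s → v ≠ 0

section
variable {n : ℕ} {z c w : ℕ → ℕ} {j s v x : ℕ}

/-- The restriction `y < 0` forbids label `j`, so no transversal is required beyond those with
labels below `j`. -/
theorem StateSpec.start (h : StateSpec n z c w j (fun _ => True) s v) :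
    StateSpec n z c w (j + 1) (fun T => ∀ y ∈ T, c y = j → y < 0) s v := by
  constructor
  · intro hv
    obtain ⟨T, hT, h1, h2⟩ := h.1 hv
    exact ⟨T, ⟨hT.lt, hT.selected, fun x hx => (hT.label_lt x hx).trans (Nat.lt_succ_self j),
      hT.inj⟩, h1, h2⟩
  · intro T hT hQ hs
    refine h.2 T ⟨hT.lt, hT.selected, fun x hx => ?_, hT.inj⟩ trivial hs
    have h1 := hT.label_lt x hx
    have h2 := hQ x hx
    lia

theorem StateSpec.finish
    (h : StateSpec n z c w j (fun T => ∀ y ∈ T, c y = j - 1 → y < n) s v) :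
    StateSpec n z c w j (fun _ => True) s v :=
  ⟨h.1, fun T hT _ => h.2 T hT fun y hy _ => hT.lt y hy⟩

/-- The label of `x` does not occur in a transversal with smaller labels, so `x` can be inserted.
Completeness is immediate, as the new entry is not `0`. -/
theorem StateSpec.step_add {v' : ℕ} (hx : x < n) (hz : z x ≠ 0) (hc : c x = j) (hw : w x ≤ s)
    (hv' : v' ≠ 0) (h' : StateSpec n z c w j (fun _ => True) (s - w x) v') :
    StateSpec n z c w (j + 1) (fun T => ∀ y ∈ T, c y = j → y < x + 1) s (v' + 2 ^ x) := by
  refine ⟨fun _ => ?_, fun _ _ _ _ => by positivity⟩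
  obtain ⟨T, hT, h1, h2⟩ := h'.1 hv'
  have hxT : x ∉ T := fun h => (hT.label_lt x h).ne hc
  refine ⟨insert x T, ⟨?_, ?_, ?_, ?_⟩, ?_, ?_⟩
  · exact Finset.forall_mem_insert _ _ _ |>.2 ⟨hx, hT.lt⟩
  · exact Finset.forall_mem_insert _ _ _ |>.2 ⟨hz, hT.selected⟩
  · exact Finset.forall_mem_insert _ _ _ |>.2
      ⟨by lia, fun y hy => (hT.label_lt y hy).trans (Nat.lt_succ_self j)⟩
  · intro a ha b hb hab
    rcases Finset.mem_insert.1 ha with ha' | ha' <;> rcases Finset.mem_insert.1 hb with hb' | hb'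
    · rw [ha', hb']
    · have := hT.label_lt b hb'
      rw [ha'] at hab
      lia
    · have := hT.label_lt a ha'
      rw [hb'] at hab
      lia
    · exact hT.inj a ha' b hb' hab
  · rw [Finset.sum_insert hxT, h1]
    lia
  · rw [h2, codeOf, codeOf, Finset.sum_insert hxT]
    ring

/-- A transversal that uses `x` with label `j` would leave, after removal of `x`, one with labels
below `j` and weight `s - w x`, which the entry `0` excludes. All others are covered before. -/
theorem StateSpec.step_skip
    (h : StateSpec n z c w (j + 1) (fun T => ∀ y ∈ T, c y = j → y < x) s v)
    (h' : z x ≠ 0 → c x = j → w x ≤ s →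
      StateSpec n z c w j (fun _ => True) (s - w x) 0) :
    StateSpec n z c w (j + 1) (fun T => ∀ y ∈ T, c y = j → y < x + 1) s v := by
  refine ⟨h.1, fun T hT hQ hs => ?_⟩
  by_cases hx : x ∈ T ∧ c x = j
  · exfalso
    have hsum := Finset.add_sum_erase T w hx.1
    have hw : w x ≤ s := by lia
    refine (h' (hT.selected x hx.1) hx.2 hw).2 (T.erase x) ⟨?_, ?_, ?_, ?_⟩ trivial (by lia) rfl
    · exact fun y hy => hT.lt y (Finset.mem_of_mem_erase hy)
    · exact fun y hy => hT.selected y (Finset.mem_of_mem_erase hy)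
    · intro y hy
      have h1 := hT.label_lt y (Finset.mem_of_mem_erase hy)
      have h2 : c y ≠ j := fun h => (Finset.mem_erase.1 hy).1
        (hT.inj y (Finset.mem_of_mem_erase hy) x hx.1 (h.trans hx.2.symm))
      lia
    · exact fun a ha b hb => hT.inj a (Finset.mem_of_mem_erase ha) b (Finset.mem_of_mem_erase hb)
  · refine h.2 T hT (fun y hy hcy => ?_) hs
    have h1 := hQ y hy hcy
    rcases eq_or_ne y x with rfl | hne
    · exact absurd ⟨hy, hcy⟩ hx
    · lia

end

section
variable {m n : ℕ} {I : Instance m n}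

theorem run_stateCode {s : Memory} (hpos : ∀ x < n, s.nat 5 x ≠ 0 → 0 < s.nat 3 x)
    (h4 : ∀ x ≤ n, s.nat 4 x = 2 ^ x)
    (hold : ∀ t ≤ s.nat 16 0, StateSpec n (s.nat 5) (s.nat 6) (s.nat 3) (s.nat 20 0)
      (fun _ => True) t (s.nat 7 t)) :
    ∃ v, (stateCode.run I s).nat 7 = Function.update (s.nat 7) (s.nat 16 0) v ∧
      StateSpec n (s.nat 5) (s.nat 6) (s.nat 3) (s.nat 20 0 + 1) (fun _ => True)
        (s.nat 16 0) v := by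
  rw [stateCode]
  have key := Code.run_for (I := I) (a := 22) (b := .size) (N := n)
    (p := .guard [.natLe (.lit 1) (.get 5 (var 22)),
      .natLe (.get 6 (var 22)) (var 20), .natLe (var 20) (.get 6 (var 22)),
      .natLe (.get 3 (var 22)) (var 16),
      .natLe (.lit 1) (.get 7 (.sub (var 16) (.get 3 (var 22))))]
    (.setNat 7 (var 16) (.add (.get 7 (.sub (var 16) (.get 3 (var 22)))) (.get 4 (var 22)))))
    (s := s)
    (fun x s' => ∃ v, s'.nat 7 = Function.update (s.nat 7) (s.nat 16 0) v ∧
      StateSpec n (s.nat 5) (s.nat 6) (s.nat 3) (s.nat 20 0 + 1)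
        (fun T => ∀ y ∈ T, s.nat 6 y = s.nat 20 0 → y < x) (s.nat 16 0) v) rfl
    ⟨s.nat 7 (s.nat 16 0), by simp, (hold _ le_rfl).start⟩ ?_ ?_
  · obtain ⟨v, h1, h2⟩ := key
    exact ⟨v, h1, h2.finish⟩
  · rintro x hx s' hfix - ⟨v, hv, hspec⟩
    have f3 : s'.nat 3 = s.nat 3 := hfix 3 (of_decide_eq_true rfl)
    have f4 : s'.nat 4 = s.nat 4 := hfix 4 (of_decide_eq_true rfl)
    have f5 : s'.nat 5 = s.nat 5 := hfix 5 (of_decide_eq_true rfl)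
    have f6 : s'.nat 6 = s.nat 6 := hfix 6 (of_decide_eq_true rfl)
    have f16 : s'.nat 16 = s.nat 16 := hfix 16 (of_decide_eq_true rfl)
    have f20 : s'.nat 20 = s.nat 20 := hfix 20 (of_decide_eq_true rfl)
    -- Weights of selected points are positive, so the entry read is not the one being rewritten and
    -- still belongs to the labels below the current one.
    have hread : s.nat 5 x ≠ 0 → s.nat 3 x ≤ s.nat 16 0 →
        s'.nat 7 (s.nat 16 0 - s.nat 3 x) = s.nat 7 (s.nat 16 0 - s.nat 3 x) := by
      intro hz hw
      have := hpos x hx hz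
      rw [hv, Function.update_of_ne (by lia)]
    have hiff : (∀ t ∈ [Test.natLe (.lit 1) (.get 5 (var 22)),
          .natLe (.get 6 (var 22)) (var 20), .natLe (var 20) (.get 6 (var 22)),
          .natLe (.get 3 (var 22)) (var 16),
          .natLe (.lit 1) (.get 7 (.sub (var 16) (.get 3 (var 22))))],
          t.Holds I (s'.setNat 22 0 x)) ↔
        s.nat 5 x ≠ 0 ∧ s.nat 6 x = s.nat 20 0 ∧ s.nat 3 x ≤ s.nat 16 0 ∧
          s'.nat 7 (s.nat 16 0 - s.nat 3 x) ≠ 0 := by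
      simp [f3, f5, f6, f16, f20, Nat.one_le_iff_ne_zero]
      lia
    rw [Code.run_guard]
    split_ifs with hc
    · obtain ⟨hz, hcx, hw, hne⟩ := hiff.1 hc
      rw [hread hz hw] at hne
      refine ⟨s.nat 7 (s.nat 16 0 - s.nat 3 x) + 2 ^ x, ?_,
        StateSpec.step_add hx hz hcx hw hne (hold _ (Nat.sub_le _ _))⟩
      simp [f3, f4, f16, hread hz hw, h4 x hx.le]
      simp [hv]
    · refine ⟨v, by simpa using hv, hspec.step_skip fun hz hcx hw => ?_⟩
      have h0 : s.nat 7 (s.nat 16 0 - s.nat 3 x) = 0 := by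
        by_contra hne
        exact hc (hiff.2 ⟨hz, hcx, hw, by rwa [hread hz hw]⟩)
      have := hold _ (Nat.sub_le (s.nat 16 0) (s.nat 3 x))
      rwa [h0] at this
  · rintro s' ⟨v, h1, h2⟩
    exact ⟨v, by simpa using h1, h2⟩

theorem run_searchCode {s : Memory} (hpos : ∀ x < n, s.nat 5 x ≠ 0 → 0 < s.nat 3 x)
    (h4 : ∀ x ≤ n, s.nat 4 x = 2 ^ x) :
    ∀ t < s.nat 1 0, StateSpec n (s.nat 5) (s.nat 6) (s.nat 3) n (fun _ => True) t
      ((searchCode.run I s).nat 7 t) := by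
  rw [searchCode, Code.run_seq, Code.run_seq]
  set s₀ := (Code.for_ 20 .pow (.setNat 7 (var 20) (.lit 0))).run I s with hs₀
  have h7 : ∀ t < s.nat 1 0, s₀.nat 7 t = 0 := by
    rw [hs₀]
    refine Code.run_for (fun k s' => ∀ x < k, s'.nat 7 x = 0) rfl (by simp) ?_ ?_
    · intro k hk s' _ _ hs' x hx
      rcases eq_or_ne x k with rfl | hne
      · simp
      · simpa [hne] using hs' x (by lia)
    · intro s' h
      simpa using h
  set s₁ := (Code.setNat 7 (.lit 0) (.lit 1)).run I s₀ with hs₁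
  have fix : ∀ a ∉ [7, 20], s₁.nat a = s.nat a := by
    intro a ha
    simp only [List.mem_cons, List.not_mem_nil, or_false, not_or] at ha
    rw [hs₁, Code.run_setNat, Memory.setNat_nat_of_ne _ _ _ ha.1, hs₀]
    exact Code.run_nat_of_not_mem (by simp [Code.writes, ha]) s
  have e1 : s₁.nat 1 = s.nat 1 := fix 1 (of_decide_eq_true rfl)
  have e3 : s₁.nat 3 = s.nat 3 := fix 3 (of_decide_eq_true rfl)
  have e4 : s₁.nat 4 = s.nat 4 := fix 4 (of_decide_eq_true rfl)
  have e5 : s₁.nat 5 = s.nat 5 := fix 5 (of_decide_eq_true rfl)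
  have e6 : s₁.nat 6 = s.nat 6 := fix 6 (of_decide_eq_true rfl)
  have e7 : s₁.nat 7 = Function.update (s₀.nat 7) 0 1 := by simp [hs₁]
  rw [← e1, ← e3, ← e5, ← e6]
  rw [← e3, ← e5] at hpos
  rw [← e4] at h4
  rw [← e1] at h7
  refine Code.run_for (fun j s' => ∀ t < s₁.nat 1 0, StateSpec n (s₁.nat 5) (s₁.nat 6)
    (s₁.nat 3) j (fun _ => True) t (s'.nat 7 t)) rfl ?_ ?_ ?_
  · intro t ht
    have hempty : ∀ T, PartialTransversal n (s₁.nat 5) (s₁.nat 6) 0 T → T = ∅ := fun T hT =>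
      Finset.eq_empty_of_forall_notMem fun x hx => absurd (hT.label_lt x hx) (by lia)
    -- Without labels only the empty set is a transversal; its code is `1`, since `0` means that
    -- there is none.
    rcases eq_or_ne t 0 with rfl | hne
    · refine ⟨fun _ => ⟨∅, ⟨by simp, by simp, by simp, by simp⟩, by simp, ?_⟩, fun _ _ _ _ => ?_⟩
      · simp [e7, codeOf]
      · simp [e7]
    · have h0 : s₁.nat 7 t = 0 := by
        rw [e7, Function.update_of_ne hne, h7 t ht]
      refine ⟨fun h => absurd h0 h, fun T hT _ hs => ?_⟩
      rw [hempty T hT] at hs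
      exact absurd hs.symm hne
  · intro j hj s' hfix _ hs'
    have f1 : s'.nat 1 = s₁.nat 1 := hfix 1 (of_decide_eq_true rfl)
    have f3 : s'.nat 3 = s₁.nat 3 := hfix 3 (of_decide_eq_true rfl)
    have f4 : s'.nat 4 = s₁.nat 4 := hfix 4 (of_decide_eq_true rfl)
    have f5 : s'.nat 5 = s₁.nat 5 := hfix 5 (of_decide_eq_true rfl)
    have f6 : s'.nat 6 = s₁.nat 6 := hfix 6 (of_decide_eq_true rfl)
    -- States are updated from the largest downwards. After `k` rounds the top `k` states include
    -- label `j`, while the smaller ones, from which later updates read, do not; so a component is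
    -- used at most once.
    have key := Code.run_for (I := I) (a := 21) (b := .pow) (N := s₁.nat 1 0)
      (p := .setNat 16 (.lit 0) (.sub (var 1) (.add (var 21) (.lit 1))) ;; stateCode)
      (s := s'.setNat 20 0 j)
      (fun k s'' => ∀ t < s₁.nat 1 0, StateSpec n (s₁.nat 5) (s₁.nat 6)
        (s₁.nat 3) (if t + k < s₁.nat 1 0 then j else j + 1) (fun _ => True) t (s''.nat 7 t))
      (by simp [f1]) ?_ ?_ ?_
    · intro t ht
      simpa using key t ht
    · intro t ht
      simpa [ht] using hs' t ht
    · intro k hk s'' hfix' _ hs''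
      have g1 : s''.nat 1 = s₁.nat 1 := by
        rw [hfix' 1 (of_decide_eq_true rfl)]
        simpa using f1
      have g3 : s''.nat 3 = s₁.nat 3 := by
        rw [hfix' 3 (of_decide_eq_true rfl)]
        simpa using f3
      have g4 : s''.nat 4 = s₁.nat 4 := by
        rw [hfix' 4 (of_decide_eq_true rfl)]
        simpa using f4
      have g5 : s''.nat 5 = s₁.nat 5 := by
        rw [hfix' 5 (of_decide_eq_true rfl)]
        simpa using f5
      have g6 : s''.nat 6 = s₁.nat 6 := by
        rw [hfix' 6 (of_decide_eq_true rfl)]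
        simpa using f6
      have g20 : s''.nat 20 0 = j := by
        rw [hfix' 20 (of_decide_eq_true rfl)]
        simp
      rw [Code.run_seq]
      set s₂ := (Code.setNat 16 (.lit 0) (.sub (var 1) (.add (var 21) (.lit 1)))).run I
        (s''.setNat 21 0 k) with hs₂
      have i3 : s₂.nat 3 = s₁.nat 3 := by simpa [hs₂] using g3
      have i4 : s₂.nat 4 = s₁.nat 4 := by simpa [hs₂] using g4
      have i5 : s₂.nat 5 = s₁.nat 5 := by simpa [hs₂] using g5
      have i6 : s₂.nat 6 = s₁.nat 6 := by simpa [hs₂] using g6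
      have i7 : s₂.nat 7 = s''.nat 7 := by simp [hs₂]
      have i16 : s₂.nat 16 0 = s₁.nat 1 0 - (k + 1) := by simp [hs₂, g1]
      have i20 : s₂.nat 20 0 = j := by simpa [hs₂] using g20
      obtain ⟨v, hv, hspec⟩ := run_stateCode (I := I) (s := s₂) (by rwa [i3, i5])
        (by rwa [i4]) (by
          intro t ht
          rw [i16] at ht
          have := hs'' t (by lia)
          rw [if_pos (by lia)] at this
          rwa [i3, i5, i6, i7, i20])
      rw [i3, i5, i6, i20, i16] at hspec
      rw [hv, i7, i16]
      intro t ht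
      rcases eq_or_ne t (s₁.nat 1 0 - (k + 1)) with rfl | hne
      · rw [if_neg (by lia), Function.update_self]
        exact hspec
      · have := hs'' t ht
        rw [Function.update_of_ne hne]
        have e : t + (k + 1) < s₁.nat 1 0 ↔ t + k < s₁.nat 1 0 := by lia
        simpa only [e] using this
    · intro s'' h
      simpa using h
  · intro s' h
    simpa using h

end

/-! ### The evaluation of transversals -/

/-- Array `0` receives the characteristic function of the set with the code in register `11`. -/
def decodeCode : Code :=
  .setNat 11 (.lit 0) (.sub (var 11) (.lit 1)) ;;
  .for_ 23 .size (.setNat 17 (.lit 0) (.sub .size (.add (var 23) (.lit 1))) ;;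
    .ite (.natLe (.get 4 (var 17)) (var 11))
      (.setNat 0 (var 17) (.lit 1) ;; .setNat 11 (.lit 0) (.sub (var 11) (.get 4 (var 17))))
      (.setNat 0 (var 17) (.lit 0)))

/-- Register `13` receives the number of points of the class in register `23` in the set in
array `0`. -/
def countCode : Code :=
  .setNat 13 (.lit 0) (.lit 0) ;;
  .for_ 24 .size (.guard [.natLe (.lit 1) (.get 0 (var 24))]
    (.setNat 13 (.lit 0) (.add (var 13) (.member (var 24) (var 23)))))

/-- Register `12` is `1` if the set in array `0` is feasible, and `0` otherwise. -/
def feasibleCode (m : ℕ) : Code :=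
  .setNat 12 (.lit 0) (.lit 1) ;;
  .for_ 23 (.lit m) (countCode ;;
    .guard [.not (.natLe (.quota (var 23)) (var 13))] (.setNat 12 (.lit 0) (.lit 0)))

/-- Store the current set and the current guess. -/
def storeCode : Code :=
  .setNat 14 (.lit 0) (.lit 1) ;; .setNat 15 (.lit 0) (.get 7 (var 20)) ;;
    .setReal 1 (.lit 0) (.get 0 (.lit 0))

/-- Store the current set if it is feasible and the stored guess is not larger. -/
def recordCode : Code :=
  .guard [.natLe (.lit 1) (var 12)] (.ite (.natLe (var 14) (.lit 0)) storeCode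
    (.guard [.realLe (.get 1 (.lit 0)) (.get 0 (.lit 0))] storeCode))

/-- Go through the transversals that were found. -/
def checkCode (m : ℕ) : Code :=
  .for_ 20 .pow (.guard [.natLe (.lit 1) (.get 7 (var 20))]
    (.setNat 11 (.lit 0) (.get 7 (var 20)) ;; decodeCode ;; feasibleCode m ;; recordCode))

section
variable {m n : ℕ} (I : Instance m n)

/-- Feasibility of sets of numbers. -/
def FeasibleN (T : Finset ℕ) : Prop := ∀ i < m, quotaN I i ≤ ∑ x ∈ T, memN I x i

variable {I}

/-- Binary digits are extracted from the top: the powers below position `y` sum to less than `2 ^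
y`, so comparing the remainder with `2 ^ y` decides whether `y` is in the set. -/
theorem run_decodeCode {s : Memory} {T : Finset ℕ} (h4 : ∀ x ≤ n, s.nat 4 x = 2 ^ x)
    (hT : ∀ x ∈ T, x < n) (h11 : s.nat 11 0 = codeOf T) :
    ∀ x < n, (decodeCode.run I s).nat 0 x = if x ∈ T then 1 else 0 := by
  rw [decodeCode, Code.run_seq]
  set s₁ := (Code.setNat 11 (.lit 0) (.sub (var 11) (.lit 1))).run I s with hs₁
  have e4 : s₁.nat 4 = s.nat 4 := by simp [hs₁]
  have e11 : s₁.nat 11 0 = ∑ x ∈ T, 2 ^ x := by simp [hs₁, h11, codeOf]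
  have key := Code.run_for (I := I) (a := 23) (b := .size) (N := n)
    (p := .setNat 17 (.lit 0) (.sub .size (.add (var 23) (.lit 1))) ;;
    .ite (.natLe (.get 4 (var 17)) (var 11))
      (.setNat 0 (var 17) (.lit 1) ;; .setNat 11 (.lit 0) (.sub (var 11) (.get 4 (var 17))))
      (.setNat 0 (var 17) (.lit 0))) (s := s₁)
    (fun k s' => s'.nat 11 0 = ∑ x ∈ T.filter (fun x => x < n - k), 2 ^ x ∧
      ∀ x < n, n - k ≤ x → s'.nat 0 x = if x ∈ T then 1 else 0) rfl ?_ ?_ ?_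
  · intro x hx
    exact key.2 x hx (by lia)
  · refine ⟨?_, fun x hx h => by lia⟩
    rw [e11, Finset.filter_true_of_mem]
    simpa using hT
  · rintro k hk s' hfix - ⟨h1, h2⟩
    have f4 : s'.nat 4 = s.nat 4 := by rw [hfix 4 (of_decide_eq_true rfl), e4]
    obtain ⟨y, hy⟩ : ∃ y, y = n - (k + 1) := ⟨_, rfl⟩
    have hyn : y < n := by lia
    have hlt : ∑ x ∈ T.filter (fun x => x < y), 2 ^ x < 2 ^ y :=
      Nat.geomSum_lt le_rfl fun x hx => (Finset.mem_filter.1 hx).2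
    have hsplit : ∑ x ∈ T.filter (fun x => x < n - k), 2 ^ x =
        (if y ∈ T then 2 ^ y else 0) + ∑ x ∈ T.filter (fun x => x < y), 2 ^ x := by
      split_ifs with hyT
      · rw [← Finset.sum_insert (f := fun x => 2 ^ x) (by simp)]
        congr 1
        ext x
        simp only [Finset.mem_filter, Finset.mem_insert]
        constructor
        · rintro ⟨hx, hx'⟩
          rcases eq_or_ne x y with h | h
          · exact Or.inl h
          · exact Or.inr ⟨hx, by lia⟩
        · rintro (rfl | ⟨hx, hx'⟩)
          · exact ⟨hyT, by lia⟩
          · exact ⟨hx, by lia⟩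
      · rw [zero_add]
        congr 1
        refine Finset.filter_congr fun x hx => ?_
        have : x ≠ y := fun h => hyT (h ▸ hx)
        lia
    rw [← hy]
    rw [Code.run_seq, Code.run_ite]
    have hpow : s.nat 4 y = 2 ^ y := h4 y hyn.le
    by_cases hyT : y ∈ T
    · rw [if_pos hyT] at hsplit
      have hle : 2 ^ y ≤ s'.nat 11 0 := by lia
      rw [if_pos (by simpa [f4, ← hy, hpow] using hle)]
      refine ⟨?_, fun x hx hyx => ?_⟩
      · simp [f4, ← hy, hpow]
        lia
      · rcases eq_or_ne x y with rfl | hne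
        · simp [← hy, hyT]
        · simpa [← hy, hne] using h2 x hx (by lia)
    · rw [if_neg hyT] at hsplit
      have hle : ¬ 2 ^ y ≤ s'.nat 11 0 := by lia
      rw [if_neg (by simpa [f4, ← hy, hpow] using hle)]
      refine ⟨?_, fun x hx hyx => ?_⟩
      · simp
        lia
      · rcases eq_or_ne x y with rfl | hne
        · simp [← hy, hyT]
        · simpa [← hy, hne] using h2 x hx (by lia)
  · intro s' h
    simpa using h

theorem run_countCode {s : Memory} {T : Finset ℕ} (hT : ∀ x ∈ T, x < n)
    (h0 : ∀ x < n, s.nat 0 x = if x ∈ T then 1 else 0) :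
    (countCode.run I s).nat 13 0 = ∑ x ∈ T, memN I x (s.nat 23 0) := by
  rw [countCode, Code.run_seq]
  have key := Code.run_for (I := I) (a := 24) (b := .size) (N := n)
    (p := .guard [.natLe (.lit 1) (.get 0 (var 24))]
      (.setNat 13 (.lit 0) (.add (var 13) (.member (var 24) (var 23)))))
    (s := (Code.setNat 13 (.lit 0) (.lit 0)).run I s)
    (fun k s' => s'.nat 13 0 = ∑ x ∈ Finset.range k, if x ∈ T then memN I x (s.nat 23 0) else 0)
    rfl (by simp) ?_ ?_
  · rw [key, ← Finset.sum_filter]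
    congr 1
    ext x
    simp only [Finset.mem_filter, Finset.mem_range]
    exact ⟨fun h => h.2, fun h => ⟨hT x h, h⟩⟩
  · intro k hk s' hfix _ hs'
    have f0 : s'.nat 0 = s.nat 0 := by
      rw [hfix 0 (of_decide_eq_true rfl)]
      simp
    have f23 : s'.nat 23 = s.nat 23 := by
      rw [hfix 23 (of_decide_eq_true rfl)]
      simp
    rw [Code.run_guard, Finset.sum_range_succ, ← hs']
    by_cases hk' : k ∈ T
    · rw [if_pos (by simp [f0, h0 k hk, hk'])]
      simp [f23, hk']
    · rw [if_neg (by simp [f0, h0 k hk, hk'])]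
      simp [hk']
  · intro s' h
    simpa using h

theorem run_feasibleCode {s : Memory} {T : Finset ℕ} (hT : ∀ x ∈ T, x < n)
    (h0 : ∀ x < n, s.nat 0 x = if x ∈ T then 1 else 0) :
    ((feasibleCode m).run I s).nat 12 0 ≠ 0 ↔ FeasibleN I T := by
  rw [feasibleCode, Code.run_seq]
  refine Code.run_for (fun k s' => s'.nat 12 0 ≠ 0 ↔
    ∀ i < k, quotaN I i ≤ ∑ x ∈ T, memN I x i) rfl (by simp) ?_ ?_
  · intro i hi s' hfix _ hs'
    have f0 : s'.nat 0 = s.nat 0 := by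
      rw [hfix 0 (of_decide_eq_true rfl)]
      simp
    rw [Code.run_seq]
    have hcount := run_countCode (I := I) (s := s'.setNat 23 0 i) hT (by simpa [f0] using h0)
    have c12 : (countCode.run I (s'.setNat 23 0 i)).nat 12 = s'.nat 12 := by
      rw [Code.run_nat_of_not_mem (of_decide_eq_true rfl)]
      simp
    have c23 : (countCode.run I (s'.setNat 23 0 i)).nat 23 0 = i := by
      rw [Code.run_nat_of_not_mem (of_decide_eq_true rfl)]
      simp
    simp only [Memory.setNat_nat_self, Function.update_self] at hcount
    rw [Code.run_guard]
    by_cases hq : quotaN I i ≤ ∑ x ∈ T, memN I x i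
    · rw [if_neg (by simpa [c23, hcount] using hq), c12, hs', Nat.forall_lt_succ_right]
      exact ⟨fun h => ⟨h, hq⟩, fun h => h.1⟩
    · rw [if_pos (by simpa [c23, hcount] using hq), Nat.forall_lt_succ_right]
      simp [hq]
  · intro s' h
    simpa using h

/-- If a set is stored then it satisfies `P`. -/
def BestSpec (P : ℝ → Finset ℕ → Prop) (s : Memory) : Prop :=
  s.nat 14 0 ≠ 0 → ∃ T, P (s.real 1 0) T ∧ s.nat 15 0 = codeOf T

/-- A set is stored with a guess of at least `γ`. -/
def Success (γ : ℝ) (s : Memory) : Prop := s.nat 14 0 ≠ 0 ∧ γ ≤ s.real 1 0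

theorem run_storeCode (s : Memory) :
    (storeCode.run I s).nat 14 0 = 1 ∧ (storeCode.run I s).nat 15 0 = s.nat 7 (s.nat 20 0) ∧
      (storeCode.run I s).real 1 0 = s.real 0 0 := by
  simp [storeCode]

/-- Either the candidate is stored and the stored guess does not decrease, or nothing changes; a
feasible candidate is passed over only if the stored guess is larger. -/
theorem run_recordCode (s : Memory) :
    (s.nat 12 0 ≠ 0 ∧ (s.nat 14 0 ≠ 0 → s.real 1 0 ≤ s.real 0 0) ∧
      (recordCode.run I s).nat 14 0 = 1 ∧ (recordCode.run I s).nat 15 0 = s.nat 7 (s.nat 20 0) ∧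
      (recordCode.run I s).real 1 0 = s.real 0 0) ∨
    ((s.nat 12 0 ≠ 0 → Success (s.real 0 0) s) ∧ recordCode.run I s = s) := by
  rw [recordCode, Code.run_guard]
  by_cases h12 : s.nat 12 0 = 0
  · rw [if_neg (by simp [h12])]
    exact Or.inr ⟨fun h => absurd h12 h, rfl⟩
  · rw [if_pos (by simpa [Nat.one_le_iff_ne_zero] using h12), Code.run_ite]
    by_cases h14 : s.nat 14 0 = 0
    · rw [if_pos (by simp [h14])]
      exact Or.inl ⟨h12, fun h => absurd h14 h, run_storeCode s⟩
    · rw [if_neg (by simpa using h14), Code.run_guard]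
      by_cases hle : s.real 1 0 ≤ s.real 0 0
      · rw [if_pos (by simpa using hle)]
        exact Or.inl ⟨h12, fun _ => hle, run_storeCode s⟩
      · rw [if_neg (by simpa using hle)]
        exact Or.inr ⟨fun _ => ⟨h14, (not_le.1 hle).le⟩, rfl⟩

/-- The table keeps one transversal per weight, not necessarily the one whose existence is known.
Success is therefore claimed for a weight all of whose transversals are feasible. -/
theorem run_checkCode {s : Memory} {z c w : ℕ → ℕ} {P : ℝ → Finset ℕ → Prop}
    (h4 : ∀ x ≤ n, s.nat 4 x = 2 ^ x)
    (h7 : ∀ t < s.nat 1 0, StateSpec n z c w n (fun _ => True) t (s.nat 7 t))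
    (hP : ∀ T, PartialTransversal n z c n T → FeasibleN I T → P (s.real 0 0) T)
    (hbest : BestSpec P s) :
    BestSpec P ((checkCode m).run I s) ∧
      (∀ γ, Success γ s → Success γ ((checkCode m).run I s)) ∧
      ((∃ t < s.nat 1 0, s.nat 7 t ≠ 0 ∧ ∀ T, PartialTransversal n z c n T →
        ∑ x ∈ T, w x = t → FeasibleN I T) → Success (s.real 0 0) ((checkCode m).run I s)) := by
  rw [checkCode]
  refine Code.run_for (fun k s' => BestSpec P s' ∧ (∀ γ, Success γ s → Success γ s') ∧
    ((∃ t < k, s.nat 7 t ≠ 0 ∧ ∀ T, PartialTransversal n z c n T →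
        ∑ x ∈ T, w x = t → FeasibleN I T) → Success (s.real 0 0) s')) rfl
    ⟨hbest, fun _ h => h, by simp⟩ ?_ ?_
  · rintro t ht s' hfix hreal ⟨hA, hB, hC⟩
    have f4 : s'.nat 4 = s.nat 4 := hfix 4 (of_decide_eq_true rfl)
    have f7 : s'.nat 7 = s.nat 7 := hfix 7 (of_decide_eq_true rfl)
    have fr : s'.real 0 = s.real 0 := hreal 0 (of_decide_eq_true rfl)
    rw [Code.run_guard]
    by_cases hne : s.nat 7 t = 0
    · rw [if_neg (by simp [f7, hne])]
      refine ⟨by simpa [BestSpec] using hA, by simpa [Success] using hB, ?_⟩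
      rintro ⟨t', ht', h1, h2⟩
      rcases eq_or_ne t' t with rfl | htt
      · exact absurd hne h1
      · simpa [Success] using hC ⟨t', by lia, h1, h2⟩
    · rw [if_pos (by simpa [f7, Nat.one_le_iff_ne_zero] using hne)]
      obtain ⟨T, hT, hw, hcode⟩ := (h7 t ht).1 hne
      rw [Code.run_seq, Code.run_seq, Code.run_seq]
      set s₁ := (Code.setNat 11 (.lit 0) (.get 7 (var 20))).run I (s'.setNat 20 0 t) with hs₁
      have hdec := run_decodeCode (I := I) (s := s₁) (T := T) (by simpa [hs₁, f4] using h4) hT.lt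
        (by simpa [hs₁, f7] using hcode)
      set s₂ := decodeCode.run I s₁ with hs₂
      have hfeas := run_feasibleCode (I := I) hT.lt hdec
      set s₃ := (feasibleCode m).run I s₂ with hs₃
      have fix : ∀ a ∉ decodeCode.writes ++ (feasibleCode m).writes, s₃.nat a = s₁.nat a := by
        intro a ha
        rw [List.mem_append, not_or] at ha
        rw [hs₃, Code.run_nat_of_not_mem ha.2, hs₂, Code.run_nat_of_not_mem ha.1]
      have fixr : ∀ a, s₃.real a = s'.real a := by
        intro a
        rw [hs₃, Code.run_real_of_not_mem (show a ∉ [] by simp), hs₂,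
          Code.run_real_of_not_mem (show a ∉ [] by simp)]
        simp [hs₁]
      have g7 : s₃.nat 7 = s.nat 7 := by
        rw [fix 7 (of_decide_eq_true rfl)]
        simp [hs₁, f7]
      have g14 : s₃.nat 14 = s'.nat 14 := by
        rw [fix 14 (of_decide_eq_true rfl)]
        simp [hs₁]
      have g15 : s₃.nat 15 = s'.nat 15 := by
        rw [fix 15 (of_decide_eq_true rfl)]
        simp [hs₁]
      have g20 : s₃.nat 20 0 = t := by
        rw [fix 20 (of_decide_eq_true rfl)]
        simp [hs₁]
      have hsucc : ∀ γ, Success γ s₃ ↔ Success γ s' := by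
        intro γ
        simp [Success, g14, fixr]
      rcases run_recordCode (I := I) s₃ with ⟨h12, hle, r14, r15, r1⟩ | ⟨h12, hrun⟩
      · have hγ : Success (s.real 0 0) (recordCode.run I s₃) := by
          refine ⟨by simp [r14], ?_⟩
          rw [r1, fixr, fr]
        refine ⟨fun _ => ⟨T, ?_, ?_⟩, fun γ hγ' => ?_, fun _ => hγ⟩
        · rw [r1, fixr, fr]
          exact hP T hT (hfeas.1 h12)
        · rw [r15, g7, g20, hcode]
        · have h := (hsucc γ).2 (hB γ hγ')
          refine ⟨by simp [r14], ?_⟩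
          rw [r1]
          exact h.2.trans (hle h.1)
      · rw [hrun]
        refine ⟨?_, fun γ hγ => (hsucc γ).2 (hB γ hγ), ?_⟩
        · intro h
          rw [g14] at h
          rw [fixr, g15]
          exact hA h
        · rintro ⟨t', ht', h1, h2⟩
          rcases eq_or_ne t' t with rfl | htt
          · have := h12 (hfeas.2 (h2 T hT hw))
            rwa [fixr, fr] at this
          · exact (hsucc _).2 (hC ⟨t', by lia, h1, h2⟩)
  · intro s' h
    simpa [BestSpec, Success] using h

end

/-! ### From numbers to points -/

section
variable {m n : ℕ} {I : Instance m n} {γ : ℝ}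

theorem memN_eq (x : Fin n) (i : Fin m) : memN I x i = if x ∈ I.U i then 1 else 0 := by
  simp [memN]

theorem distN_eq (x y : Fin n) : distN I x y = I.d x y := by
  simp [distN]

theorem colourLe_iff (x y : Fin n) : ColourLe I x y ↔ colourOf I x ⊆ colourOf I y := by
  constructor
  · intro h i hi
    have := h i i.2
    rw [mem_colourOf] at hi ⊢
    rw [memN_eq, memN_eq, if_pos hi] at this
    by_contra hy
    rw [if_neg hy] at this
    lia
  · intro h i hi
    have := @h ⟨i, hi⟩
    rw [mem_colourOf, mem_colourOf] at this
    rw [memN_eq x ⟨i, hi⟩, memN_eq y ⟨i, hi⟩]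
    split_ifs with h1 h2
    · exact le_rfl
    · exact absurd (this h1) h2
    · exact Nat.zero_le _
    · exact le_rfl

theorem cardN_eq (x : Fin n) : cardN I x = (colourOf I x).card := by
  rw [cardN, ← Fin.sum_univ_eq_sum_range (fun i => memN I x i) m, colourOf, Finset.card_filter]
  exact Finset.sum_congr rfl fun i _ => memN_eq x i

theorem denom_cast_pos (m : ℕ) : (0 : ℝ) < denom m := by
  rw [denom_cast]
  exact denominator_pos m

theorem tooClose_iff (x y : Fin n) : TooClose I γ x y ↔ I.d x y < d1 m γ := by
  rw [TooClose, distN_eq, d1, ← denom_cast, lt_div_iff₀ (denom_cast_pos m), mul_comm]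

theorem closeN_iff {z : ℕ → ℕ} (x y : Fin n) :
    CloseN I γ z x y ↔ z x ≠ 0 ∧ z y ≠ 0 ∧ I.d x y < d2 m γ := by
  rw [CloseN, distN_eq, d2, ← denom_cast, lt_div_iff₀ (denom_cast_pos m), mul_comm]
  simp

/-- The selection with characteristic function `z`. -/
def selectionOf (I : Instance m n) (z : ℕ → ℕ) (L : Colour m) : Finset (Fin n) :=
  (Finset.univ.filter fun x : Fin n => z x ≠ 0).filter fun x => colourOf I x = L.1

variable {z c : ℕ → ℕ}

theorem SelectionSpec.isSelection (h : SelectionSpec I γ (fun x => 0 < cardN I x) z) :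
    IsSelection I γ (selectionOf I z) := by
  refine isSelection_of_separated_of_cover ?_ ?_
  · intro x hx y hy hxy hsub
    have := h.separated x x.2 y y.2 (Finset.mem_filter.1 hx).2 (Finset.mem_filter.1 hy).2
      (fun e => hxy (Fin.ext e)) ((colourLe_iff x y).2 hsub)
    rwa [tooClose_iff, not_lt] at this
  · intro x hx hxA
    obtain ⟨y, hy, h1, h2, h3⟩ := h.cover x x.2 (by rwa [cardN_eq, Finset.card_pos])
      (by simpa using hxA)
    exact ⟨⟨y, hy⟩, by simpa using h1, (colourLe_iff x ⟨y, hy⟩).1 h2,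
      (tooClose_iff x ⟨y, hy⟩).1 h3⟩

theorem SelectionSpec.exists_mem_iff (h : SelectionSpec I γ (fun x => 0 < cardN I x) z)
    (x : Fin n) : (∃ L, x ∈ selectionOf I z L) ↔ z x ≠ 0 := by
  constructor
  · rintro ⟨L, hx⟩
    exact (Finset.mem_filter.1 (Finset.mem_filter.1 hx).1).2
  · intro hx
    have := h.done x x.2 hx
    rw [cardN_eq, Finset.card_pos] at this
    exact ⟨⟨_, this⟩, by simp [selectionOf, hx]⟩

theorem LabelSpec.reachable_iff (h : SelectionSpec I γ (fun x => 0 < cardN I x) z)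
    (hc : LabelSpec I γ z (fun _ _ => True) c) (x y : Selected (selectionOf I z)) :
    (closeGraph I γ (selectionOf I z)).Reachable x y ↔ c x.1 = c y.1 := by
  constructor
  · rintro ⟨p⟩
    induction p with
    | nil => rfl
    | @cons u v _ hadj _ ih =>
      refine Eq.trans (hc.complete _ _ trivial ?_) ih
      exact (closeN_iff _ _).2 ⟨(h.exists_mem_iff _).1 u.2, (h.exists_mem_iff _).1 v.2, hadj.2⟩
  · intro hxy
    -- The generated equivalence is also reflexive at numbers that are no selected points, hence the
    -- alternative `u = v`.
    have key : ∀ u v : ℕ, Relation.EqvGen (CloseN I γ z) u v → u = v ∨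
        ∃ x y : Selected (selectionOf I z), (x.1 : ℕ) = u ∧ (y.1 : ℕ) = v ∧
          (closeGraph I γ (selectionOf I z)).Reachable x y := by
      intro u v huv
      induction huv with
      | rel u v huv =>
        right
        have h' := (closeN_iff ⟨u, huv.1⟩ ⟨v, huv.2.1⟩).1 huv
        let x : Selected (selectionOf I z) := ⟨⟨u, huv.1⟩, (h.exists_mem_iff _).2 h'.1⟩
        let y : Selected (selectionOf I z) := ⟨⟨v, huv.2.1⟩, (h.exists_mem_iff _).2 h'.2.1⟩
        refine ⟨x, y, rfl, rfl, ?_⟩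
        rcases eq_or_ne x y with e | e
        · rw [e]
        · exact SimpleGraph.Adj.reachable ⟨e, h'.2.2⟩
      | refl u => exact Or.inl rfl
      | symm u v _ ih =>
        rcases ih with rfl | ⟨x, y, h1, h2, h3⟩
        · exact Or.inl rfl
        · exact Or.inr ⟨y, x, h2, h1, h3.symm⟩
      | trans u v w _ _ ih1 ih2 =>
        rcases ih1 with rfl | ⟨x, y, h1, h2, h3⟩
        · exact ih2
        · rcases ih2 with rfl | ⟨x', y', h1', h2', h3'⟩
          · exact Or.inr ⟨x, y, h1, h2, h3⟩
          · obtain rfl : y = x' := Subtype.ext (Fin.ext (h2.trans h1'.symm))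
            exact Or.inr ⟨x, y', h1, h2', h3.trans h3'⟩
    rcases key _ _ (hc.sound x.1 x.1.2 y.1 y.1.2 hxy) with e | ⟨x', y', h1, h2, h3⟩
    · rw [Subtype.ext (Fin.ext e)]
    · rwa [Subtype.ext (Fin.ext h1), Subtype.ext (Fin.ext h2)] at h3

/-- The points whose numbers are in `T`. -/
def pointsOf (n : ℕ) (T : Finset ℕ) : Finset (Fin n) := Finset.univ.filter fun x => x.1 ∈ T

theorem mem_pointsOf {T : Finset ℕ} {x : Fin n} : x ∈ pointsOf n T ↔ x.1 ∈ T := by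
  simp [pointsOf]

theorem sum_memN {T : Finset ℕ} (hT : ∀ x ∈ T, x < n) (i : Fin m) :
    ∑ x ∈ T, memN I x i = (pointsOf n T ∩ I.U i).card := by
  rw [Finset.card_eq_sum_ones, ← Finset.sum_filter_add_sum_filter_not T fun x => memN I x i = 0,
    Finset.sum_eq_zero (s := T.filter fun x => memN I x i = 0)
      fun x hx => (Finset.mem_filter.1 hx).2, zero_add]
  symm
  refine Finset.sum_bij (fun x _ => x.1) ?_ (fun x _ y _ h => Fin.ext h) ?_ ?_
  · intro x hx
    rw [Finset.mem_inter, mem_pointsOf] at hx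
    simp [hx.1, memN_eq, hx.2]
  · intro x hx
    rw [Finset.mem_filter] at hx
    have hxn := hT x hx.1
    have h2 := hx.2
    rw [memN_eq ⟨x, hxn⟩ i] at h2
    exact ⟨⟨x, hxn⟩, by simpa [mem_pointsOf, hx.1] using h2, rfl⟩
  · intro x hx
    rw [memN_eq, if_pos (Finset.mem_inter.1 hx).2]

theorem feasibleN_iff {T : Finset ℕ} (hT : ∀ x ∈ T, x < n) :
    FeasibleN I T ↔ Feasible I (pointsOf n T) := by
  constructor
  · intro h i
    have := h i i.2
    rw [sum_memN hT] at this
    simpa [quotaN] using this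
  · intro h i hi
    rw [sum_memN hT ⟨i, hi⟩]
    simpa [quotaN, hi] using h ⟨i, hi⟩

theorem PartialTransversal.isTransversal (h : SelectionSpec I γ (fun x => 0 < cardN I x) z)
    (hc : LabelSpec I γ z (fun _ _ => True) c) {T : Finset ℕ}
    (hT : PartialTransversal n z c n T) :
    IsTransversal I γ (selectionOf I z) (pointsOf n T) := by
  constructor
  · intro x hx
    exact (h.exists_mem_iff x).2 (hT.selected x (mem_pointsOf.1 hx))
  · intro x y hx hy hxy
    exact Subtype.ext (Fin.ext (hT.inj _ (mem_pointsOf.1 hx) _ (mem_pointsOf.1 hy)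
      ((hc.reachable_iff h x y).1 hxy)))

theorem IsTransversal.partialTransversal (h : SelectionSpec I γ (fun x => 0 < cardN I x) z)
    (hc : LabelSpec I γ z (fun _ _ => True) c) {S : Finset (Fin n)}
    (hS : IsTransversal I γ (selectionOf I z) S) :
    PartialTransversal n z c n (S.map Fin.valEmbedding) := by
  have aux : ∀ x ∈ S.map Fin.valEmbedding, ∃ y ∈ S, (y : ℕ) = x := fun x hx => by
    simpa using hx
  constructor
  · intro x hx
    obtain ⟨y, -, rfl⟩ := aux x hx
    exact y.2
  · intro x hx
    obtain ⟨y, hy, rfl⟩ := aux x hx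
    exact (h.exists_mem_iff y).1 (hS.selected y hy)
  · intro x hx
    obtain ⟨y, -, rfl⟩ := aux x hx
    exact hc.lt y y.2
  · intro a ha b hb hab
    obtain ⟨x, hx, rfl⟩ := aux a ha
    obtain ⟨y, hy, rfl⟩ := aux b hb
    have := hS.eq_of_reachable ⟨x, hS.selected x hx⟩ ⟨y, hS.selected y hy⟩ hx hy
      ((hc.reachable_iff h _ _).2 hab)
    rw [Subtype.mk.injEq] at this
    rw [this]

theorem pointsOf_map (S : Finset (Fin n)) : pointsOf n (S.map Fin.valEmbedding) = S := by
  ext x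
  simp only [mem_pointsOf, Finset.mem_map, Fin.valEmbedding_apply]
  exact ⟨fun ⟨a, ha, e⟩ => Fin.ext e ▸ ha, fun h => ⟨x, h, rfl⟩⟩

/-! ### Weights -/

theorem sum_mul_pow_lt {B : ℕ} {a : ℕ → ℕ} {k : ℕ} (ha : ∀ i < k, a i < B) :
    ∑ i ∈ Finset.range k, a i * B ^ i < B ^ k := by
  induction k with
  | zero => simp
  | succ k ih =>
    rw [Finset.sum_range_succ, pow_succ']
    have h1 := ih fun i hi => ha i (by lia)
    have h2 := Nat.mul_le_mul_right (B ^ k) (Nat.succ_le_of_lt (ha k (by lia)))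
    rw [Nat.succ_mul] at h2
    lia

/-- Uniqueness of expansions in base `B`: the lower part is less than `B ^ k`, so the leading digits
agree, and induction does the rest. -/
theorem eq_of_sum_mul_pow_eq {B : ℕ} {a b : ℕ → ℕ} {k : ℕ} (ha : ∀ i < k, a i < B)
    (hb : ∀ i < k, b i < B)
    (h : ∑ i ∈ Finset.range k, a i * B ^ i = ∑ i ∈ Finset.range k, b i * B ^ i) :
    ∀ i < k, a i = b i := by
  induction k with
  | zero => simp
  | succ k ih =>
    rw [Finset.sum_range_succ, Finset.sum_range_succ] at h
    have h1 := sum_mul_pow_lt fun i hi => ha i (Nat.lt_succ_of_lt hi)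
    have h2 := sum_mul_pow_lt fun i hi => hb i (Nat.lt_succ_of_lt hi)
    have hk : a k = b k := by
      by_contra hne
      rcases Nat.lt_or_gt_of_ne hne with hlt | hlt
      · have := Nat.mul_le_mul_right (B ^ k) (Nat.succ_le_of_lt hlt)
        rw [Nat.succ_mul] at this
        lia
      · have := Nat.mul_le_mul_right (B ^ k) (Nat.succ_le_of_lt hlt)
        rw [Nat.succ_mul] at this
        lia
    rw [hk] at h
    intro i hi
    rcases Nat.lt_succ_iff_lt_or_eq.1 hi with hi | rfl
    · exact ih (fun i hi => ha i (Nat.lt_succ_of_lt hi)) (fun i hi => hb i (Nat.lt_succ_of_lt hi))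
        (Nat.add_right_cancel h) i hi
    · exact hk

/-- The weight of a point codes its classes. -/
def weightN (I : Instance m n) (x : ℕ) : ℕ := ∑ i ∈ Finset.range m, memN I x i * (n + 1) ^ i

theorem sum_weightN (T : Finset ℕ) :
    ∑ x ∈ T, weightN I x = ∑ i ∈ Finset.range m, (∑ x ∈ T, memN I x i) * (n + 1) ^ i := by
  simp only [weightN, Finset.sum_mul]
  exact Finset.sum_comm

/-- The class counts are digits in base `n + 1`, so adding weights never produces a carry. -/
theorem sum_memN_lt {T : Finset ℕ} (hT : ∀ x ∈ T, x < n) (i : ℕ) :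
    ∑ x ∈ T, memN I x i < n + 1 := by
  have h1 := Finset.sum_le_card_nsmul T _ 1 fun x _ => memN_le_one I x i
  have h2 := Finset.card_le_card (show T ⊆ Finset.range n from fun x hx =>
    Finset.mem_range.2 (hT x hx))
  rw [Finset.card_range] at h2
  simp only [smul_eq_mul, mul_one] at h1
  lia

theorem sum_weightN_lt {T : Finset ℕ} (hT : ∀ x ∈ T, x < n) :
    ∑ x ∈ T, weightN I x < (n + 1) ^ m := by
  rw [sum_weightN]
  exact sum_mul_pow_lt fun i _ => sum_memN_lt hT i

/-- The weight of a set determines its number of points in every class, and feasibility depends on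
nothing else. -/
theorem feasibleN_of_sum_weightN_eq {T T' : Finset ℕ} (hT : ∀ x ∈ T, x < n)
    (hT' : ∀ x ∈ T', x < n) (h : ∑ x ∈ T', weightN I x = ∑ x ∈ T, weightN I x)
    (hfeas : FeasibleN I T) : FeasibleN I T' := by
  rw [sum_weightN, sum_weightN] at h
  intro i hi
  rw [eq_of_sum_mul_pow_eq (fun i _ => sum_memN_lt hT' i) (fun i _ => sum_memN_lt hT i) h i hi]
  exact hfeas i hi

/-- Selected points are coloured, so this supplies the positivity that the dynamic program requires.
-/
theorem weightN_pos {x : ℕ} (hx : 0 < cardN I x) : 0 < weightN I x := by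
  refine lt_of_lt_of_le hx (Finset.sum_le_sum fun i _ => ?_)
  exact Nat.le_mul_of_pos_right _ (by positivity)

end

/-! ### The program -/

/-- Fair⁺-Flow for the guess in the real register `0`, with all guesses of the counts. -/
def tryCode (m : ℕ) : Code :=
  selectCode m ;; componentsCode m ;; searchCode ;; checkCode m

/-- The program after the register for the bounds has been set. -/
def mainCode (m : ℕ) : Code :=
  weightsCode m ;; twoPowersCode ;; hugeCode m ;; tryCode m ;;
  .for_ 30 .size (.for_ 31 .size
    (.setReal 0 (.lit 0) (.dist (var 30) (var 31)) ;; tryCode m)) ;;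
  .setNat 11 (.lit 0) (var 15) ;; decodeCode

/-- The approximation algorithm. -/
def approxProgram (m : ℕ) : Program :=
  .seq (powersCode m).compile (.seq (.setNat 1 (.lit 0) (.get 2 (.lit m))) (mainCode m).compile)

section
variable {m n : ℕ} (I : Instance m n)

/-- `T` is a result of Fair⁺-Flow with the guess `γ`. -/
def IsResult (γ : ℝ) (T : Finset ℕ) : Prop :=
  (∀ x ∈ T, x < n) ∧ Feasible I (pointsOf n T) ∧
    ∃ Z, IsSelection I γ Z ∧ IsTransversal I γ Z (pointsOf n T)

/-- The tables that are computed in advance. -/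
structure Prepared (s : Memory) : Prop where
  pow : s.nat 1 0 = (n + 1) ^ m
  weight : ∀ x < n, s.nat 3 x = weightN I x
  two_pow : ∀ x ≤ n, s.nat 4 x = 2 ^ x

variable {I}

theorem Prepared.congr {s s' : Memory} (h : Prepared I s) (h1 : s'.nat 1 = s.nat 1)
    (h3 : s'.nat 3 = s.nat 3) (h4 : s'.nat 4 = s.nat 4) : Prepared I s' :=
  ⟨by rw [h1, h.pow], fun x hx => by rw [h3, h.weight x hx],
    fun x hx => by rw [h4, h.two_pow x hx]⟩

theorem Prepared.run {s : Memory} (h : Prepared I s) {p : Code} (h1 : 1 ∉ p.writes)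
    (h3 : 3 ∉ p.writes) (h4 : 4 ∉ p.writes) : Prepared I (p.run I s) :=
  h.congr (Code.run_nat_of_not_mem h1 s) (Code.run_nat_of_not_mem h3 s)
    (Code.run_nat_of_not_mem h4 s)

theorem StateSpec.congr_weight {z c w w' : ℕ → ℕ} {j t v : ℕ} (hw : ∀ x < n, w x = w' x)
    (h : StateSpec n z c w j (fun _ => True) t v) :
    StateSpec n z c w' j (fun _ => True) t v := by
  have aux : ∀ T, PartialTransversal n z c j T → ∑ x ∈ T, w x = ∑ x ∈ T, w' x :=
    fun T hT => Finset.sum_congr rfl fun x hx => hw x (hT.lt x hx)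
  refine ⟨fun hv => ?_, fun T hT hQ hs => h.2 T hT hQ ((aux T hT).trans hs)⟩
  obtain ⟨T, hT, h1, h2⟩ := h.1 hv
  exact ⟨T, hT, (aux T hT).symm.trans h1, h2⟩

theorem run_tryCode {s : Memory} (hs : Prepared I s) (hbest : BestSpec (IsResult I) s) :
    BestSpec (IsResult I) ((tryCode m).run I s) ∧
      (∀ γ, Success γ s → Success γ ((tryCode m).run I s)) ∧
      ((s.real 0 0 : EReal) ≤ opt I → Success (s.real 0 0) ((tryCode m).run I s)) := by
  rw [tryCode, Code.run_seq, Code.run_seq, Code.run_seq]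
  have hsel := run_selectCode (I := I) s
  set s₁ := (selectCode m).run I s with hs₁
  have p₁ : Prepared I s₁ := hs.run (of_decide_eq_true rfl) (of_decide_eq_true rfl)
    (of_decide_eq_true rfl)
  have r₁ : s₁.real = s.real := funext fun a =>
    Code.run_real_of_not_mem (show a ∉ [] by simp) s
  have hlab := run_componentsCode (I := I) s₁
  set s₂ := (componentsCode m).run I s₁ with hs₂
  have p₂ : Prepared I s₂ := p₁.run (of_decide_eq_true rfl) (of_decide_eq_true rfl)
    (of_decide_eq_true rfl)
  have r₂ : s₂.real = s₁.real := funext fun a =>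
    Code.run_real_of_not_mem (show a ∉ [] by simp) s₁
  have e5 : s₂.nat 5 = s₁.nat 5 := Code.run_nat_of_not_mem (of_decide_eq_true rfl) s₁
  rw [← e5] at hsel hlab
  rw [r₁] at hlab
  have hsearch := run_searchCode (I := I) (s := s₂) (fun x hx hz => by
    rw [p₂.weight x hx]
    exact weightN_pos (hsel.done x hx hz)) p₂.two_pow
  set s₃ := searchCode.run I s₂ with hs₃
  have p₃ : Prepared I s₃ := p₂.run (of_decide_eq_true rfl) (of_decide_eq_true rfl)
    (of_decide_eq_true rfl)
  have r₃ : s₃.real = s.real := by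
    rw [← r₁, ← r₂]
    exact funext fun a => Code.run_real_of_not_mem (show a ∉ [] by simp) s₂
  have e14 : s₃.nat 14 = s.nat 14 := by
    rw [hs₃, Code.run_nat_of_not_mem (of_decide_eq_true rfl), hs₂,
      Code.run_nat_of_not_mem (of_decide_eq_true rfl), hs₁,
      Code.run_nat_of_not_mem (of_decide_eq_true rfl)]
  have e15 : s₃.nat 15 = s.nat 15 := by
    rw [hs₃, Code.run_nat_of_not_mem (of_decide_eq_true rfl), hs₂,
      Code.run_nat_of_not_mem (of_decide_eq_true rfl), hs₁,
      Code.run_nat_of_not_mem (of_decide_eq_true rfl)]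
  have hspec : ∀ t < s₃.nat 1 0, StateSpec n (s₂.nat 5) (s₂.nat 6) (weightN I) n
      (fun _ => True) t (s₃.nat 7 t) := by
    intro t ht
    rw [p₃.pow, ← p₂.pow] at ht
    exact (hsearch t ht).congr_weight p₂.weight
  obtain ⟨h1, h2, h3⟩ := run_checkCode (I := I) (P := IsResult I) p₃.two_pow hspec (by
    intro T hT hfeas
    rw [r₃]
    exact ⟨hT.lt, (feasibleN_iff hT.lt).1 hfeas, _, hsel.isSelection,
      hT.isTransversal hsel hlab⟩) (by
    intro h
    rw [e14] at h
    rw [r₃, e15]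
    exact hbest h)
  refine ⟨h1, fun γ hγ => h2 γ ?_, fun hγ => ?_⟩
  · rwa [Success, e14, r₃]
  · rw [r₃] at h3
    apply h3
    -- At the weight of this feasible transversal the table has an entry, and whichever transversal
    -- of that weight is stored there is feasible too.
    obtain ⟨S, hS, hfeas⟩ := hsel.isSelection.exists_transversal hγ
    have hT := hS.partialTransversal hsel hlab
    have hfeasT : FeasibleN I (S.map Fin.valEmbedding) := by
      rw [feasibleN_iff hT.lt, pointsOf_map]
      exact hfeas
    have hlt : ∑ x ∈ S.map Fin.valEmbedding, weightN I x < s₃.nat 1 0 := by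
      rw [p₃.pow]
      exact sum_weightN_lt hT.lt
    exact ⟨_, hlt, (hspec _ hlt).2 _ hT trivial rfl, fun T' hT' hw =>
      feasibleN_of_sum_weightN_eq hT.lt hT'.lt hw hfeasT⟩

/-- What has been achieved after the guesses `γ` that satisfy `G` have been tried. -/
structure Progress (I : Instance m n) (G : ℝ → Prop) (s : Memory) : Prop where
  prepared : Prepared I s
  best : BestSpec (IsResult I) s
  success : ∀ γ : ℝ, G γ → (γ : EReal) ≤ opt I → Success γ s

theorem Progress.step {G : ℝ → Prop} {s : Memory} (h : Progress I G s) :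
    Progress I (fun γ => G γ ∨ γ = s.real 0 0) ((tryCode m).run I s) := by
  obtain ⟨h1, h2, h3⟩ := run_tryCode h.prepared h.best
  refine ⟨h.prepared.run (of_decide_eq_true rfl) (of_decide_eq_true rfl)
    (of_decide_eq_true rfl), h1, ?_⟩
  rintro γ (hγ | rfl) hle
  · exact h2 γ (h.success γ hγ hle)
  · exact h3 hle

theorem Progress.congr {G G' : ℝ → Prop} {s s' : Memory} (h : Progress I G s)
    (hG : ∀ γ, G' γ → G γ) (hs : ∀ a ∈ [1, 3, 4, 14, 15], s'.nat a = s.nat a)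
    (hr : s'.real 1 = s.real 1) : Progress I G' s' := by
  simp only [List.mem_cons, List.not_mem_nil, or_false, forall_eq_or_imp, forall_eq] at hs
  obtain ⟨e1, e3, e4, e14, e15⟩ := hs
  refine ⟨h.prepared.congr e1 e3 e4, ?_, fun γ hγ hle => ?_⟩
  · rw [BestSpec, e14, e15, hr]
    exact h.best
  · rw [Success, e14, hr]
    exact h.success γ (hG γ hγ) hle

end

/-! ### The guesses that are tried, the running time and the approximation ratio. -/

section
variable {m n : ℕ} {I : Instance m n}

/-- An optimal solution with two points attains its diversity at some pair; with fewer points its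
diversity is infinite. Hence the distances and one huge number suffice as guesses. -/
theorem opt_eq_top_or_eq_dist (I : Instance m n) : opt I = ⊤ ∨ ∃ x y, opt I = (I.d x y : EReal) := by
  classical
  obtain ⟨O, -, hO⟩ := exists_isOptimal I
  rw [← hO]
  rcases O.offDiag.eq_empty_or_nonempty with h | h
  · left
    refine top_le_iff.1 (le_iInf₂ fun x hx => le_iInf₂ fun y hy => le_iInf fun hxy => ?_)
    exact absurd (h ▸ Finset.mem_offDiag.2 ⟨hx, hy, hxy⟩) (Finset.notMem_empty (x, y))
  · right
    obtain ⟨p, hp, hmin⟩ := O.offDiag.exists_min_image (fun p => I.d p.1 p.2) h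
    rw [Finset.mem_offDiag] at hp
    refine ⟨p.1, p.2, le_antisymm ?_ (le_diversity_iff.2 fun x hx y hy hxy =>
      hmin (x, y) (Finset.mem_offDiag.2 ⟨hx, hy, hxy⟩))⟩
    exact (iInf₂_le p.1 hp.1).trans ((iInf₂_le p.2 hp.2.1).trans (iInf_le _ hp.2.2))

/-- The guess `γ` of the stored set may exceed the optimum. The last two clauses are all that the
ratio needs to know about it. -/
theorem run_mainCode {s : Memory} (h1 : s.nat 1 0 = (n + 1) ^ m)
    (h2 : ∀ i ≤ m, s.nat 2 i = (n + 1) ^ i) (h14 : s.nat 14 0 = 0) :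
    ∃ (γ : ℝ) (T : Finset ℕ), IsResult I γ T ∧
      output n ((mainCode m).run I s) = pointsOf n T ∧
      (opt I = ⊤ → ∀ x y, denom m * I.d x y < γ) ∧
      ∀ x y, opt I = (I.d x y : EReal) → I.d x y ≤ γ := by
  simp only [mainCode, Code.run_seq]
  have hweight := run_weightsCode I h2
  set s₁ := (weightsCode m).run I s with hs₁
  have htwo := run_twoPowersCode I s₁
  set s₂ := twoPowersCode.run I s₁ with hs₂
  have hhuge := (run_hugeCode I s₂).2
  set s₃ := (hugeCode m).run I s₂ with hs₃
  have e1 : s₃.nat 1 = s.nat 1 := by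
    rw [hs₃, Code.run_nat_of_not_mem (of_decide_eq_true rfl), hs₂,
      Code.run_nat_of_not_mem (of_decide_eq_true rfl), hs₁,
      Code.run_nat_of_not_mem (of_decide_eq_true rfl)]
  have e3 : s₃.nat 3 = s₁.nat 3 := by
    rw [hs₃, Code.run_nat_of_not_mem (of_decide_eq_true rfl), hs₂,
      Code.run_nat_of_not_mem (of_decide_eq_true rfl)]
  have e4 : s₃.nat 4 = s₂.nat 4 := by
    rw [hs₃, Code.run_nat_of_not_mem (of_decide_eq_true rfl)]
  have e14 : s₃.nat 14 = s.nat 14 := by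
    rw [hs₃, Code.run_nat_of_not_mem (of_decide_eq_true rfl), hs₂,
      Code.run_nat_of_not_mem (of_decide_eq_true rfl), hs₁,
      Code.run_nat_of_not_mem (of_decide_eq_true rfl)]
  have prog₃ : Progress I (fun _ => False) s₃ := by
    refine ⟨⟨by rw [e1, h1], fun x hx => ?_, fun x hx => by rw [e4, htwo x hx]⟩, fun h => ?_,
      fun γ h => h.elim⟩
    · rw [e3, hweight x hx, weightN]
    · rw [e14] at h
      exact absurd h14 h
  have prog₄ := prog₃.step
  set huge := s₃.real 0 0
  set s₄ := (tryCode m).run I s₃ with hs₄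
  have prog₅ : Progress I (fun γ => γ = huge ∨ ∃ x < n, ∃ y < n, γ = distN I x y)
      ((Code.for_ 30 .size (.for_ 31 .size
        (.setReal 0 (.lit 0) (.dist (var 30) (var 31)) ;; tryCode m))).run I s₄) := by
    refine Code.run_for (fun k s' => Progress I
      (fun γ => γ = huge ∨ ∃ x < k, ∃ y < n, γ = distN I x y) s') rfl ?_ ?_ ?_
    · exact prog₄.congr (by simp) (fun _ _ => rfl) rfl
    · intro x hx s' _ _ hs'
      have key := Code.run_for (I := I) (a := 31) (b := .size) (N := n)
        (p := .setReal 0 (.lit 0) (.dist (var 30) (var 31)) ;; tryCode m)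
        (s := s'.setNat 30 0 x)
        (fun k s'' => Progress I (fun γ => (γ = huge ∨ ∃ x' < x, ∃ y < n, γ = distN I x' y) ∨
          ∃ y < k, γ = distN I x y) s'') rfl ?_ ?_ ?_
      · refine key.congr ?_ (fun _ _ => rfl) rfl
        rintro γ (h | ⟨x', hx', y, hy, h⟩)
        · exact Or.inl (Or.inl h)
        · rcases eq_or_ne x' x with rfl | hne
          · exact Or.inr ⟨y, hy, h⟩
          · exact Or.inl (Or.inr ⟨x', by lia, y, hy, h⟩)
      · exact hs'.congr (by simp) (by simp) (by simp)
      · intro y hy s'' hfix _ hs''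
        have f30 : s''.nat 30 0 = x := by
          rw [hfix 30 (of_decide_eq_true rfl)]
          simp
        rw [Code.run_seq]
        set s₅ := (Code.setReal 0 (.lit 0) (.dist (var 30) (var 31))).run I
          (s''.setNat 31 0 y) with hs₅
        have hγ : s₅.real 0 0 = distN I x y := by simp [hs₅, f30]
        refine (hs''.congr (fun _ h => h) (s' := s₅) (by simp [hs₅])
          (by simp [hs₅])).step.congr ?_ (fun _ _ => rfl) rfl
        rintro γ (h | ⟨y', hy', h⟩)
        · exact Or.inl (Or.inl h)
        · rcases eq_or_ne y' y with rfl | hne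
          · exact Or.inr (h.trans hγ.symm)
          · exact Or.inl (Or.inr ⟨y', by lia, h⟩)
      · intro s'' h
        exact h.congr (fun _ h => h) (by simp) (by simp)
    · intro s' h
      exact h.congr (fun _ h => h) (by simp) (by simp)
  set s₅ := (Code.for_ 30 .size (.for_ 31 .size
    (.setReal 0 (.lit 0) (.dist (var 30) (var 31)) ;; tryCode m))).run I s₄ with hs₅
  have htop : opt I = ⊤ → Success huge s₅ := fun h =>
    prog₅.success huge (Or.inl rfl) (by simp [h])
  have hdist : ∀ x y, opt I = (I.d x y : EReal) → Success (I.d x y) s₅ := fun x y h =>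
    prog₅.success _ (Or.inr ⟨x, x.2, y, y.2, (distN_eq x y).symm⟩) h.ge
  -- In both cases some guess that was tried is at most the optimum, so a set has been stored.
  have hok : s₅.nat 14 0 ≠ 0 := by
    rcases opt_eq_top_or_eq_dist I with h | ⟨x, y, h⟩
    · exact (htop h).1
    · exact (hdist x y h).1
  obtain ⟨T, hT, hcode⟩ := prog₅.best hok
  refine ⟨s₅.real 1 0, T, hT, ?_, fun h x y => ?_, fun x y h => (hdist x y h).2⟩
  · have hdec := run_decodeCode (I := I)
      (s := (Code.setNat 11 (.lit 0) (var 15)).run I s₅) (T := T)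
      (by simpa using prog₅.prepared.two_pow) hT.1 (by simpa using hcode)
    ext x
    rw [output, Finset.mem_filter, hdec x x.2, mem_pointsOf]
    simp
  · rw [← distN_eq x y]
    exact (hhuge x x.2 y y.2).trans_le (htop h).2

theorem countersSafe_powersCode (m : ℕ) : (powersCode m).CountersSafe := by
  simp [powersCode, Code.CountersSafe, Code.writes]

theorem countersSafe_tryCode (m : ℕ) : (tryCode m).CountersSafe := by
  simp [tryCode, selectCode, conflictCode, componentsCode, relabelCode, searchCode, stateCode,
    checkCode, decodeCode, feasibleCode, countCode, recordCode, storeCode, Code.guard,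
    Code.CountersSafe, Code.writes]

theorem countersSafe_mainCode (m : ℕ) : (mainCode m).CountersSafe := by
  have h30 : 30 ∉ (tryCode m).writes := of_decide_eq_true rfl
  have h31 : 31 ∉ (tryCode m).writes := of_decide_eq_true rfl
  simp [mainCode, weightsCode, twoPowersCode, hugeCode, decodeCode, Code.guard,
    Code.CountersSafe, Code.writes, countersSafe_tryCode, h30, h31]

theorem exists_computes_result (m : ℕ) : ∃ q : Polynomial ℕ, ∀ (n : ℕ) (I : Instance m n),
    ∃ (γ : ℝ) (T : Finset ℕ), IsResult I γ T ∧
      Computes I (approxProgram m) (q.eval n) (pointsOf n T) ∧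
      (opt I = ⊤ → ∀ x y, denom m * I.d x y < γ) ∧
      ∀ x y, opt I = (I.d x y : EReal) → I.d x y ≤ γ := by
  refine ⟨(powersCode m).timeBound m + (4 + (mainCode m).timeBound m), fun n I => ?_⟩
  -- The bound register still contains `0` here, and computing the powers does not use it.
  obtain ⟨t₁, ht₁, he₁⟩ := Code.exists_exec (I := I) (countersSafe_powersCode m)
    (of_decide_eq_true rfl) (s := Memory.init) (by simp [Memory.init])
  have hpow := run_powersCode I Memory.init
  have h14 : ((powersCode m).run I Memory.init).nat 14 0 = 0 := by
    rw [Code.run_nat_of_not_mem (of_decide_eq_true rfl)]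
    rfl
  set s₁ := (powersCode m).run I Memory.init
  -- The bound register is set between the two bounded programs, as neither may write to array `1`.
  -- This assignment accounts for the `4` steps in the time bound.
  have he₂ := Exec.setNat (I := I) s₁ 1 (.lit 0) (.get 2 (.lit m))
  set s₂ := s₁.setNat 1 ((NatExp.lit 0).eval I s₁) ((NatExp.get 2 (.lit m)).eval I s₁) with hs₂
  have h1 : s₂.nat 1 0 = (n + 1) ^ m := by simp [hs₂, hpow m le_rfl]
  obtain ⟨t₃, ht₃, he₃⟩ := Code.exists_exec (I := I) (countersSafe_mainCode m)
    (of_decide_eq_true rfl) (s := s₂) h1.le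
  obtain ⟨γ, T, hT, hout, htop, hdist⟩ := run_mainCode (I := I) h1
    (by simpa [hs₂] using hpow) (by simpa [hs₂] using h14)
  refine ⟨γ, T, hT, ⟨_, _, Exec.seq he₁ (Exec.seq he₂ he₃), ?_, hout⟩, htop, hdist⟩
  simp only [Polynomial.eval_add, NatExp.cost, Polynomial.eval_ofNat]
  lia

theorem IsResult.exists_fairPlusFlow {γ : ℝ} {T : Finset ℕ} (h : IsResult I γ T) (R : EdgeRule) :
    (∃ c : Colour m → ℕ, Admissible I c ∧ FairPlusFlow I γ R c (some (pointsOf n T))) ∧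
      Apart I (d2 m γ) (pointsOf n T) := by
  obtain ⟨-, hfeas, Z, hZ, hT⟩ := h
  obtain ⟨c, hc, hout⟩ := hT.exists_outcome hZ hfeas R
  exact ⟨⟨c, hc, Z, hZ, hout⟩, (outcome_sound hc hout).2⟩

/-- If the optimum is infinite, `γ / (3M - 1)` exceeds every distance, so `S` has no two distinct
points. Otherwise `γ` is at least the optimum. -/
theorem mul_opt_le_diversity {γ : ℝ} {S : Finset (Fin n)} (hS : Apart I (d2 m γ) S)
    (htop : opt I = ⊤ → ∀ x y, denom m * I.d x y < γ)
    (hdist : ∀ x y, opt I = (I.d x y : EReal) → I.d x y ≤ γ) :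
    ((1 / (3 * (bigM m : ℝ) - 1) : ℝ) : EReal) * opt I ≤ diversity I S := by
  rcases opt_eq_top_or_eq_dist I with h | ⟨x, y, h⟩
  · refine le_top.trans (le_iInf₂ fun x hx => le_iInf₂ fun y hy => le_iInf fun hxy => ?_)
    have h1 := hS x hx y hy hxy
    have h2 := htop h x y
    rw [d2, ← denom_cast, div_le_iff₀ (denom_cast_pos m)] at h1
    linarith
  · rw [h, ← EReal.coe_mul, le_diversity_iff]
    intro a ha b hb hab
    refine le_trans ?_ (hS a ha b hb hab)
    rw [d2, one_div, inv_mul_eq_div]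
    exact div_le_div_of_nonneg_right (hdist x y h) (denominator_pos m).le

end

end FairDiv

open FairDiv in
theorem mainTheorem5 (m : ℕ) (R : EdgeRule) :
    -- guarantees for Fair⁺-Flow on every instance and for every guess `γ`
    (∀ (n : ℕ) (I : Instance m n) (γ : ℝ),
      -- the algorithm always produces a result
      (∀ c : Colour m → ℕ, ∃ r, FairPlusFlow I γ R c r) ∧
      -- whatever `γ` is, it aborts or returns a feasible set of points that are far apart
      (∀ c : Colour m → ℕ, Admissible I c → ∀ r, FairPlusFlow I γ R c r →
        r = none ∨
          ∃ S, r = some S ∧ Feasible I S ∧ Apart I (γ / (3 * (bigM m : ℝ) - 1)) S) ∧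
      -- if `γ` is at most the optimum, it returns such a set for a correct guess of the counts
      ((γ : EReal) ≤ opt I →
        (R = EdgeRule.atLeast → ∀ O, IsOptimal I O →
          ∀ r, FairPlusFlow I γ R (counts I O) r →
            ∃ S, r = some S ∧ Feasible I S ∧ Apart I (γ / (3 * (bigM m : ℝ) - 1)) S) ∧
        (∀ Z, IsSelection I γ Z → ∃ c : Colour m → ℕ, Admissible I c ∧
          ∀ r, Outcome I γ R c Z r →
            ∃ S, r = some S ∧ Feasible I S ∧ Apart I (γ / (3 * (bigM m : ℝ) - 1)) S))) ∧
    -- polynomial-time approximation by Fair⁺-Flow with suitable guesses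
    (∃ (p : Program) (q : Polynomial ℕ), ∀ (n : ℕ) (I : Instance m n),
      ∃ S, Computes I p (q.eval n) S ∧
        (∃ (γ : ℝ) (c : Colour m → ℕ), Admissible I c ∧ FairPlusFlow I γ R c (some S)) ∧
        Feasible I S ∧
        ((1 / (3 * (bigM m : ℝ) - 1) : ℝ) : EReal) * opt I ≤ diversity I S) := by
  refine ⟨fun n I γ => ⟨fun c => ?_, fun c hc r hr => ?_, fun hγ => ⟨?_, fun Z hZ => ?_⟩⟩, ?_⟩
  · obtain ⟨Z, hZ⟩ := exists_selection I γ
    obtain ⟨r, hr⟩ := exists_outcome (R := R) (c := c) hZ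
    exact ⟨r, Z, hZ, hr⟩
  · obtain ⟨Z, -, hr⟩ := hr
    rcases r with _ | S
    · exact Or.inl rfl
    · exact Or.inr ⟨S, rfl, outcome_sound hc hr⟩
  · rintro rfl O hO r hr
    exact returns_of_isOptimal hO hγ hr
  · exact exists_admissible_returns R hγ hZ
  · obtain ⟨q, hq⟩ := exists_computes_result m
    refine ⟨approxProgram m, q, fun n I => ?_⟩
    obtain ⟨γ, T, hT, hcomp, htop, hdist⟩ := hq n I
    -- The program does not depend on the rule: its transversal is a possible result under either.
    obtain ⟨⟨c, hc, hflow⟩, hapart⟩ := hT.exists_fairPlusFlow R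
    exact ⟨pointsOf n T, hcomp, ⟨γ, c, hc, hflow⟩, hT.2.1,
      mul_opt_le_diversity hapart htop hdist⟩
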